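/- Let $D$ be a (non-empty) knot or link diagram in the plane with $c$ crossings. A state $s$ of $D$ chooses an $A$- or a $B$-splicing at each crossing; let $\alpha(s)$, $\beta(s)$ be the numbers of $A$- and $B$-splicings and $d(s)$ the number of circles obtained after splicing. The Kauffman bracket is $$\langle D\rangle=\sum_s A^{\alpha(s)-\beta(s)}(-A^2-A^{-2})^{d(s)-1}\in\mathbb Z[A,A^{-1}].$$ The $A$-graph $A(D)$ is the multigraph whose vertices are the circles of the all-$A$ state, with one edge for each crossing, joining the circles on its two sides. The diagram $D$ is $A$-adequate if $A(D)$ has no loops. The reduced $A$-graph $A(D)'$ is obtained from $A(D)$ by replacing all edges between the same two vertices by a single one; the number of edges so replaced is its multiplicity. Two distinct edges $E,E'$ of $A(D)'$ with a common vertex $V$ are separated at $V$ if the circle $V$ can be divided into two semicircles (arcs) such that all edges of $A(D)$ reducing to $E$ are attached to $V$ on one of them, and all those reducing to $E'$ on the other one; otherwise $E$ and $E'$ are mixed at $V$. **Theorem.** Suppose that $D$ is $A$-adequate. Let $v$ and $e$ be the numbers of vertices and edges of $A(D)'$, let $\mu$ be the number of edges of $A(D)'$ whose multiplicity in $A(D)$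 is larger than $1$, let $\theta$ be the number of (unordered) pairs of edges of $A(D)'$ mixed at a vertex, and let $\tau$ be the number of triangles in $A(D)'$. Then $$\begin{aligned}\langle D\rangle={}&(-1)^{v-1}A^{c+2v-2}+(-1)^{v-2}(e-v+1)A^{c+2v-6}\\&+(-1)^{v-3}\left(\binom{v-1}{2}-e(v-2)+\mu+\binom e2-\theta-\tau\right)A^{c+2v-10}+R,\end{aligned}$$ where $R\in\mathbb Z[A,A^{-1}]$ contains only powers $A^k$ with $k<c+2v-10$. -/

import Mathlib

open LaurentPolynomial

/-- An (unoriented) link diagram in the plane with set of crossings `X`, up to planar isotopy,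
given as a planar diagram code.

At each crossing `x` the four ends of the two crossing strands are numbered counterclockwise
`(x, 0), (x, 1), (x, 2), (x, 3)`, in such a way that `(x, 0)` and `(x, 2)` are the ends of the
understrand and `(x, 1)` and `(x, 3)` are the ends of the overstrand.  The arcs of the diagram
between crossings join these ends in pairs: `arc` sends each end to the other end of its arc.
In addition there are `loops` simple closed curves without crossings.

The four-valent graph with this rotation system is required to be planar: its faces are the orbits
of "run along the arc, then take the next end counterclockwise", and Euler's formula
`crossings - arcs + faces = 2 * components` is to hold, where `arcs = 2 * crossings`.

A knot diagram is the special case in which the link has one component. -/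
structure LinkDiagram (X : Type*) [Fintype X] where
  arc : X × ZMod 4 → X × ZMod 4
  arc_arc : ∀ a, arc (arc a) = a
  arc_ne : ∀ a, arc a ≠ a
  loops : ℕ
  /-- the diagram is not empty -/
  nonempty : Nonempty X ∨ 0 < loops
  /-- Euler's formula: `faces = crossings + 2 * components` -/
  planar :
    Nat.card (Quot fun a b : X × ZMod 4 => b = ((arc a).1, (arc a).2 + 1)) =
      Fintype.card X +
        2 * Nat.card (Quot fun a b : X × ZMod 4 => b = arc a ∨ b = (a.1, a.2 + 1))

namespace LinkDiagram

variable {X : Type*} [Fintype X] [DecidableEq X]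

/-- A state chooses an `A`- or a `B`-splicing at each crossing; it is given by the set `s` of those
crossings at which the `B`-splicing is chosen.  `splice s` sends each end at a crossing to the end
which it is joined to there.

The two `A`-regions at a crossing are those swept out when the overstrand is turned
counterclockwise to the understrand, i.e. those between the ends `1, 2` and between the ends
`3, 0`.  The `A`-splicing merges them, so it joins the ends `0, 1` and the ends `2, 3`;
the `B`-splicing joins the ends `1, 2` and the ends `3, 0`. -/
def splice (s : Finset X) (a : X × ZMod 4) : X × ZMod 4 :=
  if a.1 ∈ s then (a.1, 3 - a.2) else (a.1, 1 - a.2)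

/-- The circles of the spliced diagram: the classes of ends joined through arcs and splicings,
and the crossingless closed curves. -/
abbrev Circle (D : LinkDiagram X) (s : Finset X) : Type _ :=
  Quot (fun a b : X × ZMod 4 => b = D.arc a ∨ b = splice s a) ⊕ Fin D.loops

/-- The circle through an end. -/
def circleOf (D : LinkDiagram X) (s : Finset X) (a : X × ZMod 4) : D.Circle s :=
  Sum.inl (Quot.mk _ a)

/-- The Kauffman bracket
`∑ s, A ^ (α(s) - β(s)) * (- A ^ 2 - A ^ (-2)) ^ (d(s) - 1)`, a Laurent polynomial in `A = T 1`.
Here `α(s)`, `β(s)` are the numbers of `A`- and `B`-splicings and `d(s) ≥ 1` is the number of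
circles. -/
noncomputable def bracket (D : LinkDiagram X) : ℤ[T;T⁻¹] :=
  ∑ s : Finset X, T ((sᶜ.card : ℤ) - (s.card : ℤ)) *
    (-T 2 - T (-2)) ^ (Nat.card (D.Circle s) - 1)

/-- The `A`-graph is the multigraph whose vertices are the circles of the all-`A` state and whose
edges are the crossings: the edge `x` joins the circle through the ends `0, 1` at `x` with the
circle through the ends `2, 3` at `x`. -/
abbrev AVertex (D : LinkDiagram X) : Type _ := D.Circle ∅

/-- The unordered pair of end vertices of the edge `x` of the `A`-graph. -/
def aEdge (D : LinkDiagram X) (x : X) : Sym2 D.AVertex :=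
  s(D.circleOf ∅ (x, 0), D.circleOf ∅ (x, 2))

/-- A diagram is `A`-adequate if its `A`-graph has no loops. -/
def IsAAdequate (D : LinkDiagram X) : Prop :=
  ∀ x, ¬ (D.aEdge x).IsDiag

/-- The reduced `A`-graph: all multiple edges of the `A`-graph are reduced to one. -/
def reducedAGraph (D : LinkDiagram X) : SimpleGraph D.AVertex :=
  SimpleGraph.fromEdgeSet (Set.range D.aEdge)

/-- The multiplicity in the `A`-graph of an edge of the reduced `A`-graph. -/
noncomputable def multiplicity (D : LinkDiagram X) (E : Sym2 D.AVertex) : ℕ :=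
  {x | D.aEdge x = E}.ncard

/-- Travelling along a circle of the all-`A` state.  Starting from an end `p`, the iterates
`p, aNext p, aNext (aNext p), …` run once around the circle until they return to `p`, and
pass in cyclic order all places of the circle where an edge of the `A`-graph is attached,
each exactly once; the edge attached at `a` is the crossing `a.1`. -/
def aNext (D : LinkDiagram X) (a : X × ZMod 4) : X × ZMod 4 :=
  splice ∅ (D.arc a)

/-- `E` and `E'` are separated at `V`: the circle `V` can be divided into two semicircles, such
that the multiple edge `E` is attached to the first one only and the multiple edge `E'` to the
second one only.  The division is given by a starting point `p` and the number `m` of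
attaching places on the first semicircle. -/
def Separated (D : LinkDiagram X) (V : D.AVertex) (E E' : Sym2 D.AVertex) : Prop :=
  ∃ p : X × ZMod 4, D.circleOf ∅ p = V ∧ ∃ m : ℕ,
    ∀ k < Function.minimalPeriod D.aNext p,
      (D.aEdge (D.aNext^[k] p).1 = E → k < m) ∧
      (D.aEdge (D.aNext^[k] p).1 = E' → m ≤ k)

/-- Two different edges of the reduced `A`-graph with a common vertex `V` are mixed at `V` if they
are not separated at `V`. -/
def Mixed (D : LinkDiagram X) (V : D.AVertex) (E E' : Sym2 D.AVertex) : Prop :=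
  E ≠ E' ∧ E ∈ D.reducedAGraph.edgeSet ∧ E' ∈ D.reducedAGraph.edgeSet ∧ V ∈ E ∧ V ∈ E' ∧
    ¬ D.Separated V E E'

/-- The number of vertices of the (reduced) `A`-graph. -/
noncomputable def v (D : LinkDiagram X) : ℕ := Nat.card D.AVertex

/-- The number of edges of the reduced `A`-graph. -/
noncomputable def e (D : LinkDiagram X) : ℕ := D.reducedAGraph.edgeSet.ncard

/-- The number of edges of the reduced `A`-graph whose multiplicity is larger than one. -/
noncomputable def μ (D : LinkDiagram X) : ℕ :=
  {E | E ∈ D.reducedAGraph.edgeSet ∧ 1 < D.multiplicity E}.ncard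

/-- The number of unordered pairs of edges of the reduced `A`-graph mixed at a vertex. -/
noncomputable def θ (D : LinkDiagram X) : ℕ :=
  {P : Sym2 (Sym2 D.AVertex) | ∃ V E E', P = s(E, E') ∧ D.Mixed V E E'}.ncard

/-- The number of triangles in the reduced `A`-graph. -/
noncomputable def τ (D : LinkDiagram X) : ℕ :=
  {t : Finset D.AVertex | D.reducedAGraph.IsNClique 3 t}.ncard

end LinkDiagram

/-! Write `v + |s| = d(s) + 2k(s)`, where `s` is the set of `B`-spliced crossings. Changing one
splicing changes the number of circles by exactly one (`joined_insert_iff`, which needs planarity),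
so `k(s)`, the `excess`, is a natural number: it counts how often circles merge when the crossings
of `s` are switched one after another. It is monotone in `s`. The term of `s` in the bracket has
leading exponent `c + 2v - 2 - 4k(s)` and leading sign `-(-1)^v (-1)^|s|`, so only states of excess
0, 1 and 2 matter for the three highest coefficients.

Let `T` be the set of reduced edges to which the crossings of `s` belong. By adequacy the excess is
0 only for `s = ∅`, and it is 1 exactly when `T` is a single edge: the first of several parallel
crossings merges two circles, and each further one splits. Summing signs over the nonempty subsets
of a parallel class gives `-1`. Weighting by `|s|`, which enters through the second coefficient of
the power, gives `-1` for a simple edge and `0` for a multiple one. This is the source of `e` and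
`μ`.

For excess 2, four or more edges, or three edges not forming a triangle, already give excess at
least 3. A triangle always gives excess 2 and contributes `-1`. Two disjoint edges always give
excess 2 and contribute `+1`. For two edges meeting at a circle `V`, the excess is 2 exactly when
the chosen places on `V` are unlinked. The signed count of unlinked pairs of nonempty subsets
(`Finset.sum_unlinked`) is 1 if the full classes are unlinked, that is separated, and 0 otherwise.
Altogether this gives `binom e 2 - θ - τ`.

Planarity enters through Euler's formula, which makes every mod 2 cycle of the diagram a boundary.
So there is a checkerboard colouring, and every circle of a state has an inside and an outside,
given by a mod 2 function on the faces (`IsPrimitive`). Statements such as "parallel crossings lie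
on the same side of `V`" become computations with these functions. -/

/-- The Laurent polynomials all of whose terms have exponent less than `N`. -/
def LaurentPolynomial.below (N : ℤ) : AddSubgroup ℤ[T;T⁻¹] where
  carrier := {p | ∀ k, N ≤ k → p.coeff k = 0}
  zero_mem' := by intro k _; simp
  add_mem' := by
    intro a b ha hb k hk
    simp [ha k hk, hb k hk]
  neg_mem' := by
    intro a ha k hk
    simp [ha k hk]

/-! ### Laurent polynomials up to terms of low degree. -/

namespace LaurentPolynomial

theorem below_mono {M N : ℤ} (h : M ≤ N) : below M ≤ below N :=
  fun _ hp k hk => hp k (h.trans hk)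

theorem degree_lt_of_mem_below {N : ℤ} {p : ℤ[T;T⁻¹]} (h : p ∈ below N) :
    p.degree < (N : WithBot ℤ) := by
  rw [degree, Finset.max_eq_sup_withBot, Finset.sup_lt_iff (WithBot.bot_lt_coe N)]
  intro k hk
  rw [Finsupp.mem_support_iff] at hk
  exact WithBot.coe_lt_coe.2 (lt_of_not_ge fun hN => hk (h k hN))

theorem C_mul_T_mem_below {N k : ℤ} (a : ℤ) (h : k < N) : C a * T k ∈ below N := by
  intro j hj
  rw [← single_eq_C_mul_T, AddMonoidAlgebra.coeff_single, Finsupp.single_apply,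
    if_neg (by omega)]

theorem T_mem_below {N k : ℤ} (h : k < N) : (T k : ℤ[T;T⁻¹]) ∈ below N := by
  simpa using C_mul_T_mem_below 1 h

theorem C_mul_mem_below {N : ℤ} (a : ℤ) {p : ℤ[T;T⁻¹]} (h : p ∈ below N) : C a * p ∈ below N := by
  have : C a * p = a • p := by simp
  rw [this]
  exact AddSubgroup.zsmul_mem _ h a

theorem T_mul_mem_below {N : ℤ} (n : ℤ) {p : ℤ[T;T⁻¹]} (h : p ∈ below N) :
    T n * p ∈ below (n + N) := by
  intro k hk
  have : (T n * p).coeff k = p.coeff (k - n) := by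
    rw [T]
    have := AddMonoidAlgebra.coeff_single_mul_add p (1 : ℤ) n (k - n)
    simpa using this
  rw [this]
  exact h _ (by omega)

/-- The three highest terms of a power of `-T 2 - T (-2)`. -/
theorem neg_T_sub_T_pow (n : ℕ) :
    (-T 2 - T (-2) : ℤ[T;T⁻¹]) ^ n - C ((-1) ^ n) * (T (2 * n) + C (n : ℤ) * T (2 * n - 4) +
      C (n.choose 2 : ℤ) * T (2 * n - 8)) ∈ below (2 * n - 8) := by
  induction n with
  | zero => simp
  | succ n ih =>
    set E := (-T 2 - T (-2) : ℤ[T;T⁻¹]) ^ n - C ((-1) ^ n) * (T (2 * n) + C (n : ℤ) * T (2 * n - 4) +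
      C (n.choose 2 : ℤ) * T (2 * n - 8)) with hE
    have h1 : (-T 2 - T (-2) : ℤ[T;T⁻¹]) ^ n = E + C ((-1) ^ n) * (T (2 * n) +
        C (n : ℤ) * T (2 * n - 4) + C (n.choose 2 : ℤ) * T (2 * n - 8)) := by
      rw [hE]; ring
    -- Multiplying the three leading terms by `-T 2 - T (-2)` reproduces the next three by Pascal's
    -- rule; only the product of the third term with `-T (-2)` is left over, and it has exponent `2n
    -- - 10`.
    have h2 : (-T 2 - T (-2) : ℤ[T;T⁻¹]) ^ (n + 1) - C ((-1) ^ (n + 1)) *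
        (T (2 * (n + 1 : ℕ)) + C ((n + 1 : ℕ) : ℤ) * T (2 * (n + 1 : ℕ) - 4) +
        C ((n + 1).choose 2 : ℤ) * T (2 * (n + 1 : ℕ) - 8)) =
        - (T 2 * E) - T (-2) * E + C ((-1) ^ (n + 1) * (n.choose 2 : ℤ)) * T (2 * n - 10) := by
      rw [pow_succ, h1, Nat.choose_succ_succ' n 1, Nat.choose_one_right]
      have e1 : (T (2 * (n + 1 : ℕ)) : ℤ[T;T⁻¹]) = T (2 * n) * T 2 := by
        rw [← T_add]; congr 1
      have e2 : (T (2 * (n + 1 : ℕ) - 4) : ℤ[T;T⁻¹]) = T (2 * n - 4) * T 2 := by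
        rw [← T_add]; congr 1; push_cast; ring
      have e3 : (T (2 * (n + 1 : ℕ) - 8) : ℤ[T;T⁻¹]) = T (2 * n - 8) * T 2 := by
        rw [← T_add]; congr 1; push_cast; ring
      have e4 : (T (2 * n - 4) * T 2 : ℤ[T;T⁻¹]) = T (2 * n) * T (-2) := by
        rw [← T_add, ← T_add]; congr 1; ring
      have e5 : (T (2 * n - 8) * T 2 : ℤ[T;T⁻¹]) = T (2 * n - 4) * T (-2) := by
        rw [← T_add, ← T_add]; congr 1; ring
      have e6 : (T (2 * n - 10) : ℤ[T;T⁻¹]) = T (2 * n - 8) * T (-2) := by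
        rw [← T_add]; congr 1; ring
      rw [e1, e2, e3, e6]
      push_cast
      simp only [map_add, map_mul, map_pow, map_neg, map_one]
      linear_combination ((-1) ^ n * (C (n : ℤ)) * (1:ℤ[T;T⁻¹]) + (-1) ^ n - (-1) ^ n * (C (n : ℤ)) ) * e4
        + ((-1) ^ n * (C (n : ℤ))) * e5
    rw [h2]
    have hn : (2 * (n + 1 : ℕ) - 8 : ℤ) = 2 + (2 * n - 8) := by push_cast; ring
    rw [hn]
    refine add_mem (sub_mem (neg_mem (T_mul_mem_below 2 ih)) ?_) (C_mul_T_mem_below _ (by omega))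
    exact below_mono (by omega) (T_mul_mem_below (-2) ih)

end LaurentPolynomial

/-! ### Signed sums over subsets. -/

namespace Finset

/-- Summed over all `T' ⊆ T`, the left side runs over all subsets of the preimage of `T` and gives 1
or 0 according to whether `T` is empty, as the right side does. Induction on `T` then isolates the
summand of `T` itself. This lets a whole parallel class count like one edge. -/
theorem sum_powerset_image_eq {α β : Type*} [DecidableEq α] [DecidableEq β] (A : Finset α)
    (f : α → β) {T : Finset β} (hT : T ⊆ A.image f) :
    ∑ S ∈ A.powerset with S.image f = T, (-1 : ℤ) ^ S.card = (-1) ^ T.card := by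
  induction T using Finset.strongInduction with
  | H T ih =>
    have h1 : ∑ T' ∈ T.powerset, ∑ S ∈ A.powerset with S.image f = T', (-1 : ℤ) ^ S.card =
        ∑ T' ∈ T.powerset, (-1 : ℤ) ^ T'.card := by
      rw [sum_powerset_neg_one_pow_card]
      have h2 : ∑ T' ∈ T.powerset, ∑ S ∈ A.powerset with S.image f = T', (-1 : ℤ) ^ S.card =
          ∑ S ∈ (A.filter (f · ∈ T)).powerset, (-1 : ℤ) ^ S.card := by
        rw [← sum_fiberwise_of_maps_to (s := (A.filter (f · ∈ T)).powerset) (t := T.powerset)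
          (g := fun S => S.image f)]
        · refine sum_congr rfl fun T' hT' => sum_congr ?_ fun _ _ => rfl
          rw [mem_powerset] at hT'
          ext S
          simp only [mem_filter, mem_powerset]
          constructor
          · rintro ⟨hS, rfl⟩
            exact ⟨fun x hx => mem_filter.2 ⟨hS hx, hT' (mem_image_of_mem f hx)⟩, rfl⟩
          · rintro ⟨hS, h⟩
            exact ⟨hS.trans (filter_subset _ _), h⟩
        · intro S hS
          rw [mem_powerset] at hS ⊢
          intro y hy
          obtain ⟨x, hx, rfl⟩ := mem_image.1 hy
          exact (mem_filter.1 (hS hx)).2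
      rw [h2, sum_powerset_neg_one_pow_card]
      congr 1
      rw [eq_iff_iff, filter_eq_empty_iff]
      constructor
      · intro h
        rw [eq_empty_iff_forall_notMem]
        intro y hy
        obtain ⟨x, hx, rfl⟩ := mem_image.1 (hT hy)
        exact h hx hy
      · rintro rfl x _
        simp
    rw [← insert_erase (mem_powerset_self T), sum_insert (notMem_erase _ _),
      sum_insert (notMem_erase _ _)] at h1
    have h3 : ∑ T' ∈ T.powerset.erase T, ∑ S ∈ A.powerset with S.image f = T', (-1 : ℤ) ^ S.card =
        ∑ T' ∈ T.powerset.erase T, (-1 : ℤ) ^ T'.card := by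
      refine sum_congr rfl fun T' hT' => ?_
      rw [mem_erase, mem_powerset] at hT'
      exact ih T' (hT'.2.ssubset_of_ne hT'.1) (hT'.2.trans hT)
    linarith

/-- This is the value at `x = 1` of `x` times the derivative of `(1 - x)^n`, which vanishes unless
`n = 1`. It is what distinguishes simple edges from multiple ones and produces `μ`. -/
theorem sum_powerset_neg_one_pow_card_mul_card {α : Type*} [DecidableEq α] (A : Finset α) :
    ∑ S ∈ A.powerset, (-1 : ℤ) ^ S.card * S.card = if A.card = 1 then -1 else 0 := by
  induction A using Finset.induction_on with
  | empty => simp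
  | insert a A ha ih =>
    rw [sum_powerset_insert ha, ← sum_add_distrib]
    have : ∀ S ∈ A.powerset, (-1 : ℤ) ^ S.card * S.card +
        (-1 : ℤ) ^ (insert a S).card * (insert a S).card = -(-1 : ℤ) ^ S.card := by
      intro S hS
      rw [card_insert_of_notMem fun h => ha (mem_powerset.1 hS h)]
      push_cast
      ring
    rw [sum_congr rfl this, sum_neg_distrib, sum_powerset_neg_one_pow_card, card_insert_of_notMem ha]
    by_cases h : A = ∅
    · simp [h]
    · have : A.card ≠ 0 := by simpa using h
      simp [h]

/-- Two sets of places on a circle, given by their positions `p` along the circle, can be separated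
from each other: no two places of the first set are separated by the second one. -/
def Unlinked {α : Type*} (p : α → ℕ) (A B : Finset α) : Prop :=
  ∀ a ∈ A, ∀ a' ∈ A, p a < p a' →
    (∀ b ∈ B, ¬ (p a < p b ∧ p b < p a')) ∨ (∀ b ∈ B, p a < p b ∧ p b < p a')

-- Only places before all of `B` or after all of `B` may occur in `S`, and both kinds must occur.
-- Mapping such places to `Bool` by their kind, this counts the sets with image all of `Bool`, so
-- `sum_powerset_image_eq` gives `(-1)^2` or an empty sum.
open Classical in
theorem sum_unlinked_outside {α : Type*} (p : α → ℕ) (A B : Finset α)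
    (hB : B.Nonempty) :
    ∑ S ∈ A.powerset, (-1 : ℤ) ^ S.card *
      (if (∀ a ∈ S, (∀ b ∈ B, p a < p b) ∨ ∀ b ∈ B, p b < p a) ∧
        (∃ a ∈ S, ∀ b ∈ B, p a < p b) ∧ (∃ a ∈ S, ∀ b ∈ B, p b < p a) then 1 else 0) =
    if (∃ a ∈ A, ∀ b ∈ B, p a < p b) ∧ (∃ a ∈ A, ∀ b ∈ B, p b < p a) then 1 else 0 := by
  obtain ⟨b₀, hb₀⟩ := hB
  set A' := A.filter fun a => (∀ b ∈ B, p a < p b) ∨ ∀ b ∈ B, p b < p a with hA'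
  set f : α → Bool := fun a => decide (∀ b ∈ B, p a < p b) with hf
  have key : ∀ S : Finset α, S ⊆ A' → ((univ : Finset Bool) ⊆ S.image f ↔
      (∃ a ∈ S, ∀ b ∈ B, p a < p b) ∧ (∃ a ∈ S, ∀ b ∈ B, p b < p a)) := by
    intro S hS
    constructor
    · intro h
      obtain ⟨a, ha, h1⟩ := mem_image.1 (h (mem_univ true))
      obtain ⟨a', ha', h2⟩ := mem_image.1 (h (mem_univ false))
      simp only [hf, decide_eq_true_eq, decide_eq_false_iff_not] at h1 h2
      exact ⟨⟨a, ha, h1⟩, ⟨a', ha', (mem_filter.1 (hS ha')).2.resolve_left h2⟩⟩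
    · rintro ⟨⟨a, ha, h1⟩, ⟨a', ha', h2⟩⟩ y -
      rw [mem_image]
      cases y
      · refine ⟨a', ha', ?_⟩
        simp only [hf, decide_eq_false_iff_not]
        intro h
        exact absurd (h _ hb₀) (h2 _ hb₀).not_gt
      · exact ⟨a, ha, by simpa [hf] using h1⟩
  have e1 : ∑ S ∈ A.powerset, (-1 : ℤ) ^ S.card *
      (if (∀ a ∈ S, (∀ b ∈ B, p a < p b) ∨ ∀ b ∈ B, p b < p a) ∧
        (∃ a ∈ S, ∀ b ∈ B, p a < p b) ∧ (∃ a ∈ S, ∀ b ∈ B, p b < p a) then 1 else 0) =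
      ∑ S ∈ A'.powerset with S.image f = univ, (-1 : ℤ) ^ S.card := by
    simp_rw [mul_ite, mul_one, mul_zero]
    rw [← sum_filter]
    refine sum_congr ?_ fun _ _ => rfl
    ext S
    simp only [mem_filter, mem_powerset]
    constructor
    · rintro ⟨hS, h1, h2⟩
      have hS' : S ⊆ A' := fun a ha => mem_filter.2 ⟨hS ha, h1 a ha⟩
      exact ⟨hS', univ_subset_iff.1 ((key S hS').2 h2)⟩
    · rintro ⟨hS, h⟩
      exact ⟨hS.trans (filter_subset _ _), fun a ha => (mem_filter.1 (hS ha)).2,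
        (key S hS).1 (univ_subset_iff.2 h)⟩
  rw [e1]
  have hA : (univ : Finset Bool) ⊆ A'.image f ↔
      (∃ a ∈ A, ∀ b ∈ B, p a < p b) ∧ (∃ a ∈ A, ∀ b ∈ B, p b < p a) := by
    rw [key A' subset_rfl]
    simp only [hA', mem_filter]
    constructor
    · rintro ⟨⟨a, ha, h⟩, ⟨a', ha', h'⟩⟩
      exact ⟨⟨a, ha.1, h⟩, ⟨a', ha'.1, h'⟩⟩
    · rintro ⟨⟨a, ha, h⟩, ⟨a', ha', h'⟩⟩
      exact ⟨⟨a, ⟨ha, Or.inl h⟩, h⟩, ⟨a', ⟨ha', Or.inr h'⟩, h'⟩⟩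
  split_ifs with h
  · rw [sum_powerset_image_eq A' f (hA.2 h)]
    simp
  · refine sum_eq_zero fun S hS => ?_
    rw [mem_filter, mem_powerset] at hS
    exact absurd (hA.1 (hS.2 ▸ image_subset_image hS.1)) h

open Classical in
/-- The signed number of pairs of nonempty subsets of two sets of places on a circle which are
not linked with each other. -/
theorem sum_unlinked {α : Type*} (p : α → ℕ) (A B : Finset α) (hAB : ∀ a ∈ A, ∀ b ∈ B, p a ≠ p b)
    (hA : A.Nonempty) {y : α} (hy : y ∈ B) (hpy : p y = 0) :
    ∑ S ∈ A.powerset, ∑ S' ∈ B.powerset, (-1 : ℤ) ^ S.card * (-1 : ℤ) ^ S'.card *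
      (if S.Nonempty ∧ S'.Nonempty ∧ Unlinked p S S' then 1 else 0) =
    if Unlinked p A B then 1 else 0 := by
  have hlt : ∀ a ∈ A, p y < p a := fun a ha => by
    have := hAB a ha y hy
    omega
  obtain ⟨B', hyB', rfl⟩ : ∃ B', y ∉ B' ∧ insert y B' = B :=
    ⟨B.erase y, notMem_erase _ _, insert_erase hy⟩
  -- the sum over the subsets of `B` for fixed `S`
  have h1 : ∀ S ∈ A.powerset, ∑ S' ∈ (insert y B').powerset,
      (-1 : ℤ) ^ S.card * (-1 : ℤ) ^ S'.card *
        (if S.Nonempty ∧ S'.Nonempty ∧ Unlinked p S S' then 1 else 0) =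
      -((-1 : ℤ) ^ S.card * if S.Nonempty then 1 else 0) +
      ∑ S' ∈ B'.powerset, (if S'.Nonempty then (-1 : ℤ) ^ S'.card else 0) * ((-1 : ℤ) ^ S.card *
      (if (∀ a ∈ S, (∀ b ∈ S', p a < p b) ∨ ∀ b ∈ S', p b < p a) ∧
        (∃ a ∈ S, ∀ b ∈ S', p a < p b) ∧ (∃ a ∈ S, ∀ b ∈ S', p b < p a) then 1 else 0)) := by
    intro S hS
    rw [mem_powerset] at hS
    have hempty : (∅ : Finset α) ∈ B'.powerset := empty_mem_powerset _
    rw [sum_powerset_insert hyB', ← sum_add_distrib, ← add_sum_erase _ _ hempty,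
      ← add_sum_erase (B'.powerset) (fun S' => (if S'.Nonempty then (-1 : ℤ) ^ S'.card else 0) *
      ((-1 : ℤ) ^ S.card * _)) hempty]
    rw [← add_assoc]
    congr 1
    -- The pair `∅`, `{y}` contributes only through `{y}`, since one place is never linked with
    -- anything that comes after it.
    · have : Unlinked p S {y} := by
        intro a ha a' ha' _
        left
        intro b hb
        rw [mem_singleton] at hb
        have := hlt a (hS ha)
        subst hb
        omega
      by_cases hSn : S.Nonempty <;> simp [this, hSn]
    · refine sum_congr rfl fun S' hS' => ?_
      rw [mem_erase, mem_powerset] at hS'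
      obtain ⟨hne, hS'⟩ := hS'
      have hne : S'.Nonempty := nonempty_iff_ne_empty.2 hne
      have hyS' : y ∉ S' := fun h => hyB' (hS' h)
      rw [card_insert_of_notMem hyS', pow_succ]
      simp only [hne, insert_nonempty, true_and, if_true]
      by_cases hSn : S.Nonempty
      swap
      · rw [not_nonempty_iff_eq_empty] at hSn
        subst hSn
        simp
      simp only [hSn, true_and]
      have hABS : ∀ a ∈ S, ∀ b ∈ S', p a ≠ p b :=
        fun a ha b hb => hAB a (hS ha) b (mem_insert_of_mem (hS' hb))
      have hins : Unlinked p S (insert y S') ↔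
          ∀ a ∈ S, ∀ a' ∈ S, ∀ b ∈ S', ¬ (p a < p b ∧ p b < p a') := by
        constructor
        · intro h a ha a' ha' b hb hab
          rcases h a ha a' ha' (by omega) with h | h
          · exact h b (mem_insert_of_mem hb) hab
          · have := h y (mem_insert_self _ _)
            omega
        · intro h a ha a' ha' _
          left
          intro b hb
          rw [mem_insert] at hb
          rcases hb with rfl | hb
          · have := hlt a (hS ha)
            omega
          · exact h a ha a' ha' b hb
      -- `S'` and `insert y S'` have opposite signs and cancel unless exactly one of them is
      -- unlinked with `S`. As `y` precedes all of `A`, this happens precisely when `S'` sits in one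
      -- inner gap of `S`, which is `Q`: adding `y` then links the two sets.
      set Q := (∀ a ∈ S, (∀ b ∈ S', p a < p b) ∨ ∀ b ∈ S', p b < p a) ∧
        (∃ a ∈ S, ∀ b ∈ S', p a < p b) ∧ (∃ a ∈ S, ∀ b ∈ S', p b < p a) with hQ
      have hdich : Unlinked p S S' ↔ Unlinked p S (insert y S') ∨ Q := by
        rw [hins]
        constructor
        · intro h
          by_contra hcon
          rw [not_or] at hcon
          obtain ⟨h1, h2⟩ := hcon
          push Not at h1
          obtain ⟨a, ha, a', ha', b, hb, hab, hba'⟩ := h1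
          have h3 : ∀ b ∈ S', p a < p b ∧ p b < p a' := by
            rcases h a ha a' ha' (by omega) with h | h
            · exact absurd ⟨hab, hba'⟩ (h b hb)
            · exact h
          refine h2 ⟨?_, ⟨a, ha, fun b hb => (h3 b hb).1⟩, ⟨a', ha', fun b hb => (h3 b hb).2⟩⟩
          intro c hc
          rcases lt_or_gt_of_ne (hABS c hc b hb) with hcb | hcb
          · left
            rcases h c hc a' ha' (by omega) with h | h
            · exact absurd ⟨hcb, hba'⟩ (h b hb)
            · exact fun b hb => (h b hb).1
          · right
            rcases h a ha c hc (by omega) with h | h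
            · exact absurd ⟨hab, hcb⟩ (h b hb)
            · exact fun b hb => (h b hb).2
        · rintro (h | ⟨h, -, -⟩) a ha a' ha' haa'
          · exact Or.inl fun b hb => h a ha a' ha' b hb
          · rcases h a ha with h1 | h1
            · rcases h a' ha' with h2 | h2
              · left
                intro b hb
                have := h2 b hb
                omega
              · exact Or.inr fun b hb => ⟨h1 b hb, h2 b hb⟩
            · left
              intro b hb
              have := h1 b hb
              omega
      have hexcl : ¬ (Unlinked p S (insert y S') ∧ Q) := by
        rw [hins]
        rintro ⟨h, -, ⟨a, ha, h1⟩, ⟨a', ha', h2⟩⟩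
        obtain ⟨b, hb⟩ := hne
        exact h a ha a' ha' b hb ⟨h1 b hb, h2 b hb⟩
      simp only [← hQ]
      by_cases hU : Unlinked p S (insert y S')
      · have hQ' : ¬ Q := fun h => hexcl ⟨hU, h⟩
        simp [hdich, hU, hQ']
      · simp only [hdich, hU, false_or, if_false]
        ring
  rw [sum_congr rfl h1, sum_add_distrib, sum_comm]
  have h2 : ∑ S ∈ A.powerset, -((-1 : ℤ) ^ S.card * if S.Nonempty then 1 else 0) = 1 := by
    rw [← add_sum_erase _ _ (empty_mem_powerset A)]
    have := sum_powerset_neg_one_pow_card_of_nonempty hA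
    rw [← add_sum_erase _ _ (empty_mem_powerset A)] at this
    have h3 : ∑ S ∈ A.powerset.erase ∅, -((-1 : ℤ) ^ S.card * if S.Nonempty then 1 else 0) =
        - ∑ S ∈ A.powerset.erase ∅, (-1 : ℤ) ^ S.card := by
      rw [← sum_neg_distrib]
      refine sum_congr rfl fun S hS => ?_
      simp [nonempty_iff_ne_empty, (mem_erase.1 hS).1]
    rw [h3]
    simp at this ⊢
    linarith
  rw [h2]
  -- `M` consists of the places of `B'` strictly between the first and the last place of `A`. The
  -- nonempty `S' ⊆ M` sum to `[M = ∅] - 1`, which together with the 1 from `{y}` gives `[M = ∅]`.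
  -- Since `y` comes first, `M = ∅` means that `A` and `B` are unlinked.
  set M := B'.filter fun b => (∃ a ∈ A, p a < p b) ∧ ∃ a ∈ A, p b < p a with hM
  have h4 : ∀ S' ∈ B'.powerset, ∑ S ∈ A.powerset, (if S'.Nonempty then (-1 : ℤ) ^ S'.card else 0) *
      ((-1 : ℤ) ^ S.card *
      (if (∀ a ∈ S, (∀ b ∈ S', p a < p b) ∨ ∀ b ∈ S', p b < p a) ∧
        (∃ a ∈ S, ∀ b ∈ S', p a < p b) ∧ (∃ a ∈ S, ∀ b ∈ S', p b < p a) then 1 else 0)) =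
      if S' ⊆ M then (-1 : ℤ) ^ S'.card - (if S' = ∅ then 1 else 0) else 0 := by
    intro S' hS'
    rw [mem_powerset] at hS'
    by_cases hne : S'.Nonempty
    swap
    · rw [not_nonempty_iff_eq_empty] at hne
      subst hne
      simp
    rw [← mul_sum, sum_unlinked_outside p A S' hne, if_pos hne]
    have : ((∃ a ∈ A, ∀ b ∈ S', p a < p b) ∧ ∃ a ∈ A, ∀ b ∈ S', p b < p a) ↔ S' ⊆ M := by
      constructor
      · rintro ⟨⟨a, ha, h⟩, ⟨a', ha', h'⟩⟩ b hb
        exact mem_filter.2 ⟨hS' hb, ⟨a, ha, h b hb⟩, ⟨a', ha', h' b hb⟩⟩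
      · intro h
        obtain ⟨a, ha, hmin⟩ := exists_min_image A p hA
        obtain ⟨a', ha', hmax⟩ := exists_max_image A p hA
        refine ⟨⟨a, ha, fun b hb => ?_⟩, ⟨a', ha', fun b hb => ?_⟩⟩
        · obtain ⟨c, hc, hcb⟩ := (mem_filter.1 (h hb)).2.1
          exact (hmin c hc).trans_lt hcb
        · obtain ⟨c, hc, hcb⟩ := (mem_filter.1 (h hb)).2.2
          exact hcb.trans_le (hmax c hc)
    simp [this, nonempty_iff_ne_empty.1 hne]
  rw [sum_congr rfl h4, ← sum_filter]
  have h5 : B'.powerset.filter (· ⊆ M) = M.powerset := by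
    ext S'
    simp only [mem_filter, mem_powerset]
    exact ⟨fun h => h.2, fun h => ⟨h.trans (filter_subset _ _), h⟩⟩
  rw [h5, sum_sub_distrib, sum_powerset_neg_one_pow_card, sum_ite_eq' M.powerset ∅,
    if_pos (empty_mem_powerset M)]
  have h6 : M = ∅ ↔ Unlinked p A (insert y B') := by
    rw [hM, filter_eq_empty_iff]
    constructor
    · intro h a ha a' ha' _
      left
      intro b hb hab
      rw [mem_insert] at hb
      rcases hb with rfl | hb
      · have := hlt a ha
        omega
      · exact h hb ⟨⟨a, ha, hab.1⟩, ⟨a', ha', hab.2⟩⟩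
    · rintro h b hb ⟨⟨a, ha, hab⟩, ⟨a', ha', hba⟩⟩
      rcases h a ha a' ha' (by omega) with h | h
      · exact h b (mem_insert_of_mem hb) ⟨hab, hba⟩
      · have := h y (mem_insert_self _ _)
        omega
  simp [h6]

end Finset

/-! ### Mod 2 cycles and boundaries of a planar diagram. -/

namespace LinkDiagram

section Cohomology

variable {X : Type*}

/-- The next end counterclockwise at the same crossing. -/
def ccw (a : X × ZMod 4) : X × ZMod 4 := (a.1, a.2 + 1)

theorem ccw_ccw_ccw_ccw (a : X × ZMod 4) : ccw (ccw (ccw (ccw a))) = a := by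
  ext
  · rfl
  · change a.2 + 1 + 1 + 1 + 1 = a.2
    have : (1 + 1 + 1 + 1 : ZMod 4) = 0 := by decide
    linear_combination this

theorem zmod_four_sum {M : Type*} [AddCommMonoid M] (f : ZMod 4 → M) :
    ∑ i, f i = f 0 + f 1 + f 2 + f 3 := Fin.sum_univ_four f

variable [Fintype X]

theorem arc_eq_iff (D : LinkDiagram X) {a b : X × ZMod 4} : D.arc a = b ↔ a = D.arc b :=
  ⟨fun h => by rw [← h, D.arc_arc], fun h => by rw [h, D.arc_arc]⟩

/-- The arcs of the diagram between the crossings. -/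
abbrev Arc (D : LinkDiagram X) : Type _ := Quot fun a b : X × ZMod 4 => b = D.arc a

/-- The faces of the diagram, as orbits of ends; the face of the end `a` is the one of the corner
between `a` and the preceding end. -/
abbrev Face (D : LinkDiagram X) : Type _ :=
  Quot fun a b : X × ZMod 4 => b = ((D.arc a).1, (D.arc a).2 + 1)

/-- The connected components of the diagram which have crossings. -/
abbrev Component (D : LinkDiagram X) : Type _ :=
  Quot fun a b : X × ZMod 4 => b = D.arc a ∨ b = (a.1, a.2 + 1)

theorem arc_mk_eq_iff (D : LinkDiagram X) {a b : X × ZMod 4} :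
    (Quot.mk _ a : D.Arc) = Quot.mk _ b ↔ b = a ∨ b = D.arc a := by
  constructor
  · intro h
    have := congrArg (Quot.lift (fun c => c = a ∨ c = D.arc a) (by
      rintro c _ rfl
      rw [D.arc_eq_iff, D.arc_eq_iff, D.arc_arc, or_comm])) h
    exact this.mp (Or.inl rfl)
  · rintro (rfl | rfl)
    · rfl
    · exact Quot.sound rfl

/-- Each arc has two distinct ends, namely a representative and its image under `arc`. -/
theorem two_mul_card_arc_le (D : LinkDiagram X) : 2 * Nat.card D.Arc ≤ 4 * Fintype.card X := by
  classical
  have hinj : Function.Injective fun q : D.Arc × Bool => if q.2 then q.1.out else D.arc q.1.out := by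
    rintro ⟨q, b⟩ ⟨q', b'⟩ h
    have hq : ∀ (q : D.Arc) (b : Bool),
        Quot.mk _ (if b then q.out else D.arc q.out) = q := by
      intro q b
      cases b
      · have : (Quot.mk _ (D.arc q.out) : D.Arc) = Quot.mk _ q.out :=
          D.arc_mk_eq_iff.2 (Or.inr (D.arc_arc _).symm)
        simpa using this.trans q.out_eq
      · simp
    have h1 : q = q' := by
      rw [← hq q b, ← hq q' b']
      exact congrArg _ h
    subst h1
    have h2 := D.arc_ne q.out
    cases b <;> cases b' <;> first | rfl | exact absurd h h2 | exact absurd h.symm h2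
  have := Nat.card_le_card_of_injective _ hinj
  rw [Nat.card_prod, Nat.card_prod] at this
  simp at this
  omega

/-- The boundary map from chains of arcs to chains of crossings. -/
noncomputable def boundary (D : LinkDiagram X) [DecidableEq D.Arc] : Matrix X D.Arc (ZMod 2) :=
  Matrix.of fun x q => ∑ i : ZMod 4, if (Quot.mk _ (x, i) : D.Arc) = q then 1 else 0

/-- The transpose of the boundary has as kernel functions on crossings that agree along arcs, hence
are constant on components. So the boundary has rank at least crossings minus components, and there
are at most twice as many arcs as crossings. -/
theorem finrank_ker_boundary_le (D : LinkDiagram X) [DecidableEq D.Arc] [Fintype D.Arc] :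
    Module.finrank (ZMod 2) (LinearMap.ker D.boundary.mulVecLin) ≤
      Fintype.card X + Nat.card D.Component := by
  classical
  have : Fintype D.Component := Fintype.ofFinite _
  have h1 := LinearMap.finrank_range_add_finrank_ker D.boundary.mulVecLin
  have h2 := LinearMap.finrank_range_add_finrank_ker D.boundary.transpose.mulVecLin
  have hr : D.boundary.transpose.rank = D.boundary.rank := Matrix.rank_transpose _
  rw [Matrix.rank, Matrix.rank] at hr
  rw [Module.finrank_fintype_fun_eq_card] at h1 h2
  have hA := D.two_mul_card_arc_le
  rw [Nat.card_eq_fintype_card] at hA ⊢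
  have h3 : Module.finrank (ZMod 2) (LinearMap.ker D.boundary.transpose.mulVecLin) ≤
      Fintype.card D.Component := by
    let L : LinearMap.ker D.boundary.transpose.mulVecLin →ₗ[ZMod 2] (D.Component → ZMod 2) :=
      { toFun := fun h => Quot.lift (fun a => h.1 a.1) (by
          rintro a b hab
          have hh := h.2
          rw [LinearMap.mem_ker] at hh
          rcases hab with rfl | rfl
          swap
          · rfl
          have := congrFun hh (Quot.mk _ a)
          simp only [Matrix.mulVecLin_apply, Matrix.mulVec, dotProduct, Matrix.transpose_apply,
            boundary, Matrix.of_apply, Finset.sum_mul, Pi.zero_apply] at this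
          rw [← Fintype.sum_prod_type' (f := fun x i => (if (Quot.mk _ (x, i) : D.Arc) =
            Quot.mk _ a then 1 else 0) * h.1 x)] at this
          simp only [Prod.mk.eta, ite_mul, one_mul, zero_mul] at this
          rw [← Finset.sum_filter] at this
          have hf : (Finset.univ.filter fun b : X × ZMod 4 => (Quot.mk _ b : D.Arc) =
              Quot.mk _ a) = {a, D.arc a} := by
            ext b
            simp only [Finset.mem_filter, Finset.mem_univ, true_and, Finset.mem_insert,
              Finset.mem_singleton]
            rw [eq_comm, arc_mk_eq_iff]
          rw [hf, Finset.sum_pair (D.arc_ne a).symm] at this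
          exact CharTwo.add_eq_zero.1 this)
        map_add' := by
          intro h h'
          ext q
          induction q using Quot.ind
          rfl
        map_smul' := by
          intro c h
          ext q
          induction q using Quot.ind
          rfl }
    have hL : Function.Injective L := by
      intro h h' e
      ext x
      exact congrFun e (Quot.mk _ (x, 0))
    have := LinearMap.finrank_le_finrank_of_injective hL
    rwa [Module.finrank_fintype_fun_eq_card] at this
  omega

/-- The coboundary from functions on faces to functions on arcs. -/
noncomputable def coboundary (D : LinkDiagram X) :
    (D.Face → ZMod 2) →ₗ[ZMod 2] (D.Arc → ZMod 2) where
  toFun F := Quot.lift (fun a => F (Quot.mk _ a) + F (Quot.mk _ (ccw a))) (by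
    rintro a _ rfl
    have h1 : (Quot.mk _ a : D.Face) = Quot.mk _ (ccw (D.arc a)) := Quot.sound rfl
    have h2 : (Quot.mk _ (D.arc a) : D.Face) = Quot.mk _ (ccw a) :=
      Quot.sound (by rw [D.arc_arc]; rfl)
    rw [h1, h2, add_comm])
  map_add' F G := by
    ext q
    induction q using Quot.ind
    simp only [Pi.add_apply]
    ring
  map_smul' c F := by
    ext q
    induction q using Quot.ind
    simp only [Pi.smul_apply, smul_eq_mul, RingHom.id_apply]
    ring

/-- A face function with zero coboundary is constant on components, and Euler's formula gives
`crossings + 2 * components` faces. This is the only place where planarity is used directly. -/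
theorem le_finrank_range_coboundary (D : LinkDiagram X) :
    Fintype.card X + Nat.card D.Component ≤
      Module.finrank (ZMod 2) (LinearMap.range D.coboundary) := by
  classical
  have : Fintype D.Component := Fintype.ofFinite _
  have : Fintype D.Face := Fintype.ofFinite _
  have h1 := LinearMap.finrank_range_add_finrank_ker D.coboundary
  rw [Module.finrank_fintype_fun_eq_card] at h1
  have hp : Nat.card D.Face = Fintype.card X + 2 * Nat.card D.Component := D.planar
  rw [Nat.card_eq_fintype_card, Nat.card_eq_fintype_card] at hp
  rw [Nat.card_eq_fintype_card]
  have h3 : Module.finrank (ZMod 2) (LinearMap.ker D.coboundary) ≤ Fintype.card D.Component := by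
    let L : LinearMap.ker D.coboundary →ₗ[ZMod 2] (D.Component → ZMod 2) :=
      { toFun := fun F => Quot.lift (fun a => F.1 (Quot.mk _ a)) (by
          rintro a b hab
          have hh : ∀ a, F.1 (Quot.mk _ a) = F.1 (Quot.mk _ (ccw a)) := fun a => by
            have hh := F.2
            rw [LinearMap.mem_ker] at hh
            exact CharTwo.add_eq_zero.1 (congrFun hh (Quot.mk _ a))
          rcases hab with rfl | rfl
          swap
          · exact hh a
          have h2 : (Quot.mk _ a : D.Face) = Quot.mk _ (ccw (D.arc a)) := Quot.sound rfl
          rw [h2]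
          exact (hh _).symm)
        map_add' := by
          intro h h'
          ext q
          induction q using Quot.ind
          rfl
        map_smul' := by
          intro c h
          ext q
          induction q using Quot.ind
          rfl }
    have hL : Function.Injective L := by
      intro h h' e
      ext q
      induction q using Quot.ind
      exact congrFun e (Quot.mk _ _)
    have := LinearMap.finrank_le_finrank_of_injective hL
    rwa [Module.finrank_fintype_fun_eq_card] at this
  omega

/-- A coboundary is a cycle because each corner of a crossing borders two of its ends; the two
dimension estimates leave no room for a proper inclusion. -/
theorem range_coboundary (D : LinkDiagram X) [DecidableEq D.Arc] [Fintype D.Arc] :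
    LinearMap.range D.coboundary = LinearMap.ker D.boundary.mulVecLin := by
  refine Submodule.eq_of_le_of_finrank_le ?_
    (D.finrank_ker_boundary_le.trans D.le_finrank_range_coboundary)
  rintro _ ⟨F, rfl⟩
  rw [LinearMap.mem_ker]
  ext x
  simp only [Matrix.mulVecLin_apply, Matrix.mulVec, dotProduct, boundary, Matrix.of_apply,
    Finset.sum_mul, ite_mul, one_mul, zero_mul, Pi.zero_apply]
  rw [Finset.sum_comm]
  simp only [Finset.sum_ite_eq, Finset.mem_univ, if_true]
  change ∑ i : ZMod 4, (F (Quot.mk _ (x, i)) + F (Quot.mk _ (x, i + 1))) = 0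
  rw [Finset.sum_add_distrib]
  have := Equiv.sum_comp (Equiv.addRight (1 : ZMod 4)) (fun i => F (Quot.mk _ (x, i)))
  simp only [Equiv.coe_addRight] at this
  rw [this]
  exact CharTwo.add_self_eq_zero _

/-- `F` is a function on the faces of the diagram, and its values on the two sides of the arc at
the end `a` differ by `g a`. -/
structure IsPrimitive (D : LinkDiagram X) (F g : X × ZMod 4 → ZMod 2) : Prop where
  face : ∀ a, F (ccw (D.arc a)) = F a
  add : ∀ a, F a + F (ccw a) = g a

theorem IsPrimitive.face' {D : LinkDiagram X} {F g : X × ZMod 4 → ZMod 2} (hF : D.IsPrimitive F g) (a : X × ZMod 4) :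
    F (D.arc a) = F (ccw a) := by
  rw [← hF.face (D.arc a), D.arc_arc]

/-- In the plane, every cycle mod 2 is a boundary. -/
theorem exists_isPrimitive (D : LinkDiagram X) (g : X × ZMod 4 → ZMod 2)
    (harc : ∀ a, g (D.arc a) = g a) (hsum : ∀ x, g (x, 0) + g (x, 1) + g (x, 2) + g (x, 3) = 0) :
    ∃ F, D.IsPrimitive F g := by
  classical
  have : Fintype D.Arc := Fintype.ofFinite _
  let G : D.Arc → ZMod 2 := Quot.lift g (by rintro a _ rfl; exact (harc a).symm)
  have hG : G ∈ LinearMap.ker D.boundary.mulVecLin := by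
    rw [LinearMap.mem_ker]
    ext x
    simp only [Matrix.mulVecLin_apply, Matrix.mulVec, dotProduct, boundary, Matrix.of_apply,
      Finset.sum_mul, ite_mul, one_mul, zero_mul, Pi.zero_apply]
    rw [Finset.sum_comm]
    simp only [Finset.sum_ite_eq, Finset.mem_univ, if_true]
    rw [zmod_four_sum]
    exact hsum x
  rw [← range_coboundary] at hG
  obtain ⟨F, hF⟩ := hG
  refine ⟨fun a => F (Quot.mk _ a), fun a => ?_, fun a => congrFun hF (Quot.mk _ a)⟩
  exact congrArg F (Quot.sound (r := fun a b : X × ZMod 4 => b = ((D.arc a).1, (D.arc a).2 + 1))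
    rfl).symm

/-- A checkerboard colouring of the faces. -/
theorem exists_checkerboard (D : LinkDiagram X) :
    ∃ F : X × ZMod 4 → ZMod 2, (∀ a, F (D.arc a) = F a + 1) ∧ ∀ a, F (ccw a) = F a + 1 := by
  obtain ⟨F, h1, h2⟩ := D.exists_isPrimitive 1 (fun _ => rfl) (fun _ => by simp; decide)
  have h3 : ∀ a, F (ccw a) = F a + 1 := fun a => by
    have := h2 a
    rw [Pi.one_apply] at this
    rw [← this]
    linear_combination (-(1:ZMod 2)) * CharTwo.add_self_eq_zero (F a)
  refine ⟨F, fun a => ?_, h3⟩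
  have := h1 a
  rw [h3] at this
  rw [← this]
  linear_combination (-(1:ZMod 2)) * CharTwo.add_self_eq_zero (1 : ZMod 2)

end Cohomology
end LinkDiagram

/-! ### Splicings and circles of a state. -/

namespace LinkDiagram

section Splice

variable {X : Type*} [DecidableEq X]

theorem splice_fst (s : Finset X) (a : X × ZMod 4) : (splice s a).1 = a.1 := by
  unfold splice; split_ifs <;> rfl

theorem splice_splice (s : Finset X) (a : X × ZMod 4) : splice s (splice s a) = a := by
  by_cases h : a.1 ∈ s
  · simp [splice, h]
  · simp [splice, h]

theorem splice_of_mem {s : Finset X} {x : X} (h : x ∈ s) (i : ZMod 4) :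
    splice s (x, i) = (x, 3 - i) := by simp [splice, h]

theorem splice_of_notMem {s : Finset X} {x : X} (h : x ∉ s) (i : ZMod 4) :
    splice s (x, i) = (x, 1 - i) := by simp [splice, h]

theorem splice_congr {s t : Finset X} {a : X × ZMod 4} (h : a.1 ∈ s ↔ a.1 ∈ t) :
    splice s a = splice t a := by
  simp [splice, h]

theorem splice_eq_or (s : Finset X) (a : X × ZMod 4) :
    splice s a = ccw a ∨ a = ccw (splice s a) := by
  obtain ⟨x, i⟩ := a
  by_cases h : x ∈ s
  · rw [splice_of_mem h]
    simp only [ccw, Prod.mk.injEq, true_and]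
    revert i; decide
  · rw [splice_of_notMem h]
    simp only [ccw, Prod.mk.injEq, true_and]
    revert i; decide

end Splice

variable {X : Type*} [Fintype X] [DecidableEq X]

section Circles

variable (D : LinkDiagram X)

theorem circleOf_arc (s : Finset X) (a : X × ZMod 4) :
    D.circleOf s (D.arc a) = D.circleOf s a :=
  congrArg Sum.inl (Quot.sound (r := fun a b => b = D.arc a ∨ b = splice s a) (Or.inl rfl)).symm

theorem circleOf_splice (s : Finset X) (a : X × ZMod 4) :
    D.circleOf s (splice s a) = D.circleOf s a :=
  congrArg Sum.inl (Quot.sound (r := fun a b => b = D.arc a ∨ b = splice s a) (Or.inr rfl)).symm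

variable {D}

/-- A function on ends which is constant along arcs and splicings is constant on circles. -/
theorem eq_of_circleOf_eq {s : Finset X} {β : Type*} (h : X × ZMod 4 → β)
    (harc : ∀ a, h (D.arc a) = h a) (hs : ∀ a, h (splice s a) = h a) {a b : X × ZMod 4}
    (hab : D.circleOf s a = D.circleOf s b) : h a = h b :=
  congrArg (Quot.lift h (by
    rintro a b (rfl | rfl)
    · exact (harc a).symm
    · exact (hs a).symm)) (Sum.inl_injective hab)

variable (D)

/-- Both sides of the crossing `x` belong to the same circle of the state `s`. -/
def Joined (s : Finset X) (x : X) : Prop := D.circleOf s (x, 0) = D.circleOf s (x, 2)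

theorem circleOf_iterate {s : Finset X} (s' : Finset X) (x : X) (hs : ∀ y ≠ x, y ∈ s' ↔ y ∈ s)
    (a : X × ZMod 4) (j : ℕ)
    (hj : ∀ i < j, (D.arc ((fun b => splice s (D.arc b))^[i] a)).1 ≠ x) :
    D.circleOf s' ((fun b => splice s (D.arc b))^[j] a) = D.circleOf s' a := by
  induction j with
  | zero => rfl
  | succ j ih =>
    rw [Function.iterate_succ_apply', ← ih fun i hi => hj i (by omega)]
    rw [← splice_congr (hs _ (hj j (by omega))), circleOf_splice, circleOf_arc]

/-- Changing the splicing at a crossing merges the two sides of the crossing if and only if they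
were on different circles before. -/
theorem joined_insert_iff {s : Finset X} {x : X} (hx : x ∉ s) :
    D.Joined (insert x s) x ↔ ¬ D.Joined s x := by
  classical
  obtain ⟨F, hF1, hF2⟩ := D.exists_checkerboard
  set ρ : X × ZMod 4 → X × ZMod 4 := fun b => splice s (D.arc b) with hρ
  set e₀ : X × ZMod 4 := (x, 0) with he₀
  have hinj : Function.Injective ρ := by
    intro a b h
    have h1 : D.arc a = D.arc b := by
      rw [← splice_splice s (D.arc a), ← splice_splice s (D.arc b)]
      exact congrArg _ h
    rw [← D.arc_arc a, h1, D.arc_arc]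
  -- The strand leaving `x` at the end 0 comes back to `x`, since `ρ` is injective on a finite set
  -- and hence periodic. The first return is taken, so that the splicing at `x` plays no role before
  -- it.
  have hex : ∃ j, (D.arc (ρ^[j] e₀)).1 = x := by
    obtain ⟨n, hn, hper⟩ := hinj.mem_periodicPts e₀
    obtain ⟨j, rfl⟩ : ∃ j, n = j + 1 := ⟨n - 1, by omega⟩
    refine ⟨j, ?_⟩
    have h1 : ρ^[j + 1] e₀ = e₀ := hper
    rw [Function.iterate_succ_apply'] at h1
    rw [← splice_fst s]
    exact congrArg Prod.fst h1
  set j := Nat.find hex with hj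
  have hj1 : (D.arc (ρ^[j] e₀)).1 = x := Nat.find_spec hex
  have hj2 : ∀ i < j, (D.arc (ρ^[i] e₀)).1 ≠ x := fun i hi => Nat.find_min hex hi
  -- `P` describes the strand from the end 0 to its first return. It meets `x` only at its two
  -- extremities.
  set P : X × ZMod 4 → Prop := fun b => ∃ i ≤ j, b = ρ^[i] e₀ ∨ b = D.arc (ρ^[i] e₀) with hP
  have hParc : ∀ b, P b → P (D.arc b) := by
    rintro b ⟨i, hi, rfl | rfl⟩
    · exact ⟨i, hi, Or.inr rfl⟩
    · exact ⟨i, hi, Or.inl (D.arc_arc _)⟩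
  have hPx : ∀ b, P b → b.1 = x → b = e₀ ∨ b = D.arc (ρ^[j] e₀) := by
    rintro b ⟨i, hi, rfl | rfl⟩ hb
    · rcases i with _ | i
      · exact Or.inl rfl
      · rw [Function.iterate_succ_apply'] at hb
        change (splice s (D.arc (ρ^[i] e₀))).1 = x at hb
        rw [splice_fst] at hb
        exact absurd hb (hj2 i (by omega))
    · rcases hi.lt_or_eq with hi | rfl
      · exact absurd hb (hj2 i hi)
      · exact Or.inr rfl
  have hPs : ∀ b, P b → b.1 ≠ x → P (splice s b) := by
    rintro b ⟨i, hi, rfl | rfl⟩ hb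
    · rcases i with _ | i
      · exact absurd rfl hb
      · rw [Function.iterate_succ_apply']
        change P (splice s (splice s (D.arc (ρ^[i] e₀))))
        rw [splice_splice]
        exact ⟨i, by omega, Or.inr rfl⟩
    · have hi : i < j := lt_of_le_of_ne hi (by rintro rfl; exact hb hj1)
      exact ⟨i + 1, hi, Or.inl (Function.iterate_succ_apply' ρ i e₀).symm⟩
  have hFs : ∀ b, F (splice s b) = F b + 1 := by
    intro b
    have h2 : (1 + 1 : ZMod 2) = 0 := by decide
    rcases splice_eq_or s b with h | h
    · rw [h, hF2]
    · have := hF2 (splice s b)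
      rw [← h] at this
      rw [this]
      linear_combination (-1 : ZMod 2) * h2
  have hFρ : ∀ i, F (ρ^[i] e₀) = F e₀ := by
    intro i
    induction i with
    | zero => rfl
    | succ i ih =>
      rw [Function.iterate_succ_apply']
      change F (splice s (D.arc (ρ^[i] e₀))) = _
      rw [hFs, hF1, ih]
      have h2 : (1 + 1 : ZMod 2) = 0 := by decide
      linear_combination h2
  -- Arcs and splicings both flip the checkerboard colour, so the return is at an end coloured
  -- differently from 0. This excludes a return at 2, where no splicing could separate the two
  -- sides.
  have hq : D.arc (ρ^[j] e₀) = (x, 1) ∨ D.arc (ρ^[j] e₀) = (x, 3) := by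
    have h1 : F (D.arc (ρ^[j] e₀)) = F e₀ + 1 := by rw [hF1, hFρ]
    have h2 : F (x, 2) = F e₀ := by
      have a1 := hF2 (x, 0)
      have a2 := hF2 (x, 1)
      change F (x, 1) = _ at a1
      change F (x, 2) = _ at a2
      rw [a2, a1]
      have h2 : (1 + 1 : ZMod 2) = 0 := by decide
      linear_combination h2
    have h3 : ∀ i : ZMod 4, i = 0 ∨ i = 1 ∨ i = 2 ∨ i = 3 := by decide
    have h4 : ∀ b : ZMod 2, b ≠ b + 1 := by decide
    have h5 : D.arc (ρ^[j] e₀) = (x, (D.arc (ρ^[j] e₀)).2) := Prod.ext hj1 rfl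
    rcases h3 (D.arc (ρ^[j] e₀)).2 with h | h | h | h <;> rw [h] at h5
    · rw [h5] at h1
      exact absurd h1 (h4 _)
    · exact Or.inl h5
    · rw [h5, h2] at h1
      exact absurd h1 (h4 _)
    · exact Or.inr h5
  have hcirc : ∀ s' : Finset X, (∀ y ≠ x, y ∈ s' ↔ y ∈ s) →
      D.circleOf s' (D.arc (ρ^[j] e₀)) = D.circleOf s' e₀ := fun s' hs' => by
    rw [circleOf_arc]
    exact D.circleOf_iterate s' x hs' e₀ j hj2
  have hins : ∀ y ≠ x, y ∈ insert x s ↔ y ∈ s := fun y hy => by simp [hy]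
  -- If the splicing at `x` joins the two extremities of the strand, the strand closes up to a
  -- circle which misses the end 2.
  have hnot : ∀ s' : Finset X, (∀ y ≠ x, y ∈ s' ↔ y ∈ s) →
      splice s' e₀ = D.arc (ρ^[j] e₀) → ¬ D.Joined s' x := by
    intro s' hs' h0 hJ
    have hmem : ∀ b, P b → P (splice s' b) := by
      intro b hb
      by_cases hbx : b.1 = x
      · rcases hPx b hb hbx with rfl | rfl
        · rw [h0]
          exact ⟨j, le_rfl, Or.inr rfl⟩
        · rw [← h0, splice_splice]
          exact ⟨0, Nat.zero_le _, Or.inl rfl⟩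
      · rw [splice_congr (hs' _ hbx)]
        exact hPs b hb hbx
    have h1 : P (x, 0) = P (x, 2) := by
      refine eq_of_circleOf_eq (s := s') P (fun a => ?_) (fun a => ?_) hJ
      · refine propext ⟨fun h => ?_, hParc a⟩
        rw [← D.arc_arc a]
        exact hParc _ h
      · refine propext ⟨fun h => ?_, hmem a⟩
        rw [← splice_splice s' a]
        exact hmem _ h
    have h2 : P (x, 2) := h1.mp ⟨0, Nat.zero_le _, Or.inl rfl⟩
    have h20 : (2 : ZMod 4) ≠ 0 := by decide
    have h21 : (2 : ZMod 4) ≠ 1 := by decide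
    have h23 : (2 : ZMod 4) ≠ 3 := by decide
    rcases hPx _ h2 rfl with h | h
    · exact h20 (Prod.ext_iff.1 h).2
    · rcases hq with hq | hq <;> rw [hq] at h
      · exact h21 (Prod.ext_iff.1 h).2
      · exact h23 (Prod.ext_iff.1 h).2
  -- A return at 1 is closed up by the `A`-splicing, while the `B`-splicing connects it to the end
  -- 2. For a return at 3 the roles are exchanged.
  rcases hq with hq | hq
  · have h1 : ¬ D.Joined s x := hnot s (fun _ _ => Iff.rfl) (by
      rw [hq, he₀, splice_of_notMem hx]; rfl)
    refine iff_of_true ?_ h1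
    have h2 := hcirc (insert x s) hins
    have h3 := D.circleOf_splice (insert x s) (x, 1)
    rw [splice_of_mem (Finset.mem_insert_self _ _)] at h3
    rw [hq] at h2
    rw [Joined, ← he₀, ← h2, ← h3]
    rfl
  · have h1 : ¬ D.Joined (insert x s) x := hnot _ hins (by
      rw [hq, he₀, splice_of_mem (Finset.mem_insert_self _ _)]; rfl)
    refine iff_of_false h1 (not_not.2 ?_)
    have h2 := hcirc s (fun _ _ => Iff.rfl)
    have h3 := D.circleOf_splice s (x, 3)
    rw [splice_of_notMem hx] at h3
    rw [hq] at h2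
    rw [Joined, ← he₀, ← h2, ← h3]
    rfl

theorem circleOf_eq_or (s : Finset X) (x : X) (i : ZMod 4) :
    D.circleOf s (x, i) = D.circleOf s (x, 0) ∨ D.circleOf s (x, i) = D.circleOf s (x, 2) := by
  have h3 : ∀ i : ZMod 4, i = 0 ∨ i = 1 ∨ i = 2 ∨ i = 3 := by decide
  have e1 := D.circleOf_splice s (x, 1)
  have e3 := D.circleOf_splice s (x, 3)
  by_cases hx : x ∈ s
  · rw [splice_of_mem hx] at e1 e3
    rcases h3 i with rfl | rfl | rfl | rfl
    · exact Or.inl rfl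
    · exact Or.inr e1.symm
    · exact Or.inr rfl
    · exact Or.inl e3.symm
  · rw [splice_of_notMem hx] at e1 e3
    rcases h3 i with rfl | rfl | rfl | rfl
    · exact Or.inl rfl
    · exact Or.inl e1.symm
    · exact Or.inr rfl
    · exact Or.inr e3.symm

end Circles

theorem card_eq_card_add_one_of_surjective {α β : Type*} [Finite α] {f : α → β}
    (hf : Function.Surjective f) {p q : α} (hpq : p ≠ q) (hfpq : f p = f q)
    (hinj : ∀ a b, f a = f b → a = b ∨ (a = p ∧ b = q) ∨ (a = q ∧ b = p)) :
    Nat.card α = Nat.card β + 1 := by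
  classical
  have hbij : Function.Bijective fun a : {a // a ≠ q} => f a := by
    constructor
    · rintro ⟨a, ha⟩ ⟨b, hb⟩ h
      rcases hinj a b h with h | ⟨-, h⟩ | ⟨h, -⟩
      · exact Subtype.ext h
      · exact absurd h hb
      · exact absurd h ha
    · intro b
      obtain ⟨a, rfl⟩ := hf b
      by_cases ha : a = q
      · exact ⟨⟨p, hpq⟩, by rw [ha]; exact hfpq⟩
      · exact ⟨⟨a, ha⟩, rfl⟩
  have : Fintype α := Fintype.ofFinite _
  have hc := Nat.card_eq_of_bijective _ hbij
  rw [← hc, Nat.card_eq_fintype_card, Nat.card_eq_fintype_card, Fintype.card_subtype_compl,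
    Fintype.card_subtype_eq]
  have : 0 < Fintype.card α := Fintype.card_pos_iff.2 ⟨p⟩
  omega

/-! ### Numbers of circles and the excess. -/

section Count

variable (D : LinkDiagram X)

/-- The circles after all four ends at the crossing `x` have been joined. -/
abbrev MergedCircle (s : Finset X) (x : X) : Type _ :=
  Quot (fun a b : X × ZMod 4 => b = D.arc a ∨ (a.1 ≠ x ∧ b = splice s a) ∨ (a.1 = x ∧ b.1 = x)) ⊕
    Fin D.loops

theorem mergedCircle_insert (s : Finset X) (x : X) :
    D.MergedCircle (insert x s) x = D.MergedCircle s x := by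
  unfold MergedCircle
  congr 2
  ext a b
  refine or_congr_right (or_congr_left (and_congr_right fun h => ?_))
  rw [splice_congr (t := s) (by simp [h])]

-- Joining all four ends at `x` identifies at most the two circles through `x`. The result does not
-- depend on the splicing at `x`, so it serves to compare the two splicings.
open Classical in
theorem card_circle_eq (s : Finset X) (x : X) :
    Nat.card (D.Circle s) = Nat.card (D.MergedCircle s x) + if D.Joined s x then 0 else 1 := by
  let π₀ : Quot (fun a b : X × ZMod 4 => b = D.arc a ∨ b = splice s a) →
      Quot (fun a b : X × ZMod 4 => b = D.arc a ∨ (a.1 ≠ x ∧ b = splice s a) ∨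
        (a.1 = x ∧ b.1 = x)) :=
    Quot.map id (by
      rintro a b (h | rfl)
      · exact Or.inl h
      · by_cases ha : a.1 = x
        · exact Or.inr (Or.inr ⟨ha, (splice_fst s a).trans ha⟩)
        · exact Or.inr (Or.inl ⟨ha, rfl⟩))
  let π : D.Circle s → D.MergedCircle s x := Sum.map π₀ id
  have hπ : Function.Surjective π := by
    rintro (q | l)
    · induction q using Quot.ind with
      | mk a => exact ⟨Sum.inl (Quot.mk _ a), rfl⟩
    · exact ⟨Sum.inr l, rfl⟩
  have hpq : π (D.circleOf s (x, 0)) = π (D.circleOf s (x, 2)) :=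
    congrArg Sum.inl (Quot.sound (Or.inr (Or.inr ⟨rfl, rfl⟩)))
  have hpq₀ : ∀ a : X × ZMod 4, a.1 = x →
      D.circleOf s a = D.circleOf s (x, 0) ∨ D.circleOf s a = D.circleOf s (x, 2) := by
    rintro ⟨y, i⟩ rfl
    exact D.circleOf_eq_or s y i
  have hinj : ∀ a b, π a = π b → a = b ∨ (a = D.circleOf s (x, 0) ∧ b = D.circleOf s (x, 2)) ∨
      (a = D.circleOf s (x, 2) ∧ b = D.circleOf s (x, 0)) := by
    -- A section up to the identification: the circle through the end 2 is replaced by the one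
    -- through the end 0, so `φ ∘ π` shows that nothing else is identified.
    let φ : D.MergedCircle s x → D.Circle s := Sum.elim (Quot.lift
      (fun a => if D.circleOf s a = D.circleOf s (x, 2) then D.circleOf s (x, 0)
        else D.circleOf s a) (by
        rintro a b (rfl | ⟨-, rfl⟩ | ⟨ha, hb⟩)
        · rw [circleOf_arc]
        · rw [circleOf_splice]
        · rcases hpq₀ a ha with h | h <;> rcases hpq₀ b hb with h' | h' <;> simp [h, h']))
      Sum.inr
    have hφ : ∀ c, φ (π c) = if c = D.circleOf s (x, 2) then D.circleOf s (x, 0) else c := by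
      rintro (q | l)
      · induction q using Quot.ind with
        | mk a => rfl
      · rw [if_neg (by simp [circleOf])]
        rfl
    intro a b hab
    have := congrArg φ hab
    rw [hφ, hφ] at this
    split_ifs at this with h1 h2 h2
    · exact Or.inl (h1.trans h2.symm)
    · exact Or.inr (Or.inr ⟨h1, this.symm⟩)
    · exact Or.inr (Or.inl ⟨this, h2⟩)
    · exact Or.inl this
  split_ifs with h
  · refine Nat.card_eq_of_bijective π ⟨fun a b hab => ?_, hπ⟩
    rcases hinj a b hab with h' | ⟨rfl, rfl⟩ | ⟨rfl, rfl⟩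
    · exact h'
    · exact h
    · exact h.symm
  · exact card_eq_card_add_one_of_surjective hπ h hpq hinj

variable {D}

theorem card_circle_insert_of_joined {s : Finset X} {x : X} (hx : x ∉ s) (h : D.Joined s x) :
    Nat.card (D.Circle (insert x s)) = Nat.card (D.Circle s) + 1 := by
  rw [card_circle_eq D s x, card_circle_eq D (insert x s) x, mergedCircle_insert, if_pos h,
    if_neg (by rw [joined_insert_iff D hx]; exact not_not.2 h)]

theorem card_circle_insert_of_not_joined {s : Finset X} {x : X} (hx : x ∉ s) (h : ¬ D.Joined s x) :
    Nat.card (D.Circle s) = Nat.card (D.Circle (insert x s)) + 1 := by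
  rw [card_circle_eq D s x, card_circle_eq D (insert x s) x, mergedCircle_insert, if_neg h,
    if_pos ((joined_insert_iff D hx).2 h)]

variable (D)

/-- Each added crossing increases `|s|` by one and changes the number of circles by plus or minus
one; `k` increases exactly at the merges. -/
theorem exists_excess (s : Finset X) : ∃ k, D.v + s.card = Nat.card (D.Circle s) + 2 * k := by
  induction s using Finset.induction_on with
  | empty => exact ⟨0, rfl⟩
  | insert x s hx ih =>
    obtain ⟨k, hk⟩ := ih
    rw [Finset.card_insert_of_notMem hx]
    by_cases h : D.Joined s x
    · exact ⟨k, by rw [card_circle_insert_of_joined hx h]; omega⟩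
    · exact ⟨k + 1, by rw [card_circle_insert_of_not_joined hx h] at hk; omega⟩

/-- Half of the amount by which the number of circles of a state falls short of the maximum. -/
noncomputable def excess (s : Finset X) : ℕ := (D.exists_excess s).choose

theorem v_add_card (s : Finset X) : D.v + s.card = Nat.card (D.Circle s) + 2 * D.excess s :=
  (D.exists_excess s).choose_spec

theorem excess_empty : D.excess ∅ = 0 := by
  have h := D.v_add_card ∅
  change Nat.card (D.Circle ∅) + _ = _ at h
  rw [Finset.card_empty] at h
  omega

variable {D}

theorem excess_insert_of_joined {s : Finset X} {x : X} (hx : x ∉ s) (h : D.Joined s x) :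
    D.excess (insert x s) = D.excess s := by
  have h1 := D.v_add_card s
  have h2 := D.v_add_card (insert x s)
  rw [Finset.card_insert_of_notMem hx, card_circle_insert_of_joined hx h] at h2
  omega

theorem excess_insert_of_not_joined {s : Finset X} {x : X} (hx : x ∉ s) (h : ¬ D.Joined s x) :
    D.excess (insert x s) = D.excess s + 1 := by
  have h1 := D.v_add_card s
  have h2 := D.v_add_card (insert x s)
  rw [Finset.card_insert_of_notMem hx] at h2
  rw [card_circle_insert_of_not_joined hx h] at h1
  omega

theorem excess_le_excess_insert (s : Finset X) (x : X) : D.excess s ≤ D.excess (insert x s) := by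
  by_cases hx : x ∈ s
  · rw [Finset.insert_eq_of_mem hx]
  · by_cases hJ : D.Joined s x
    · rw [excess_insert_of_joined hx hJ]
    · rw [excess_insert_of_not_joined hx hJ]
      omega

theorem excess_mono {s t : Finset X} (h : s ⊆ t) : D.excess s ≤ D.excess t := by
  have : ∀ u : Finset X, D.excess s ≤ D.excess (u ∪ s) := by
    intro u
    induction u using Finset.induction_on with
    | empty => rw [Finset.empty_union]
    | insert x u _ ih =>
      rw [Finset.insert_union]
      exact ih.trans (excess_le_excess_insert _ _)
  rw [← Finset.sdiff_union_of_subset h]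
  exact this _

end Count

end LinkDiagram

namespace LinkDiagram

/-! ### Sides of a circle and parallel crossings. -/

section Even

variable {X : Type*}

/-- The ends after which, counterclockwise, there is an `A`-region of the crossing which is not
merged with the opposite one by a `B`-splicing. -/
def EvenEnd (a : X × ZMod 4) : Prop := a.2 = 0 ∨ a.2 = 2

theorem EvenEnd.ccw_ccw {a : X × ZMod 4} (h : EvenEnd a) : EvenEnd (ccw (ccw a)) := by
  obtain ⟨x, i⟩ := a
  simp only [EvenEnd, ccw] at *
  revert i; decide

variable [DecidableEq X]

theorem splice_eq_ccw_iff {s : Finset X} {a : X × ZMod 4} (ha : a.1 ∉ s) :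
    splice s a = ccw a ↔ EvenEnd a := by
  obtain ⟨x, i⟩ := a
  rw [splice_of_notMem ha]
  simp only [EvenEnd, ccw, Prod.mk.injEq, true_and]
  clear ha
  revert i; decide

theorem EvenEnd.splice_ccw {s : Finset X} {a : X × ZMod 4} (h : EvenEnd a) (ha : a.1 ∈ s) :
    splice s (ccw a) = ccw (ccw a) := by
  obtain ⟨x, i⟩ := a
  change splice s (x, i + 1) = (x, i + 1 + 1)
  rw [splice_of_mem ha]
  simp only [EvenEnd, Prod.mk.injEq, true_and] at *
  revert i; decide

theorem splice_union_ne {t S : Finset X} {c : X × ZMod 4} (h1 : splice t c = ccw c)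
    (h2 : splice (t ∪ S) c ≠ ccw c) (hS : ∀ w ∈ S, w ∉ t) : c.1 ∈ S ∧ EvenEnd c := by
  have hc : c.1 ∈ S := by
    by_contra hc
    exact h2 (by rw [splice_congr (t := t) (by simp [hc]), h1])
  exact ⟨hc, (splice_eq_ccw_iff (hS _ hc)).1 h1⟩

end Even

variable {X : Type*} [Fintype X] [DecidableEq X] (D : LinkDiagram X)

/-- The circles of the state `s` on the two sides of the crossing `x`, which is meant to be
`A`-spliced. -/
def stateEdge (s : Finset X) (x : X) : Sym2 (D.Circle s) :=
  s(D.circleOf s (x, 0), D.circleOf s (x, 2))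

variable {D}

theorem EvenEnd.circleOf_ccw {a : X × ZMod 4} (h : EvenEnd a) {s : Finset X} (ha : a.1 ∉ s) :
    D.circleOf s (ccw a) = D.circleOf s a := by
  rw [← (splice_eq_ccw_iff ha).2 h, circleOf_splice]

theorem EvenEnd.stateEdge_eq {a : X × ZMod 4} (h : EvenEnd a) (s : Finset X) :
    D.stateEdge s a.1 = s(D.circleOf s a, D.circleOf s (ccw (ccw a))) := by
  obtain ⟨x, i⟩ := a
  rcases h with h | h <;> simp only at h <;> subst h
  · rfl
  · have h4 : (2 + 1 + 1 : ZMod 4) = 0 := by decide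
    change s(_, _) = s(_, D.circleOf s (x, 2 + 1 + 1))
    rw [h4]
    exact Sym2.eq_swap

theorem EvenEnd.joined_iff {a : X × ZMod 4} (h : EvenEnd a) {s : Finset X} :
    D.Joined s a.1 ↔ D.circleOf s a = D.circleOf s (ccw (ccw a)) := by
  rw [← Sym2.mk_isDiag_iff, ← h.stateEdge_eq]
  exact (Sym2.mk_isDiag_iff).symm

theorem exists_evenEnd {s : Finset X} {x : X} {V W : D.Circle s} (h : D.stateEdge s x = s(V, W)) :
    ∃ a : X × ZMod 4, a.1 = x ∧ EvenEnd a ∧ D.circleOf s a = V ∧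
      D.circleOf s (ccw (ccw a)) = W := by
  rcases Sym2.eq_iff.1 h with ⟨h1, h2⟩ | ⟨h1, h2⟩
  · exact ⟨(x, 0), rfl, Or.inl rfl, h1, h2⟩
  · have h4 : (2 + 1 + 1 : ZMod 4) = 0 := by decide
    refine ⟨(x, 2), rfl, Or.inr rfl, h2, ?_⟩
    change D.circleOf s (x, 2 + 1 + 1) = W
    rw [h4, h1]

theorem EvenEnd.circleOf_ccw_ccw {a : X × ZMod 4} (h : EvenEnd a) {s : Finset X}
    {V W : D.Circle s} (he : D.stateEdge s a.1 = s(V, W)) (ha : D.circleOf s a = V) :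
    D.circleOf s (ccw (ccw a)) = W := by
  rw [h.stateEdge_eq, ha] at he
  exact Sym2.congr_right.1 he

theorem circleOf_mem_stateEdge {s : Finset X} (a : X × ZMod 4) :
    D.circleOf s a ∈ D.stateEdge s a.1 := by
  rw [stateEdge, Sym2.mem_iff]
  exact D.circleOf_eq_or s a.1 a.2

section Untouched

/-- All splicings along `V` are the same in `t` and `t ∪ S`, so `V` stays in one piece. -/
theorem circleOf_union_eq {t S : Finset X} {V : D.Circle t} (hV : ∀ w ∈ S, V ∉ D.stateEdge t w)
    {a b : X × ZMod 4} (ha : D.circleOf t a = V) (hb : D.circleOf t b = V) :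
    D.circleOf (t ∪ S) a = D.circleOf (t ∪ S) b := by
  classical
  have := eq_of_circleOf_eq (s := t)
    (fun c => if D.circleOf t c = V then some (D.circleOf (t ∪ S) c) else none)
    (fun c => by simp only [circleOf_arc]) (fun c => by
      simp only [circleOf_splice]
      by_cases hc : D.circleOf t c = V
      · have hS : c.1 ∉ S := fun h => hV _ h (hc ▸ circleOf_mem_stateEdge c)
        rw [if_pos hc, if_pos hc, splice_congr (t := t ∪ S) (by simp [hS]), circleOf_splice]
      · rw [if_neg hc, if_neg hc]) (ha.trans hb.symm)
  simpa [ha, hb] using this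

/-- Conversely, nothing new gets joined to a circle at which no splicing is changed. -/
theorem circleOf_eq_of_circleOf_union_eq {t S : Finset X} {V : D.Circle t}
    (hV : ∀ w ∈ S, V ∉ D.stateEdge t w) {a b : X × ZMod 4} (ha : D.circleOf t a = V)
    (hab : D.circleOf (t ∪ S) a = D.circleOf (t ∪ S) b) : D.circleOf t b = V := by
  have := eq_of_circleOf_eq (s := t ∪ S) (fun c => D.circleOf t c = V)
    (fun c => by simp only [circleOf_arc]) (fun c => by
      by_cases hS : c.1 ∈ S
      · have h1 : D.circleOf t c ≠ V := fun h => hV _ hS (h ▸ circleOf_mem_stateEdge c)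
        have h2 : D.circleOf t (splice (t ∪ S) c) ≠ V := fun h =>
          hV _ hS (h ▸ splice_fst (t ∪ S) c ▸ circleOf_mem_stateEdge (splice (t ∪ S) c))
        simp [h1, h2]
      · rw [splice_congr (t := t) (by simp [hS]), circleOf_splice]) hab
  exact this.mp ha

/-- A circle which is on one side of `y` only, and which is not touched by the crossings of `S`,
is merged with another one at `y`. -/
theorem not_joined_of_notMem {t S : Finset X} {y : X} {V W : D.Circle t} (hVW : V ≠ W)
    (hy : D.stateEdge t y = s(V, W)) (hV : ∀ w ∈ S, V ∉ D.stateEdge t w) :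
    ¬ D.Joined (t ∪ S) y := by
  obtain ⟨a, rfl, ha, haV, haW⟩ := exists_evenEnd hy
  rw [ha.joined_iff]
  intro h
  have := circleOf_eq_of_circleOf_union_eq hV haV h
  exact hVW (this.symm.trans haW)

end Untouched

section Primitive

open Classical in
/-- The characteristic function of a circle of a state. -/
noncomputable def circleIndicator (s : Finset X) (U : D.Circle s) (a : X × ZMod 4) : ZMod 2 :=
  if D.circleOf s a = U then 1 else 0

theorem circleIndicator_of_eq {s : Finset X} {U : D.Circle s} {a : X × ZMod 4}
    (h : D.circleOf s a = U) : circleIndicator s U a = 1 := if_pos h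

theorem circleIndicator_of_ne {s : Finset X} {U : D.Circle s} {a : X × ZMod 4}
    (h : D.circleOf s a ≠ U) : circleIndicator s U a = 0 := if_neg h

theorem circleOf_eq_of_circleIndicator {s : Finset X} {U : D.Circle s} {a : X × ZMod 4}
    (h : circleIndicator s U a = 1) : D.circleOf s a = U := by
  by_contra hne
  rw [circleIndicator_of_ne hne] at h
  exact absurd h (by decide)

theorem circleIndicator_congr {s : Finset X} {U : D.Circle s} {a b : X × ZMod 4}
    (h : D.circleOf s a = D.circleOf s b) : circleIndicator s U a = circleIndicator s U b := by
  rw [circleIndicator, circleIndicator, h]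

/-- A circle passes through the ends of a crossing in joined pairs, so its indicator is a mod 2
cycle. The resulting `F` tells the inside of the circle from its outside. -/
theorem exists_isPrimitive_circleIndicator (s : Finset X) (U : D.Circle s) :
    ∃ F, D.IsPrimitive F (circleIndicator s U) := by
  refine D.exists_isPrimitive _ (fun a => circleIndicator_congr (circleOf_arc D s a)) fun x => ?_
  have e0 := circleIndicator_congr (U := U) (circleOf_splice D s (x, 0))
  have e2 := circleIndicator_congr (U := U) (circleOf_splice D s (x, 2))
  have key : ∀ u v : ZMod 2, u + u + v + v = 0 := by decide
  have e3 : ((3 : ZMod 4) - 0) = 3 ∧ ((3 : ZMod 4) - 2) = 1 ∧ ((1 : ZMod 4) - 0) = 1 ∧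
    ((1 : ZMod 4) - 2) = 3 := by decide
  by_cases hx : x ∈ s
  · rw [splice_of_mem hx] at e0 e2
    rw [e3.1] at e0
    rw [e3.2.1] at e2
    rw [e0, e2]
    have := key (circleIndicator s U (x, 0)) (circleIndicator s U (x, 2))
    linear_combination this
  · rw [splice_of_notMem hx] at e0 e2
    rw [e3.2.2.1] at e0
    rw [e3.2.2.2] at e2
    rw [e0, e2]
    exact key _ _

/-- A face function does not change along a circle across which it does not jump. -/
theorem IsPrimitive.eq_of_circleOf_eq {F g : X × ZMod 4 → ZMod 2} (hF : D.IsPrimitive F g)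
    {s : Finset X} {V : D.Circle s} (hg : ∀ a, D.circleOf s a = V → g a = 0)
    {a b : X × ZMod 4} (ha : D.circleOf s a = V) (hb : D.circleOf s b = V) : F a = F b := by
  classical
  have key : ∀ u v : ZMod 2, u + v = 0 → v = u := by decide
  have hc : ∀ a, D.circleOf s a = V → F (ccw a) = F a := fun a ha =>
    key _ _ ((hF.add a).trans (hg a ha))
  have := LinkDiagram.eq_of_circleOf_eq (s := s) (fun c => if D.circleOf s c = V then F c else 0)
    (fun c => by
      simp only [circleOf_arc]
      split_ifs with h
      · rw [hF.face', hc c h]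
      · rfl)
    (fun c => by
      simp only [circleOf_splice]
      split_ifs with h
      · rcases splice_eq_or s c with h' | h'
        · rw [h', hc c h]
        · conv_rhs => rw [h']
          exact (hc _ (by rw [circleOf_splice, h])).symm
      · rfl) (ha.trans hb.symm)
  simpa [ha, hb] using this

/-- Let `V` be a circle of the state `t`, and let the state `s` differ from `t` on one side of `V`
only. Then a circle of `s` has a constant position with respect to the other side of `V`. -/
theorem IsPrimitive.eq_of_far {t s : Finset X} {V : D.Circle t} {U : D.Circle s}
    {F G : X × ZMod 4 → ZMod 2} (hF : D.IsPrimitive F (circleIndicator t V))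
    (hG : D.IsPrimitive G (circleIndicator s U)) {ε : ZMod 2}
    (hfar : ∀ a, D.circleOf t a = V → splice t a = ccw a → splice s a ≠ ccw a → F (ccw a) = ε)
    {a b : X × ZMod 4} (ha : D.circleOf t a = V) (hb : D.circleOf t b = V)
    (haε : F (ccw a) = ε) (hbε : F (ccw b) = ε) : G (ccw a) = G (ccw b) := by
  classical
  have k1 : ∀ u v e : ZMod 2, u + v = 1 → v = e → u ≠ e := by decide
  have k2 : ∀ u v e : ZMod 2, u + v = 1 → v ≠ e → u = e := by decide
  have k3 : ∀ u v w : ZMod 2, u + v = v + w → u = w := by decide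
  have hV : ∀ a, D.circleOf t a = V → F a + F (ccw a) = 1 := fun a ha =>
    (hF.add a).trans (circleIndicator_of_eq ha)
  -- The expression is the value of `G` next to `V` on the side where `F = ε`. Passing from `c` to
  -- `ccw c`, this side is either the corner between them, common to both ends, or the side of the
  -- crossing site. In the latter case the splicing is not changed there, so both ends lie on the
  -- same circle of `s` and `G` jumps equally at both.
  have hstep : ∀ c, D.circleOf t c = V → splice t c = ccw c →
      (if F c = ε then G c else G (ccw c)) =
      (if F (ccw c) = ε then G (ccw c) else G (ccw (ccw c))) := by
    intro c hc hsc
    by_cases h : F (ccw c) = ε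
    · rw [if_neg (k1 _ _ _ (hV c hc) h), if_pos h]
    · have hs : splice s c = ccw c := by
        by_contra hne
        exact h (hfar c hc hsc hne)
      rw [if_pos (k2 _ _ _ (hV c hc) h), if_neg h]
      refine k3 _ (G (ccw c)) _ ?_
      rw [hG.add, hG.add, ← hs]
      exact circleIndicator_congr (circleOf_splice D s c).symm
  have := LinkDiagram.eq_of_circleOf_eq (s := t)
    (fun c => if D.circleOf t c = V then (if F c = ε then G c else G (ccw c)) else 0)
    (fun c => by
      simp only [circleOf_arc]
      by_cases h : D.circleOf t c = V
      · rw [if_pos h, if_pos h, hF.face', hG.face, hG.face']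
        by_cases h' : F (ccw c) = ε
        · rw [if_pos h', if_neg (k1 _ _ _ (hV c h) h')]
        · rw [if_neg h', if_pos (k2 _ _ _ (hV c h) h')]
      · rw [if_neg h, if_neg h])
    (fun c => by
      simp only [circleOf_splice]
      by_cases h : D.circleOf t c = V
      · rw [if_pos h, if_pos h]
        rcases splice_eq_or t c with h' | h'
        · rw [h', hstep c h h']
        · have := hstep (splice t c) (by rw [circleOf_splice, h]) (by rw [splice_splice, ← h'])
          exact this.trans
            (congrArg (fun c => if F c = ε then G c else G (ccw c)) h'.symm)
      · rw [if_neg h, if_neg h]) (ha.trans hb.symm)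
  simp only [ha, hb, if_true] at this
  rwa [if_neg (k1 _ _ _ (hV a ha) haε), if_neg (k1 _ _ _ (hV b hb) hbε)] at this

/-- Circles which are equal or connected by a crossing lie on the same side of a third one. -/
theorem IsPrimitive.far_eq {t : Finset X} {V W W' : D.Circle t} {F : X × ZMod 4 → ZMod 2}
    (hF : D.IsPrimitive F (circleIndicator t V)) (hVW : V ≠ W) (hVW' : V ≠ W')
    {a a' : X × ZMod 4} (ha : EvenEnd a) (hat : a.1 ∉ t) (haV : D.circleOf t a = V)
    (haW : D.circleOf t (ccw (ccw a)) = W) (ha' : EvenEnd a') (hat' : a'.1 ∉ t)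
    (haV' : D.circleOf t a' = V) (haW' : D.circleOf t (ccw (ccw a')) = W')
    (hWW' : W = W' ∨ ∃ x ∉ t, D.stateEdge t x = s(W, W')) : F (ccw a) = F (ccw a') := by
  have k : ∀ u v u' v' : ZMod 2, u + v = 1 → u' + v' = 1 → v = v' → u = u' := by decide
  have k0 : ∀ u v : ZMod 2, u + v = 0 → u = v := by decide
  have hother : ∀ {Y}, V ≠ Y → ∀ c, D.circleOf t c = Y → circleIndicator t V c = 0 :=
    fun h c hc => circleIndicator_of_ne (hc ▸ h.symm)
  refine k _ (F (ccw (ccw a))) _ (F (ccw (ccw a'))) ?_ ?_ ?_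
  · rw [hF.add]
    exact circleIndicator_of_eq ((ha.circleOf_ccw hat).trans haV)
  · rw [hF.add]
    exact circleIndicator_of_eq ((ha'.circleOf_ccw hat').trans haV')
  · rcases hWW' with rfl | ⟨x, hxt, hx⟩
    · exact hF.eq_of_circleOf_eq (hother hVW) haW haW'
    · obtain ⟨b, rfl, hb, hbW, hbW'⟩ := exists_evenEnd hx
      have hcb : D.circleOf t (ccw b) = W := (hb.circleOf_ccw hxt).trans hbW
      rw [hF.eq_of_circleOf_eq (hother hVW) haW hcb,
        ← hF.eq_of_circleOf_eq (hother hVW') hbW' haW']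
      exact k0 _ _ ((hF.add _).trans (hother hVW _ hcb))

end Primitive

section Parallel

variable {t S : Finset X} {V W : D.Circle t}

/-- If the splicing is changed at crossings between `V` and `W`, the resulting circles have a
constant position with respect to the side of `V` opposite to `W`. -/
theorem IsPrimitive.eq_of_parallel (hSt : ∀ w ∈ S, w ∉ t) (hVW : V ≠ W)
    (hedge : ∀ w ∈ S, D.stateEdge t w = s(V, W)) {U : D.Circle (t ∪ S)} {G : X × ZMod 4 → ZMod 2}
    (hG : D.IsPrimitive G (circleIndicator (t ∪ S) U)) {a b : X × ZMod 4} (ha : EvenEnd a)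
    (hat : a.1 ∉ t) (haV : D.circleOf t a = V) {W' : D.Circle t} (hVW' : V ≠ W')
    (haW : D.circleOf t (ccw (ccw a)) = W')
    (hWW' : W = W' ∨ ∃ x ∉ t, D.stateEdge t x = s(W, W')) (hb : EvenEnd b)
    (hbS : b.1 ∈ S) (hbV : D.circleOf t b = V) : G (ccw a) = G (ccw b) := by
  obtain ⟨F, hF⟩ := exists_isPrimitive_circleIndicator t V
  have f1 : ∀ c, EvenEnd c → c.1 ∈ S → D.circleOf t c = V → F (ccw c) = F (ccw a) :=
    fun c hc hcS hcV => hF.far_eq hVW hVW' hc (hSt _ hcS) hcV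
      (hc.circleOf_ccw_ccw (hedge _ hcS) hcV) ha hat haV haW hWW'
  refine hF.eq_of_far hG (ε := F (ccw a)) (fun c hcV h1 h2 => ?_) haV hbV rfl (f1 b hb hbS hbV)
  obtain ⟨hcS, hc⟩ := splice_union_ne h1 h2 hSt
  exact f1 c hc hcS hcV

/-- A `B`-splicing merges the two corners that the `A`-splicing cuts off, so `G` agrees on them. -/
theorem IsPrimitive.eq_across {s : Finset X} {U : D.Circle s} {G : X × ZMod 4 → ZMod 2}
    (hG : D.IsPrimitive G (circleIndicator s U)) {b : X × ZMod 4} (hb : EvenEnd b)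
    (hbs : b.1 ∈ s) : G (ccw b) = G (ccw (ccw (ccw b))) := by
  have k3 : ∀ u v w : ZMod 2, u + v = v + w → u = w := by decide
  refine k3 _ (G (ccw (ccw b))) _ ?_
  rw [hG.add, hG.add]
  refine circleIndicator_congr ?_
  rw [← hb.splice_ccw hbs, circleOf_splice]

/-- A crossing parallel to crossings at which the splicing has been changed has both its sides on
the same circle. -/
theorem joined_union_of_parallel (hS : S.Nonempty) (hSt : ∀ w ∈ S, w ∉ t)
    (hVW : V ≠ W) (hedge : ∀ w ∈ S, D.stateEdge t w = s(V, W)) {x : X} (hxt : x ∉ t) (hxS : x ∉ S)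
    (hx : D.stateEdge t x = s(V, W)) : D.Joined (t ∪ S) x := by
  obtain ⟨w, hw⟩ := hS
  obtain ⟨a, rfl, ha, haV, haW⟩ := exists_evenEnd hx
  obtain ⟨b, rfl, hb, hbV, hbW⟩ := exists_evenEnd (hedge w hw)
  have hxtS : a.1 ∉ t ∪ S := by simp [hxt, hxS]
  -- `G` takes equal values on the far sides of `V` and `W`: from `a` along `V` to a switched
  -- crossing `b`, across `b`, and back along `W`. Hence the strands of `V` and `W` at `a`, which
  -- bound the same middle region, are crossed with equal jumps, and both belong to the circle
  -- through `ccw a`.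
  obtain ⟨G, hG⟩ := exists_isPrimitive_circleIndicator (t ∪ S) (D.circleOf (t ∪ S) (ccw a))
  have haV' : D.circleOf t (ccw (ccw (ccw (ccw a)))) = V := by rw [ccw_ccw_ccw_ccw, haV]
  have g1 : G (ccw a) = G (ccw b) :=
    hG.eq_of_parallel hSt hVW hedge ha hxt haV hVW haW (Or.inl rfl) hb hw hbV
  have g2 : G (ccw (ccw (ccw a))) = G (ccw (ccw (ccw b))) :=
    hG.eq_of_parallel hSt hVW.symm (fun w hw => (hedge w hw).trans Sym2.eq_swap) ha.ccw_ccw hxt haW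
      hVW.symm haV' (Or.inl rfl) hb.ccw_ccw hw hbW
  have g3 := hG.eq_across hb (Finset.mem_union_right t hw)
  have k : ∀ u v w : ZMod 2, u = w → u + v = v + w := by decide
  have g4 := k _ (G (ccw (ccw a))) _ (g1.trans (g3.trans g2.symm))
  rw [hG.add, hG.add, circleIndicator_of_eq rfl] at g4
  have h := circleOf_eq_of_circleIndicator g4.symm
  rw [ha.circleOf_ccw hxtS] at h
  exact ha.joined_iff.2 h.symm

/-- The first crossing of `S` merges `V` and `W`; every further one finds both its sides on one
circle and splits it. -/
theorem excess_union_of_parallel (hS : S.Nonempty) (hSt : ∀ w ∈ S, w ∉ t)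
    (hVW : V ≠ W) (hedge : ∀ w ∈ S, D.stateEdge t w = s(V, W)) :
    D.excess (t ∪ S) = D.excess t + 1 := by
  induction S using Finset.induction_on with
  | empty => exact absurd hS Finset.not_nonempty_empty
  | insert x S hx ih =>
    have hxt := hSt x (Finset.mem_insert_self _ _)
    have hxe := hedge x (Finset.mem_insert_self _ _)
    have hSt' : ∀ w ∈ S, w ∉ t := fun w hw => hSt w (Finset.mem_insert_of_mem hw)
    have hedge' : ∀ w ∈ S, D.stateEdge t w = s(V, W) :=
      fun w hw => hedge w (Finset.mem_insert_of_mem hw)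
    rw [Finset.union_insert]
    rcases S.eq_empty_or_nonempty with rfl | hne
    · rw [Finset.union_empty]
      refine excess_insert_of_not_joined hxt fun h => hVW ?_
      have := not_joined_of_notMem (S := ∅) hVW hxe (by simp)
      rw [Finset.union_empty] at this
      exact absurd h this
    · rw [excess_insert_of_joined (by simp [hx, hxt])
        (joined_union_of_parallel hne hSt' hVW hedge' hxt hx hxe), ih hne hSt' hedge']

/-- If the splicing is changed at crossings between `V` and `W`, then the parts of `V` and `W`
to which a third circle is connected remain on the same circle. -/
theorem circleOf_union_eq_of_triangle (hS : S.Nonempty) (hSt : ∀ w ∈ S, w ∉ t) {Y : D.Circle t}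
    (hVW : V ≠ W) (hVY : V ≠ Y) (hWY : W ≠ Y) (hedge : ∀ w ∈ S, D.stateEdge t w = s(V, W))
    {a b : X × ZMod 4} (ha : EvenEnd a) (hat : a.1 ∉ t) (haV : D.circleOf t a = V)
    (haY : D.circleOf t (ccw (ccw a)) = Y) (hb : EvenEnd b) (hbt : b.1 ∉ t)
    (hbW : D.circleOf t b = W) (hbY : D.circleOf t (ccw (ccw b)) = Y) :
    D.circleOf (t ∪ S) a = D.circleOf (t ∪ S) b := by
  obtain ⟨w, hw⟩ := hS
  obtain ⟨c, rfl, hc, hcV, hcW⟩ := exists_evenEnd (hedge w hw)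
  have hae : D.stateEdge t a.1 = s(V, Y) := by rw [ha.stateEdge_eq, haV, haY]
  have hbe : D.stateEdge t b.1 = s(W, Y) := by rw [hb.stateEdge_eq, hbW, hbY]
  have hYS : ∀ w ∈ S, Y ∉ D.stateEdge t w := by
    intro w hw
    rw [hedge w hw, Sym2.mem_iff, not_or]
    exact ⟨hVY.symm, hWY.symm⟩
  have haS : a.1 ∉ t ∪ S := by
    rw [Finset.mem_union, not_or]
    exact ⟨hat, fun h => hYS _ h (by rw [hae]; exact Sym2.mem_mk_right _ _)⟩
  have hbS : b.1 ∉ t ∪ S := by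
    rw [Finset.mem_union, not_or]
    exact ⟨hbt, fun h => hYS _ h (by rw [hbe]; exact Sym2.mem_mk_right _ _)⟩
  obtain ⟨G, hG⟩ := exists_isPrimitive_circleIndicator (t ∪ S) (D.circleOf (t ∪ S) a)
  have g1 : G (ccw a) = G (ccw c) :=
    hG.eq_of_parallel hSt hVW hedge ha hat haV hVY haY (Or.inr ⟨b.1, hbt, hbe⟩) hc hw hcV
  have g2 : G (ccw b) = G (ccw (ccw (ccw c))) :=
    hG.eq_of_parallel hSt hVW.symm (fun w hw => (hedge w hw).trans Sym2.eq_swap) hb hbt hbW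
      hWY hbY (Or.inr ⟨a.1, hat, hae⟩) hc.ccw_ccw hw hcW
  have g3 := hG.eq_across hc (Finset.mem_union_right t hw)
  -- The third circle `Y` is untouched and does not belong to the circle in question, so `G` does
  -- not change along `Y`. With equal values also on the far sides of `V` and `W`, the jumps at `a`
  -- and `b` agree.
  have g4 : G (ccw (ccw a)) = G (ccw (ccw b)) := by
    refine hG.eq_of_circleOf_eq (s := t ∪ S) (V := D.circleOf (t ∪ S) (ccw (ccw a)))
      (fun d hd => circleIndicator_of_ne fun h => hVY ?_) rfl (circleOf_union_eq hYS hbY haY)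
    rw [← haV]
    exact circleOf_eq_of_circleOf_union_eq hYS haY (hd.symm.trans h)
  have k : ∀ u v u' v' : ZMod 2, u = u' → v = v' → u + v = u' + v' := by decide
  have g5 := k _ _ _ _ (g1.trans (g3.trans g2.symm)) g4
  rw [hG.add, hG.add, circleIndicator_of_eq (ha.circleOf_ccw haS)] at g5
  have h := circleOf_eq_of_circleIndicator g5.symm
  rw [hb.circleOf_ccw hbS] at h
  exact h.symm

end Parallel

end LinkDiagram

/-! ### Travelling along a circle of the all-`A` state. -/

namespace LinkDiagram

variable {X : Type*} [Fintype X] [DecidableEq X] {D : LinkDiagram X}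

section Walk

theorem aNext_injective : Function.Injective D.aNext := by
  intro a b h
  have h1 : D.arc a = D.arc b := by
    rw [← splice_splice ∅ (D.arc a), ← splice_splice ∅ (D.arc b)]
    exact congrArg _ h
  rw [← D.arc_arc a, h1, D.arc_arc]

theorem mem_periodicPts_aNext (p : X × ZMod 4) : p ∈ Function.periodicPts D.aNext :=
  aNext_injective.mem_periodicPts p

theorem circleOf_aNext {S : Finset X} {a : X × ZMod 4} (h : (D.aNext a).1 ∉ S) :
    D.circleOf S (D.aNext a) = D.circleOf S a := by
  rw [aNext, splice_fst] at h
  rw [aNext, splice_congr (t := S) (by simp [h]), circleOf_splice, circleOf_arc]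

theorem circleOf_iterate_aNext {S : Finset X} (p : X × ZMod 4) {i j : ℕ} (hij : i ≤ j)
    (h : ∀ k, i < k → k ≤ j → (D.aNext^[k] p).1 ∉ S) :
    D.circleOf S (D.aNext^[j] p) = D.circleOf S (D.aNext^[i] p) := by
  induction j, hij using Nat.le_induction with
  | base => rfl
  | succ j hij ih =>
    rw [← ih fun k h1 h2 => h k h1 (by omega), Function.iterate_succ_apply']
    have := h (j + 1) (by omega) le_rfl
    rw [Function.iterate_succ_apply'] at this
    exact circleOf_aNext this

theorem circleOf_iterate_aNext_empty (p : X × ZMod 4) (j : ℕ) :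
    D.circleOf ∅ (D.aNext^[j] p) = D.circleOf ∅ p :=
  circleOf_iterate_aNext p (Nat.zero_le j) (by simp)

theorem iterate_aNext_add_minimalPeriod (p : X × ZMod 4) (k : ℕ) :
    D.aNext^[k + Function.minimalPeriod D.aNext p] p = D.aNext^[k] p := by
  rw [Function.iterate_add_apply, Function.iterate_minimalPeriod]

/-- A circle of the all-`A` state meets all the crossings at which it is attached. -/
theorem exists_iterate_aNext {p : X × ZMod 4} {x : X} (hx : D.circleOf ∅ p ∈ D.aEdge x) :
    ∃ k < Function.minimalPeriod D.aNext p, (D.aNext^[k] p).1 = x := by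
  set N := Function.minimalPeriod D.aNext p with hN
  have hN0 : 0 < N := Function.minimalPeriod_pos_of_mem_periodicPts (mem_periodicPts_aNext p)
  obtain ⟨a, hax, hap⟩ : ∃ a : X × ZMod 4, a.1 = x ∧ D.circleOf ∅ a = D.circleOf ∅ p := by
    rcases Sym2.mem_iff.1 hx with h | h
    · exact ⟨_, rfl, h.symm⟩
    · exact ⟨_, rfl, h.symm⟩
  set P : X × ZMod 4 → Prop := fun b => ∃ k, b = D.aNext^[k] p ∨ b = D.arc (D.aNext^[k] p) with hP
  have harc : ∀ b, P b → P (D.arc b) := by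
    rintro b ⟨k, rfl | rfl⟩
    · exact ⟨k, Or.inr rfl⟩
    · exact ⟨k, Or.inl (D.arc_arc _)⟩
  have hsp : ∀ b, P b → P (splice ∅ b) := by
    rintro b ⟨k, rfl | rfl⟩
    · obtain ⟨l, hl⟩ : ∃ l, D.aNext^[l + 1] p = D.aNext^[k] p := by
        refine ⟨k + N - 1, ?_⟩
        rw [show k + N - 1 + 1 = k + N by omega, iterate_aNext_add_minimalPeriod]
      refine ⟨l, Or.inr ?_⟩
      rw [← hl, Function.iterate_succ_apply']
      exact splice_splice _ _
    · exact ⟨k + 1, Or.inl (Function.iterate_succ_apply' D.aNext k p).symm⟩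
  have h1 : P p = P a := by
    refine eq_of_circleOf_eq (s := ∅) P (fun b => ?_) (fun b => ?_) hap.symm
    · refine propext ⟨fun h => ?_, harc b⟩
      rw [← D.arc_arc b]
      exact harc _ h
    · refine propext ⟨fun h => ?_, hsp b⟩
      rw [← splice_splice ∅ b]
      exact hsp _ h
  obtain ⟨k, hk⟩ : ∃ k, (D.aNext^[k] p).1 = x := by
    obtain ⟨k, rfl | rfl⟩ := h1.mp ⟨0, Or.inl rfl⟩
    · exact ⟨k, hax⟩
    · refine ⟨k + 1, ?_⟩
      rw [Function.iterate_succ_apply', aNext, splice_fst, hax]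
  refine ⟨k % N, Nat.mod_lt _ hN0, ?_⟩
  rw [Function.iterate_mod_minimalPeriod_eq, hk]

/-- The two ends of a crossing on one of two different circles. -/
theorem eq_or_eq_splice {a b : X × ZMod 4} (hab : a.1 = b.1) (hd : ¬ (D.aEdge a.1).IsDiag)
    (h : D.circleOf ∅ a = D.circleOf ∅ b) : a = b ∨ a = splice ∅ b := by
  obtain ⟨x, i⟩ := a
  obtain ⟨y, j⟩ := b
  simp only at hab hd
  subst hab
  rw [splice_of_notMem (Finset.notMem_empty x)]
  have hne : D.circleOf ∅ (x, 0) ≠ D.circleOf ∅ (x, 2) := fun h => hd (Sym2.mk_isDiag_iff.2 h)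
  have e0 : D.circleOf ∅ (x, 1) = D.circleOf ∅ (x, 0) :=
    EvenEnd.circleOf_ccw (a := (x, 0)) (Or.inl rfl) (Finset.notMem_empty _)
  have e2 : D.circleOf ∅ (x, 3) = D.circleOf ∅ (x, 2) :=
    EvenEnd.circleOf_ccw (a := (x, 2)) (Or.inr rfl) (Finset.notMem_empty _)
  have h3 : ∀ i : ZMod 4, i = 0 ∨ i = 1 ∨ i = 2 ∨ i = 3 := by decide
  have key : ∀ i j : ZMod 4, ((i = 0 ∨ i = 1) ↔ (j = 0 ∨ j = 1)) → i = j ∨ i = 1 - j := by decide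
  have hc : ∀ i : ZMod 4, (i = 0 ∨ i = 1) ↔ D.circleOf ∅ (x, i) = D.circleOf ∅ (x, 0) := by
    intro i
    rcases h3 i with rfl | rfl | rfl | rfl
    · simp
    · simp [e0]
    · exact iff_of_false (by decide) hne.symm
    · rw [e2]
      exact iff_of_false (by decide) hne.symm
  simp only [Prod.mk.injEq, true_and]
  refine key i j ?_
  rw [hc, hc, h]

/-- In one turn a non-loop crossing is met only once: its two ends on the circle are exchanged by
the splicing, which flips the checkerboard colour, whereas `aNext` preserves it. -/
theorem iterate_aNext_eq {p : X × ZMod 4} {k l : ℕ} (hk : k < Function.minimalPeriod D.aNext p)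
    (hl : l < Function.minimalPeriod D.aNext p) (h : (D.aNext^[k] p).1 = (D.aNext^[l] p).1)
    (hd : ¬ (D.aEdge (D.aNext^[k] p).1).IsDiag) : k = l := by
  refine Function.iterate_injOn_Iio_minimalPeriod hk hl ?_
  rcases eq_or_eq_splice h hd
    (by rw [circleOf_iterate_aNext_empty, circleOf_iterate_aNext_empty]) with h | h
  · exact h
  · exfalso
    obtain ⟨F, hF1, hF2⟩ := D.exists_checkerboard
    have k0 : ∀ u v : ZMod 2, u = v + 1 → v = u + 1 := by decide
    have hs : ∀ b, F (splice ∅ b) = F b + 1 := by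
      intro b
      rcases splice_eq_or ∅ b with h | h
      · rw [h, hF2]
      · refine k0 _ _ ?_
        conv_lhs => rw [h]
        exact hF2 _
    have hn : ∀ j, F (D.aNext^[j] p) = F p := by
      intro j
      induction j with
      | zero => rfl
      | succ j ih =>
        rw [Function.iterate_succ_apply', aNext, hs, hF1, ih]
        exact (k0 _ _ rfl).symm
    have h1 := hs (D.aNext^[l] p)
    rw [← h, hn, hn] at h1
    have k1 : ∀ u : ZMod 2, u ≠ u + 1 := by decide
    exact k1 _ h1

variable (D)

/-- The position at which the crossing `x` is met when travelling along a circle of the all-`A`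
state, starting from the end `p`. -/
noncomputable def position (p : X × ZMod 4) (x : X) : ℕ := sInf {k | (D.aNext^[k] p).1 = x}

variable {D}

theorem iterate_position {p : X × ZMod 4} {x : X} (hx : D.circleOf ∅ p ∈ D.aEdge x) :
    (D.aNext^[D.position p x] p).1 = x := by
  obtain ⟨k, -, hk⟩ := exists_iterate_aNext hx
  exact Nat.sInf_mem (s := {k | (D.aNext^[k] p).1 = x}) ⟨k, hk⟩

theorem position_lt {p : X × ZMod 4} {x : X} (hx : D.circleOf ∅ p ∈ D.aEdge x) :
    D.position p x < Function.minimalPeriod D.aNext p := by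
  obtain ⟨k, hk, hkx⟩ := exists_iterate_aNext hx
  exact (Nat.sInf_le hkx).trans_lt hk

theorem position_iterate (hD : D.IsAAdequate) {p : X × ZMod 4} {k : ℕ}
    (hk : k < Function.minimalPeriod D.aNext p) : D.position p (D.aNext^[k] p).1 = k := by
  have hx : D.circleOf ∅ p ∈ D.aEdge (D.aNext^[k] p).1 := by
    rw [← circleOf_iterate_aNext_empty p k]
    exact circleOf_mem_stateEdge _
  exact iterate_aNext_eq (position_lt hx) hk (iterate_position hx) (hD _)

/-- The second turn is needed for walks which pass the starting point. -/
theorem position_iterate_add (hD : D.IsAAdequate) {p : X × ZMod 4} {k : ℕ}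
    (hk : k < 2 * Function.minimalPeriod D.aNext p) :
    D.position p (D.aNext^[k] p).1 = k ∧ k < Function.minimalPeriod D.aNext p ∨
      D.position p (D.aNext^[k] p).1 + Function.minimalPeriod D.aNext p = k := by
  rcases lt_or_ge k (Function.minimalPeriod D.aNext p) with h | h
  · exact Or.inl ⟨position_iterate hD h, h⟩
  · right
    obtain ⟨l, rfl⟩ := Nat.exists_eq_add_of_le' h
    rw [iterate_aNext_add_minimalPeriod, position_iterate hD (by omega)]

theorem position_injOn {p : X × ZMod 4} {x y : X} (hx : D.circleOf ∅ p ∈ D.aEdge x)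
    (hy : D.circleOf ∅ p ∈ D.aEdge y) (h : D.position p x = D.position p y) : x = y := by
  rw [← iterate_position hx, h, iterate_position hy]

end Walk

/-! ### Lower bounds for the excess and parallel classes. -/

section LowerBound

theorem exists_aEdge_eq {V : D.AVertex} {x : X} (h : V ∈ D.aEdge x) :
    ∃ W, D.aEdge x = s(V, W) := ⟨Sym2.Mem.other h, (Sym2.other_spec h).symm⟩

/-- Changing the splicing at a crossing attached to a new circle increases the excess. -/
theorem excess_insert_of_leaf (hD : D.IsAAdequate) {S : Finset X} {y : X} {V : D.AVertex}
    (hy : V ∈ D.aEdge y) (hS : ∀ w ∈ S, V ∉ D.aEdge w) :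
    D.excess (insert y S) = D.excess S + 1 := by
  obtain ⟨W, hW⟩ := exists_aEdge_eq hy
  refine excess_insert_of_not_joined (fun h => hS y h hy) ?_
  have hVW : V ≠ W := by
    rintro rfl
    exact hD y (by rw [hW]; exact Sym2.mk_isDiag_iff.2 rfl)
  have := not_joined_of_notMem (t := ∅) hVW hW hS
  rwa [Finset.empty_union] at this

theorem excess_singleton (hD : D.IsAAdequate) (x : X) : D.excess {x} = 1 := by
  have := excess_insert_of_leaf hD (S := ∅) (y := x) (Sym2.mem_mk_left _ _) (by simp)
  rw [insert_empty_eq, excess_empty] at this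
  exact this

/-- Two different edges without loops: one endpoint of the first is not on the second, so both
crossings merge circles. -/
theorem excess_pair (hD : D.IsAAdequate) {x y : X} (h : D.aEdge x ≠ D.aEdge y) :
    D.excess {x, y} = 2 := by
  obtain ⟨V, hV, hV'⟩ : ∃ V ∈ D.aEdge x, V ∉ D.aEdge y := by
    by_contra hcon
    push Not at hcon
    have h1 := hcon _ (Sym2.mem_mk_left _ _)
    have h2 := hcon _ (Sym2.mem_mk_right _ _)
    exact h (((Sym2.mem_and_mem_iff fun e => hD x (Sym2.mk_isDiag_iff.2 e)).1 ⟨h1, h2⟩).symm)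
  rw [excess_insert_of_leaf hD hV (by simpa using hV'), excess_singleton hD]

/-- Three different crossings which do not form a triangle. -/
theorem excess_triple (hD : D.IsAAdequate) {x y z : X} (hxy : D.aEdge x ≠ D.aEdge y)
    (hxz : D.aEdge x ≠ D.aEdge z) (hyz : D.aEdge y ≠ D.aEdge z)
    (h : ¬ ∃ U V W, D.aEdge x = s(U, V) ∧ D.aEdge y = s(U, W) ∧ D.aEdge z = s(V, W)) :
    3 ≤ D.excess {x, y, z} := by
  have hleaf : ∀ {x y z : X}, D.aEdge y ≠ D.aEdge z → (∃ V ∈ D.aEdge x, V ∉ D.aEdge y ∧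
      V ∉ D.aEdge z) → 3 ≤ D.excess {x, y, z} := by
    rintro x y z hyz ⟨V, hV, hV1, hV2⟩
    rw [excess_insert_of_leaf hD hV (by simp [hV1, hV2]), excess_pair hD hyz]
  have hne : ∀ {x : X} {V W}, D.aEdge x = s(V, W) → V ≠ W := by
    rintro x V W h rfl
    exact hD x (by rw [h]; exact Sym2.mk_isDiag_iff.2 rfl)
  by_contra hcon
  -- An endpoint belonging to only one of the three edges would give excess 3. It suffices to
  -- exclude such endpoints of `x` and `y` to force a triangle.
  have c1 : ∀ V ∈ D.aEdge x, V ∈ D.aEdge y ∨ V ∈ D.aEdge z := by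
    intro V hV
    by_contra h'
    rw [not_or] at h'
    exact hcon (hleaf hyz ⟨V, hV, h'⟩)
  have c2 : ∀ V ∈ D.aEdge y, V ∈ D.aEdge x ∨ V ∈ D.aEdge z := by
    intro V hV
    by_contra h'
    rw [not_or] at h'
    refine hcon ?_
    rw [Finset.insert_comm]
    exact hleaf hxz ⟨V, hV, h'⟩
  have main : ∀ {y z : X}, D.aEdge x ≠ D.aEdge y → D.aEdge x ≠ D.aEdge z →
      (∀ V ∈ D.aEdge y, V ∈ D.aEdge x ∨ V ∈ D.aEdge z) →
      ∀ a b, D.aEdge x = s(a, b) → a ∈ D.aEdge y → b ∈ D.aEdge z →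
      ∃ W, D.aEdge y = s(a, W) ∧ D.aEdge z = s(b, W) := by
    intro y z hxy hxz c2 a b hab ha hb
    obtain ⟨W, hW⟩ := exists_aEdge_eq ha
    obtain ⟨W', hW'⟩ := exists_aEdge_eq hb
    refine ⟨W, hW, ?_⟩
    have h1 : W ≠ a := (hne hW).symm
    have h2 : W ≠ b := by
      rintro rfl
      exact hxy (hab.trans hW.symm)
    have h3 := c2 W (by rw [hW]; exact Sym2.mem_mk_right _ _)
    rw [hab, hW', Sym2.mem_iff, Sym2.mem_iff] at h3
    have : W = W' := by tauto
    rw [hW', this]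
  obtain ⟨a, b, hab⟩ : ∃ a b, D.aEdge x = s(a, b) := ⟨_, _, rfl⟩
  have hboth : ∀ {y}, D.aEdge x ≠ D.aEdge y → a ∈ D.aEdge y → b ∉ D.aEdge y := by
    intro y hy h1 h2
    exact hy (hab.trans ((Sym2.mem_and_mem_iff (hne hab)).1 ⟨h1, h2⟩).symm)
  rcases c1 a (by rw [hab]; exact Sym2.mem_mk_left _ _) with ha | ha
  · have hb := (c1 b (by rw [hab]; exact Sym2.mem_mk_right _ _)).resolve_left (hboth hxy ha)
    obtain ⟨W, h1, h2⟩ := main hxy hxz c2 a b hab ha hb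
    exact h ⟨a, b, W, hab, h1, h2⟩
  · have hb := (c1 b (by rw [hab]; exact Sym2.mem_mk_right _ _)).resolve_right (hboth hxz ha)
    have hba : D.aEdge x = s(b, a) := hab.trans Sym2.eq_swap
    obtain ⟨W, h1, h2⟩ := main hxy hxz c2 b a hba hb ha
    exact h ⟨b, a, W, hba, h1, h2⟩

end LowerBound

section Classes

theorem ne_of_aEdge_eq (hD : D.IsAAdequate) {x : X} {V W : D.AVertex} (h : D.aEdge x = s(V, W)) :
    V ≠ W := by
  rintro rfl
  exact hD x (by rw [h]; exact Sym2.mk_isDiag_iff.2 rfl)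

theorem excess_of_parallel (hD : D.IsAAdequate) {S : Finset X} (hS : S.Nonempty)
    {E : Sym2 D.AVertex} (hE : ∀ x ∈ S, D.aEdge x = E) : D.excess S = 1 := by
  obtain ⟨x, hx⟩ := hS
  obtain ⟨V, W⟩ := E
  have := excess_union_of_parallel (t := ∅) ⟨x, hx⟩ (by simp) (ne_of_aEdge_eq hD (hE x hx)) hE
  rwa [Finset.empty_union, excess_empty] at this

variable {S S' : Finset X} {V W : D.AVertex}

theorem stateEdge_eq_of_circleOf (hW : ∀ y ∈ S', W ∉ D.aEdge y)
    {a b : X × ZMod 4} (ha : EvenEnd a) (haW : D.circleOf ∅ (ccw (ccw a)) = W)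
    (hbW : D.circleOf ∅ (ccw (ccw b)) = W) (hab : D.circleOf S' a = D.circleOf S' b) :
    D.stateEdge S' a.1 = s(D.circleOf S' b, D.circleOf S' (ccw (ccw b))) := by
  have := circleOf_union_eq (t := ∅) hW haW hbW
  rw [Finset.empty_union] at this
  rw [ha.stateEdge_eq, hab, this]

theorem circleOf_ne_of_untouched (hVW : V ≠ W) (hW : ∀ y ∈ S', W ∉ D.aEdge y)
    {a b : X × ZMod 4} (ha : D.circleOf ∅ a = V) (hb : D.circleOf ∅ b = W) :
    D.circleOf S' a ≠ D.circleOf S' b := by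
  intro h
  have := circleOf_eq_of_circleOf_union_eq (t := ∅) (S := S') hW hb
    (b := a) (by rw [Finset.empty_union]; exact h.symm)
  exact hVW (ha.symm.trans this)

/-- Crossings between a circle `W` not touched by `S'` and one circle of the state `S'`. -/
theorem excess_union_of_circleOf_eq (hD : D.IsAAdequate) (hS : S.Nonempty)
    (hW : ∀ y ∈ S', W ∉ D.aEdge y)
    (hSW : ∀ x ∈ S, W ∈ D.aEdge x)
    (h : ∀ a b, EvenEnd a → EvenEnd b → a.1 ∈ S → b.1 ∈ S → D.circleOf ∅ (ccw (ccw a)) = W →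
      D.circleOf ∅ (ccw (ccw b)) = W → D.circleOf S' a = D.circleOf S' b) :
    D.excess (S' ∪ S) = D.excess S' + 1 := by
  obtain ⟨x, hx⟩ := hS
  have hend : ∀ x ∈ S, ∃ a : X × ZMod 4, a.1 = x ∧ EvenEnd a ∧
      D.circleOf ∅ (ccw (ccw a)) = W := by
    intro x hx
    obtain ⟨V, hV⟩ := exists_aEdge_eq (hSW x hx)
    obtain ⟨a, h1, h2, -, h3⟩ := exists_evenEnd (s := ∅) (x := x) (hV.trans Sym2.eq_swap)
    exact ⟨a, h1, h2, h3⟩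
  obtain ⟨b, rfl, hb, hbW⟩ := hend x hx
  refine excess_union_of_parallel ⟨_, hx⟩ (fun w hw hw' => hW w hw' (hSW w hw))
    (V := D.circleOf S' b) (W := D.circleOf S' (ccw (ccw b))) ?_ ?_
  · refine circleOf_ne_of_untouched (V := D.circleOf ∅ b) (W := W) ?_ hW rfl hbW
    refine ne_of_aEdge_eq hD (x := b.1) ?_
    rw [← hbW]
    exact hb.stateEdge_eq ∅
  · intro w hw
    obtain ⟨a, rfl, ha, haW⟩ := hend w hw
    exact stateEdge_eq_of_circleOf hW ha haW hbW (h a b ha hb hw hx haW hbW)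

/-- The untouched circle `W` is connected by `a` and `b` to two different circles of the state `S'`.
Switching `b` merges `W` with the one, switching `a` then merges in the other, and `excess_mono`
takes care of the rest of `S`. -/
theorem excess_union_of_circleOf_ne (hD : D.IsAAdequate)
    (hW : ∀ y ∈ S', W ∉ D.aEdge y) {a b : X × ZMod 4} (ha : EvenEnd a) (hb : EvenEnd b)
    (haS : a.1 ∈ S) (hbS : b.1 ∈ S) (haW : D.circleOf ∅ (ccw (ccw a)) = W)
    (hbW : D.circleOf ∅ (ccw (ccw b)) = W) (hab : D.circleOf S' a ≠ D.circleOf S' b) :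
    D.excess S' + 2 ≤ D.excess (S' ∪ S) := by
  have hcW : D.circleOf S' (ccw (ccw a)) = D.circleOf S' (ccw (ccw b)) := by
    have := circleOf_union_eq (t := ∅) hW haW hbW
    rwa [Finset.empty_union] at this
  have hne : ∀ a : X × ZMod 4, EvenEnd a → D.circleOf ∅ (ccw (ccw a)) = W →
      D.circleOf S' a ≠ D.circleOf S' (ccw (ccw a)) := by
    intro a ha haW
    refine circleOf_ne_of_untouched (V := D.circleOf ∅ a) (W := W) ?_ hW rfl haW
    refine ne_of_aEdge_eq hD (x := a.1) ?_
    rw [← haW]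
    exact ha.stateEdge_eq ∅
  have hmem : ∀ a : X × ZMod 4, EvenEnd a → D.circleOf ∅ (ccw (ccw a)) = W → a.1 ∉ S' := by
    intro a ha haW h
    exact hW _ h (haW ▸ circleOf_mem_stateEdge (ccw (ccw a)))
  have h1 : D.excess (insert b.1 S') = D.excess S' + 1 := by
    refine excess_insert_of_not_joined (hmem b hb hbW) ?_
    rw [hb.joined_iff]
    exact hne b hb hbW
  have hanb : a.1 ≠ b.1 := by
    intro h
    have := hb.stateEdge_eq (D := D) S'
    rw [← h, ha.stateEdge_eq, hcW, Sym2.eq_swap, Sym2.eq_swap (b := D.circleOf S' (ccw (ccw b)))]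
      at this
    exact hab (Sym2.congr_right.1 this)
  have h2 : D.excess (insert a.1 (insert b.1 S')) = D.excess (insert b.1 S') + 1 := by
    refine excess_insert_of_not_joined ?_ ?_
    · rw [Finset.mem_insert, not_or]
      exact ⟨hanb, hmem a ha haW⟩
    · have := not_joined_of_notMem (t := S') (S := {b.1}) (hne a ha haW) (ha.stateEdge_eq S') (by
        intro w hw
        rw [Finset.mem_singleton] at hw
        rw [hw, hb.stateEdge_eq, Sym2.mem_iff, not_or, ← hcW]
        exact ⟨hab, hne a ha haW⟩)
      rwa [Finset.union_comm, ← Finset.insert_eq] at this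
  rw [show D.excess S' + 2 = D.excess (insert a.1 (insert b.1 S')) by omega]
  refine excess_mono ?_
  intro c hc
  simp only [Finset.mem_insert] at hc
  rcases hc with rfl | rfl | hc
  · exact Finset.mem_union_right _ haS
  · exact Finset.mem_union_right _ hbS
  · exact Finset.mem_union_left _ hc

end Classes

end LinkDiagram

/-! ### Two adjacent edges: linked and unlinked places. -/

namespace LinkDiagram

variable {X : Type*} [Fintype X] [DecidableEq X] {D : LinkDiagram X}

section Adjacent

/-- At a `B`-spliced crossing whose sides differ, the two ends that the `A`-splicing would join lie
on opposite strands. This is where the walk along `V` jumps to another circle. -/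
theorem circleOf_splice_empty_ne {S : Finset X} {a : X × ZMod 4} (ha : a.1 ∈ S)
    (hJ : ¬ D.Joined S a.1) : D.circleOf S (splice ∅ a) ≠ D.circleOf S a := by
  have key : ∀ b : X × ZMod 4, b.1 = a.1 → EvenEnd b →
      D.circleOf S (ccw b) ≠ D.circleOf S b := by
    intro b hb he h
    refine hJ ?_
    rw [← hb, he.joined_iff, ← he.splice_ccw (hb ▸ ha), circleOf_splice, h]
  rcases splice_eq_or ∅ a with h | h
  · rw [h]
    exact key a rfl ((splice_eq_ccw_iff (Finset.notMem_empty _)).1 h)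
  · have he : EvenEnd (splice ∅ a) :=
      (splice_eq_ccw_iff (Finset.notMem_empty _)).1 (by rw [splice_splice, ← h])
    have := key _ (splice_fst _ _) he
    rw [← h] at this
    exact this.symm

/-- The walk meets the crossing at one of its two ends on that circle; as the crossing is still
`A`-spliced in `S`, both ends lie on the same circle of `S`. -/
theorem circleOf_iterate_position (hD : D.IsAAdequate) {S : Finset X} {p a : X × ZMod 4}
    (ha : D.circleOf ∅ a = D.circleOf ∅ p) (haS : a.1 ∉ S) :
    D.circleOf S (D.aNext^[D.position p a.1] p) = D.circleOf S a := by
  have hpos : (D.aNext^[D.position p a.1] p).1 = a.1 :=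
    iterate_position (ha ▸ circleOf_mem_stateEdge a)
  rcases eq_or_eq_splice hpos (hD _) (by rw [circleOf_iterate_aNext_empty, ha]) with h | h
  · rw [h]
  · rw [h, splice_congr (t := S) (by simp [haS]), circleOf_splice]

variable {S S' : Finset X} {p : X × ZMod 4} {W W' : D.AVertex}

/-- Two adjacent classes of parallel crossings, attached to the circle through `p` at unlinked
places. -/
theorem excess_union_of_unlinked (hD : D.IsAAdequate) (hWW' : W ≠ W') (hS : S.Nonempty)
    (hS' : S'.Nonempty) (hSE : ∀ x ∈ S, D.aEdge x = s(D.circleOf ∅ p, W))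
    (hSE' : ∀ x ∈ S', D.aEdge x = s(D.circleOf ∅ p, W'))
    (h : Finset.Unlinked (D.position p) S S') : D.excess (S' ∪ S) = 2 := by
  set V := D.circleOf ∅ p with hV
  set N := Function.minimalPeriod D.aNext p with hN
  have hVW : V ≠ W := by
    obtain ⟨x, hx⟩ := hS
    exact ne_of_aEdge_eq hD (hSE x hx)
  have hW : ∀ y ∈ S', W ∉ D.aEdge y := by
    intro y hy
    rw [hSE' y hy, Sym2.mem_iff, not_or]
    exact ⟨hVW.symm, hWW'⟩
  have hSS' : ∀ x ∈ S, x ∉ S' := fun x hx hx' =>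
    hW x hx' (by rw [hSE x hx]; exact Sym2.mem_mk_right _ _)
  have hVS : ∀ x ∈ S, V ∈ D.aEdge x := fun x hx => by
    rw [hSE x hx]; exact Sym2.mem_mk_left _ _
  have hend : ∀ a, EvenEnd a → a.1 ∈ S → D.circleOf ∅ (ccw (ccw a)) = W →
      D.circleOf ∅ a = V := by
    intro a ha haS haW
    have := ha.stateEdge_eq (D := D) ∅
    rw [haW] at this
    exact (Sym2.congr_left.1 ((hSE _ haS).symm.trans this)).symm
  -- the case of a smaller position first
  have main : ∀ a b, EvenEnd a → EvenEnd b → a.1 ∈ S → b.1 ∈ S → D.circleOf ∅ a = V →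
      D.circleOf ∅ b = V → D.position p a.1 < D.position p b.1 →
      D.circleOf S' a = D.circleOf S' b := by
    intro a b _ _ haS hbS haV hbV hlt
    rw [← circleOf_iterate_position hD haV (hSS' _ haS),
      ← circleOf_iterate_position hD hbV (hSS' _ hbS)]
    have hbN : D.position p b.1 < N := position_lt (hVS _ hbS)
    -- Either no place of `S'` lies between the two positions, and the walk goes directly from `a`
    -- to `b`; or all of them do, and it goes from `b` past the starting point to `a` one turn
    -- later.
    rcases h _ haS _ hbS hlt with h | h
    · refine (circleOf_iterate_aNext p hlt.le fun k h1 h2 hk => ?_).symm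
      have hpk : D.position p (D.aNext^[k] p).1 = k := position_iterate hD (by omega)
      have h3 := h _ hk
      rw [hpk] at h3
      have : k = D.position p b.1 := by omega
      rw [this] at hk
      exact hSS' _ hbS (by rwa [iterate_position (hVS _ hbS)] at hk)
    · rw [← iterate_aNext_add_minimalPeriod p (D.position p a.1)]
      refine circleOf_iterate_aNext p (by omega) fun k h1 h2 hk => ?_
      have h3 := h _ hk
      have h4 := position_iterate_add hD (p := p) (k := k) (by omega)
      omega
  rw [excess_union_of_circleOf_eq hD hS hW
    (fun x hx => by rw [hSE x hx]; exact Sym2.mem_mk_right _ _),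
    excess_of_parallel hD hS' hSE']
  intro a b ha hb haS hbS haW hbW
  have haV := hend a ha haS haW
  have hbV := hend b hb hbS hbW
  rcases lt_trichotomy (D.position p a.1) (D.position p b.1) with hlt | heq | hlt
  · exact main a b ha hb haS hbS haV hbV hlt
  · rw [← circleOf_iterate_position hD haV (hSS' _ haS),
      ← circleOf_iterate_position hD hbV (hSS' _ hbS), heq]
  · exact (main b a hb ha hbS haS hbV haV hlt).symm

/-- Two adjacent classes of parallel crossings, attached to the circle through `p` at linked
places. -/
theorem three_le_excess_union (hD : D.IsAAdequate) (hWW' : W ≠ W')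
    (hSE : ∀ x ∈ S, D.aEdge x = s(D.circleOf ∅ p, W))
    (hSE' : ∀ x ∈ S', D.aEdge x = s(D.circleOf ∅ p, W'))
    (h : ¬ Finset.Unlinked (D.position p) S S') : 3 ≤ D.excess (S' ∪ S) := by
  unfold Finset.Unlinked at h
  push Not at h
  obtain ⟨x, hx, x', hx', hxx', ⟨b, hb, hxb, hbx'⟩, ⟨b', hb', hb'o⟩⟩ := h
  set V := D.circleOf ∅ p with hV
  set N := Function.minimalPeriod D.aNext p with hN
  have hVW : V ≠ W := ne_of_aEdge_eq hD (hSE x hx)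
  have hVW' : V ≠ W' := ne_of_aEdge_eq hD (hSE' b hb)
  have hW : ∀ y ∈ S', W ∉ D.aEdge y := by
    intro y hy
    rw [hSE' y hy, Sym2.mem_iff, not_or]
    exact ⟨hVW.symm, hWW'⟩
  have hVS : ∀ x ∈ S, V ∈ D.aEdge x := fun x hx => by
    rw [hSE x hx]; exact Sym2.mem_mk_left _ _
  have hVS' : ∀ x ∈ S', V ∈ D.aEdge x := fun x hx => by
    rw [hSE' x hx]; exact Sym2.mem_mk_left _ _
  have hbb' : b ≠ b' := by
    rintro rfl
    have := hb'o hxb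
    omega
  -- One crossing of `S'` between `x` and `x'` and one outside are enough: by monotonicity the
  -- others can be ignored.
  set B : Finset X := insert b {b'} with hB
  have hBS' : B ⊆ S' := by
    intro y hy
    simp only [hB, Finset.mem_insert, Finset.mem_singleton] at hy
    rcases hy with rfl | rfl <;> assumption
  have hSB : ∀ x ∈ S, x ∉ B := fun x hx hx' =>
    hW x (hBS' hx') (by rw [hSE x hx]; exact Sym2.mem_mk_right _ _)
  -- Switching `b'` merges `V` and `W'`, and switching the parallel `b` splits the result, so the
  -- two sides of `b` end on different circles.
  have hnJ : ¬ D.Joined B b := by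
    rw [hB, joined_insert_iff D (by simpa using hbb'), not_not]
    have := joined_union_of_parallel (t := ∅) (S := {b'}) (Finset.singleton_nonempty _) (by simp)
      hVW' (fun w hw => by
        rw [Finset.mem_singleton] at hw
        rw [hw]
        exact hSE' b' hb') (Finset.notMem_empty b) (by simpa using hbb') (hSE' b hb)
    rwa [Finset.empty_union] at this
  obtain ⟨j, hj⟩ : ∃ j, D.position p b = j + 1 := ⟨D.position p b - 1, by omega⟩
  have hx'N : D.position p x' < N := position_lt (hVS _ hx')
  have hqb : (D.aNext^[j + 1] p).1 = b := by rw [← hj, iterate_position (hVS' _ hb)]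
  -- The walk from `x` to `x'` changes circle exactly once, at `b`. So `x` and `x'` attach `W` to
  -- two different circles of the state `B`, which costs 2 beyond the excess 1 of `B`.
  have hcut : D.circleOf B (D.aNext^[j + 1] p) ≠ D.circleOf B (D.aNext^[j] p) := by
    rw [Function.iterate_succ_apply', aNext, splice_fst] at hqb
    rw [Function.iterate_succ_apply', aNext, ← circleOf_arc D B (D.aNext^[j] p)]
    exact circleOf_splice_empty_ne (by rw [hqb]; exact Finset.mem_insert_self _ _)
      (by rw [hqb]; exact hnJ)
  have hwalk : ∀ k, D.position p x < k → k ≤ D.position p x' → k ≠ j + 1 →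
      (D.aNext^[k] p).1 ∉ B := by
    intro k h1 h2 h3 hk
    have hpk : D.position p (D.aNext^[k] p).1 = k := position_iterate hD (by omega)
    rcases eq_or_ne k (D.position p x') with heq | hne
    · rw [heq, iterate_position (hVS _ hx')] at hk
      exact hSB _ hx' hk
    · simp only [hB, Finset.mem_insert, Finset.mem_singleton] at hk
      rcases hk with hk | hk <;> rw [hk] at hpk
      · omega
      · have := hb'o (by omega)
        omega
  have h1 : D.circleOf B (D.aNext^[j] p) = D.circleOf B (D.aNext^[D.position p x] p) :=
    circleOf_iterate_aNext p (by omega) fun k h1 h2 => hwalk k h1 (by omega) (by omega)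
  have h2 : D.circleOf B (D.aNext^[D.position p x'] p) = D.circleOf B (D.aNext^[j + 1] p) :=
    circleOf_iterate_aNext p (by omega) fun k h1 h2 => hwalk k (by omega) h2 (by omega)
  obtain ⟨a, rfl, ha, haV, haW⟩ := exists_evenEnd (s := ∅) (hSE x hx)
  obtain ⟨a', rfl, ha', haV', haW'⟩ := exists_evenEnd (s := ∅) (hSE x' hx')
  have hab : D.circleOf B a ≠ D.circleOf B a' := by
    rw [← circleOf_iterate_position hD haV (hSB _ hx),
      ← circleOf_iterate_position hD haV' (hSB _ hx'), ← h1, h2]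
    exact hcut.symm
  have h3 := excess_union_of_circleOf_ne (S := S) hD (fun y hy => hW y (hBS' hy)) ha ha' hx hx'
    haW haW' hab
  have h4 : D.excess B = 1 :=
    excess_of_parallel hD (Finset.insert_nonempty _ _) fun y hy => hSE' y (hBS' hy)
  rw [h4] at h3
  exact h3.trans (excess_mono (Finset.union_subset_union_left hBS'))

theorem excess_union_eq_two_iff (hD : D.IsAAdequate) (hWW' : W ≠ W') (hS : S.Nonempty)
    (hS' : S'.Nonempty) (hSE : ∀ x ∈ S, D.aEdge x = s(D.circleOf ∅ p, W))
    (hSE' : ∀ x ∈ S', D.aEdge x = s(D.circleOf ∅ p, W')) :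
    D.excess (S' ∪ S) = 2 ↔ Finset.Unlinked (D.position p) S S' := by
  refine ⟨fun h => ?_, excess_union_of_unlinked hD hWW' hS hS' hSE hSE'⟩
  by_contra hcon
  have := three_le_excess_union hD hWW' hSE hSE' hcon
  omega

variable (D) in
/-- The crossings in a class of parallel edges of the `A`-graph. -/
noncomputable def edgeClass (E : Sym2 D.AVertex) : Finset X :=
  open Classical in Finset.univ.filter fun x => D.aEdge x = E

theorem mem_edgeClass {E : Sym2 D.AVertex} {x : X} : x ∈ D.edgeClass E ↔ D.aEdge x = E := by
  simp [edgeClass]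

theorem separated_iff (hD : D.IsAAdequate) {V : D.AVertex} (hWW' : W ≠ W') (hV : D.circleOf ∅ p = V)
    (hE : (D.edgeClass s(V, W)).Nonempty) {y : X} (hyE : D.aEdge y = s(V, W'))
    (hy : D.position p y = 0) :
    D.Separated V s(V, W) s(V, W') ↔
      Finset.Unlinked (D.position p) (D.edgeClass s(V, W)) (D.edgeClass s(V, W')) := by
  have hyB : y ∈ D.edgeClass s(V, W') := mem_edgeClass.2 hyE
  constructor
  · rintro ⟨p', hp', m, hm⟩
    subst hV
    -- The excess does not refer to a starting point, so passing through it replaces `p` by the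
    -- point `p'` of the given division.
    rw [← excess_union_eq_two_iff hD hWW' hE ⟨y, hyB⟩ (fun x hx => mem_edgeClass.1 hx)
      fun x hx => mem_edgeClass.1 hx]
    rw [← hp'] at hE hyB hm ⊢
    rw [excess_union_eq_two_iff hD hWW' hE ⟨y, hyB⟩ (fun x hx => mem_edgeClass.1 hx)
      fun x hx => mem_edgeClass.1 hx]
    intro a ha a' ha' _
    left
    intro b hb hab
    rw [mem_edgeClass] at ha' hb
    have hb' : D.circleOf ∅ p' ∈ D.aEdge b := by rw [hb]; exact Sym2.mem_mk_left _ _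
    have ha'' : D.circleOf ∅ p' ∈ D.aEdge a' := by rw [ha']; exact Sym2.mem_mk_left _ _
    have h1 := (hm _ (position_lt ha'')).1 (by rw [iterate_position ha'', ha'])
    have h2 := (hm _ (position_lt hb')).2 (by rw [iterate_position hb', hb])
    omega
  · intro hU
    subst hV
    set V := D.circleOf ∅ p with hV
    set N := Function.minimalPeriod D.aNext p with hN
    have hVA : ∀ x ∈ D.edgeClass s(V, W), V ∈ D.aEdge x := fun x hx => by
      rw [mem_edgeClass.1 hx]; exact Sym2.mem_mk_left _ _
    have hVB : ∀ x ∈ D.edgeClass s(V, W'), V ∈ D.aEdge x := fun x hx => by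
      rw [mem_edgeClass.1 hx]; exact Sym2.mem_mk_left _ _
    have hne : ∀ x ∈ D.edgeClass s(V, W), ∀ x' ∈ D.edgeClass s(V, W'),
        D.position p x ≠ D.position p x' := by
      intro x hx x' hx' h
      have := position_injOn (hVA x hx) (hVB x' hx') h
      subst this
      exact hWW' (Sym2.congr_right.1 ((mem_edgeClass.1 hx).symm.trans (mem_edgeClass.1 hx')))
    obtain ⟨a, ha, hmin⟩ := Finset.exists_min_image _ (D.position p) hE
    obtain ⟨a', ha', hmax⟩ := Finset.exists_max_image _ (D.position p) hE
    have haN : D.position p a' < N := position_lt (hVA a' ha')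
    have haa' := hmin a' ha'
    -- The first semicircle runs from the first place of `E` to the last, both included. No place of
    -- `E'` lies in it: the alternative that all lie between two places of `E` fails for `y`, which
    -- has position 0.
    refine ⟨D.aNext^[D.position p a] p, circleOf_iterate_aNext_empty _ _,
      D.position p a' - D.position p a + 1, fun k hk => ?_⟩
    rw [Function.minimalPeriod_apply_iterate (mem_periodicPts_aNext p)] at hk
    rw [← Function.iterate_add_apply]
    have hpos := position_iterate_add hD (p := p) (k := k + D.position p a) (by omega)
    constructor
    · intro hx
      have hx := mem_edgeClass.2 hx
      have h1 := hmin _ hx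
      have h2 := hmax _ hx
      omega
    · intro hx
      have hx := mem_edgeClass.2 hx
      have h1 := hne _ ha _ hx
      have h2 := hne _ ha' _ hx
      rcases haa'.eq_or_lt with h | h
      · omega
      · rcases hU a ha a' ha' h with h3 | h3
        · have h4 := h3 _ hx
          omega
        · have := h3 y hyB
          omega

open Classical in
/-- The signed number of states of excess two whose `B`-splicings are in two given adjacent
classes of parallel crossings. -/
theorem sum_excess_adjacent (hD : D.IsAAdequate) {V : D.AVertex} (hWW' : W ≠ W')
    (hE : (D.edgeClass s(V, W)).Nonempty) (hE' : (D.edgeClass s(V, W')).Nonempty) :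
    ∑ S ∈ (D.edgeClass s(V, W)).powerset, ∑ S' ∈ (D.edgeClass s(V, W')).powerset,
      (-1 : ℤ) ^ S.card * (-1 : ℤ) ^ S'.card *
      (if S.Nonempty ∧ S'.Nonempty ∧ D.excess (S' ∪ S) = 2 then 1 else 0) =
    if D.Separated V s(V, W) s(V, W') then 1 else 0 := by
  obtain ⟨y, hy⟩ := hE'
  have hyE := mem_edgeClass.1 hy
  -- Starting the walk at a crossing of the second class provides the place of position 0 which
  -- `Finset.sum_unlinked` requires.
  obtain ⟨p, rfl, hp, hpV, -⟩ := exists_evenEnd (s := ∅) (x := y) hyE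
  have hpy : D.position p p.1 = 0 :=
    position_iterate hD (p := p) (k := 0)
      (Function.minimalPeriod_pos_of_mem_periodicPts (mem_periodicPts_aNext p))
  rw [separated_iff hD hWW' hpV hE hyE hpy]
  subst hpV
  rw [← Finset.sum_unlinked (D.position p) _ _ ?_ hE hy hpy]
  · refine Finset.sum_congr rfl fun S hS => Finset.sum_congr rfl fun S' hS' => ?_
    rw [Finset.mem_powerset] at hS hS'
    congr 1
    refine if_congr (and_congr_right fun h1 => and_congr_right fun h2 => ?_) rfl rfl
    exact excess_union_eq_two_iff hD hWW' h1 h2 (fun x hx => mem_edgeClass.1 (hS hx))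
      fun x hx => mem_edgeClass.1 (hS' hx)
  · intro x hx x' hx' h
    have hx := mem_edgeClass.1 hx
    have hx' := mem_edgeClass.1 hx'
    have := position_injOn (p := p) (by rw [hx]; exact Sym2.mem_mk_left _ _)
      (by rw [hx']; exact Sym2.mem_mk_left _ _) h
    subst this
    exact hWW' (Sym2.congr_right.1 (hx.symm.trans hx'))

end Adjacent

end LinkDiagram

/-! ### Triangles and pairs of edges. -/

namespace LinkDiagram

variable {X : Type*} [Fintype X] [DecidableEq X] {D : LinkDiagram X}

section Triangles

/-- Three edges which form a triangle. -/
def IsTriangle {α : Type*} (E E' E'' : Sym2 α) : Prop :=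
  ∃ U V W, E = s(U, V) ∧ E' = s(U, W) ∧ E'' = s(V, W)

theorem IsTriangle.unique {α : Type*} {E E' E₁ E₂ : Sym2 α} (hne : E ≠ E')
    (h₁ : IsTriangle E E' E₁) (h₂ : IsTriangle E E' E₂) : E₁ = E₂ := by
  obtain ⟨U, V, W, rfl, rfl, rfl⟩ := h₁
  obtain ⟨U', V', W', h1, h2, rfl⟩ := h₂
  have hVW : V ≠ W := by
    rintro rfl
    exact hne rfl
  simp only [Sym2.eq_iff] at h1 h2 ⊢
  grind

theorem three_le_excess_of_not_isTriangle (hD : D.IsAAdequate) {S : Finset X} {x y z : X}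
    (hx : x ∈ S) (hy : y ∈ S) (hz : z ∈ S) (hxy : D.aEdge x ≠ D.aEdge y)
    (hxz : D.aEdge x ≠ D.aEdge z) (hyz : D.aEdge y ≠ D.aEdge z)
    (h : ¬ IsTriangle (D.aEdge x) (D.aEdge y) (D.aEdge z)) : 3 ≤ D.excess S := by
  refine (excess_triple hD hxy hxz hyz h).trans (excess_mono ?_)
  intro w hw
  simp only [Finset.mem_insert, Finset.mem_singleton] at hw
  rcases hw with rfl | rfl | rfl <;> assumption

-- Two sides determine the third side of a triangle, so among four different edges some three do not
-- form one.
open Classical in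
theorem three_le_excess_of_four_le_card (hD : D.IsAAdequate) {S : Finset X}
    (h : 4 ≤ (S.image D.aEdge).card) : 3 ≤ D.excess S := by
  obtain ⟨T, hT, hT4⟩ := Finset.exists_subset_card_eq h
  obtain ⟨E, T₁, hE, rfl, hT₁⟩ := Finset.card_eq_succ.1 hT4
  obtain ⟨a, b, c, hab, hac, hbc, rfl⟩ := Finset.card_eq_three.1 hT₁
  simp only [Finset.mem_insert, Finset.mem_singleton, not_or] at hE
  obtain ⟨x, hx, rfl⟩ := Finset.mem_image.1 (hT (Finset.mem_insert_self _ _))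
  obtain ⟨y, hy, rfl⟩ := Finset.mem_image.1
    (hT (Finset.mem_insert_of_mem (Finset.mem_insert_self _ _)))
  obtain ⟨z, hz, rfl⟩ := Finset.mem_image.1
    (hT (Finset.mem_insert_of_mem (Finset.mem_insert_of_mem (Finset.mem_insert_self _ _))))
  obtain ⟨u, hu, rfl⟩ := Finset.mem_image.1 (hT (Finset.mem_insert_of_mem
    (Finset.mem_insert_of_mem (Finset.mem_insert_of_mem (Finset.mem_singleton_self _)))))
  by_cases h1 : IsTriangle (D.aEdge x) (D.aEdge y) (D.aEdge z)
  · refine three_le_excess_of_not_isTriangle hD hx hy hu hE.1 hE.2.2 hac fun h2 => ?_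
    exact hbc (h1.unique hE.1 h2)
  · exact three_le_excess_of_not_isTriangle hD hx hy hz hE.1 hE.2.1 hab h1

/-- The crossings between `U` and `V` give excess 1. Afterwards all crossings at `W` lead to one and
the same circle, by `circleOf_union_eq_of_triangle`, so they add only 1. -/
theorem excess_of_isTriangle (hD : D.IsAAdequate) {S : Finset X} {U V W : D.AVertex}
    (hS : ∀ x ∈ S, D.aEdge x = s(U, V) ∨ D.aEdge x = s(U, W) ∨ D.aEdge x = s(V, W))
    (h1 : ∃ x ∈ S, D.aEdge x = s(U, V)) (h2 : ∃ x ∈ S, D.aEdge x = s(U, W))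
    (h3 : ∃ x ∈ S, D.aEdge x = s(V, W)) : D.excess S = 2 := by
  classical
  obtain ⟨x, hx, hxE⟩ := h1
  obtain ⟨y, hy, hyE⟩ := h2
  obtain ⟨z, hz, hzE⟩ := h3
  have hUV := ne_of_aEdge_eq hD hxE
  have hUW := ne_of_aEdge_eq hD hyE
  have hVW := ne_of_aEdge_eq hD hzE
  set S₁ := S.filter fun x => D.aEdge x = s(U, V) with hS₁
  set S₂ := S.filter fun x => ¬ D.aEdge x = s(U, V) with hS₂
  have hS₁E : ∀ w ∈ S₁, D.aEdge w = s(U, V) := fun w hw => (Finset.mem_filter.1 hw).2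
  have hS₂E : ∀ w ∈ S₂, D.aEdge w = s(U, W) ∨ D.aEdge w = s(V, W) := fun w hw =>
    (hS w (Finset.mem_filter.1 hw).1).resolve_left (Finset.mem_filter.1 hw).2
  have hxS₁ : x ∈ S₁ := Finset.mem_filter.2 ⟨hx, hxE⟩
  have hyS₂ : y ∈ S₂ := Finset.mem_filter.2 ⟨hy, by
    rw [hyE]
    exact fun h => hVW (Sym2.congr_right.1 h).symm⟩
  rw [← Finset.filter_union_filter_not_eq (fun x => D.aEdge x = s(U, V)) S,
    excess_union_of_circleOf_eq hD (W := W) ⟨y, hyS₂⟩, excess_of_parallel hD ⟨x, hxS₁⟩ hS₁E]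
  · intro w hw
    rw [hS₁E w hw, Sym2.mem_iff, not_or]
    exact ⟨hUW.symm, hVW.symm⟩
  · intro w hw
    rcases hS₂E w hw with h | h <;> rw [h] <;> exact Sym2.mem_mk_right _ _
  · obtain ⟨c, rfl, hc, hcU, hcW⟩ := exists_evenEnd (s := ∅) hyE
    obtain ⟨d, rfl, hd, hdV, hdW⟩ := exists_evenEnd (s := ∅) hzE
    have tri : ∀ a b : X × ZMod 4, EvenEnd a → EvenEnd b → D.circleOf ∅ a = U →
        D.circleOf ∅ b = V → D.circleOf ∅ (ccw (ccw a)) = W → D.circleOf ∅ (ccw (ccw b)) = W →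
        D.circleOf S₁ a = D.circleOf S₁ b := by
      intro a b ha hb haU hbV haW hbW
      have := circleOf_union_eq_of_triangle (t := ∅) ⟨x, hxS₁⟩ (by simp) hUV hUW hVW hS₁E ha
        (Finset.notMem_empty _) haU haW hb (Finset.notMem_empty _) hbV hbW
      rwa [Finset.empty_union] at this
    have side : ∀ a : X × ZMod 4, EvenEnd a → a.1 ∈ S₂ → D.circleOf ∅ (ccw (ccw a)) = W →
        D.circleOf ∅ a = U ∨ D.circleOf ∅ a = V := by
      intro a ha haS haW
      have h := ha.stateEdge_eq (D := D) ∅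
      rw [haW] at h
      exact (hS₂E _ haS).imp (fun h' => (Sym2.congr_left.1 (h'.symm.trans h)).symm)
        fun h' => (Sym2.congr_left.1 (h'.symm.trans h)).symm
    have all : ∀ a : X × ZMod 4, EvenEnd a → a.1 ∈ S₂ → D.circleOf ∅ (ccw (ccw a)) = W →
        D.circleOf S₁ a = D.circleOf S₁ c := by
      intro a ha haS haW
      rcases side a ha haS haW with h | h
      -- Two ends on `U` are compared through an end on `V`; the triangle argument applies only
      -- between `U` and `V`.
      · rw [tri a d ha hd h hdV haW hdW, tri c d hc hd hcU hdV hcW hdW]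
      · exact (tri c a hc ha hcU h hcW haW).symm
    intro a b ha hb haS hbS haW hbW
    rw [all a ha haS haW, all b hb hbS hbW]

end Triangles

section Pairs

-- A set whose crossings reduce to exactly `E` and `E'` is the disjoint union of a nonempty subset
-- of each class.
open Classical in
theorem sum_image_eq_pair {E E' : Sym2 D.AVertex} (h : E ≠ E') (f : Finset X → ℤ) :
    ∑ S with S.image D.aEdge = {E, E'}, (-1 : ℤ) ^ S.card * f S =
    ∑ S ∈ (D.edgeClass E).powerset, ∑ S' ∈ (D.edgeClass E').powerset,
      (-1 : ℤ) ^ S.card * (-1 : ℤ) ^ S'.card *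
      (if S.Nonempty ∧ S'.Nonempty then f (S' ∪ S) else 0) := by
  rw [← Finset.sum_product']
  simp_rw [mul_ite, mul_zero]
  rw [← Finset.sum_filter]
  refine Finset.sum_bij' (fun S _ => (S.filter (D.aEdge · = E), S.filter (D.aEdge · = E')))
    (fun P _ => P.2 ∪ P.1) ?_ ?_ ?_ ?_ ?_
  · intro S hS
    have hS := (Finset.mem_filter.1 hS).2
    simp only [Finset.mem_filter, Finset.mem_product, Finset.mem_powerset]
    refine ⟨⟨fun x hx => mem_edgeClass.2 (Finset.mem_filter.1 hx).2,
      fun x hx => mem_edgeClass.2 (Finset.mem_filter.1 hx).2⟩, ?_, ?_⟩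
    · obtain ⟨x, hx, hxE⟩ := Finset.mem_image.1
        (hS ▸ Finset.mem_insert_self E {E'} : E ∈ S.image D.aEdge)
      exact ⟨x, Finset.mem_filter.2 ⟨hx, hxE⟩⟩
    · obtain ⟨x, hx, hxE⟩ := Finset.mem_image.1
        (hS ▸ Finset.mem_insert_of_mem (Finset.mem_singleton_self E') : E' ∈ S.image D.aEdge)
      exact ⟨x, Finset.mem_filter.2 ⟨hx, hxE⟩⟩
  · rintro ⟨S, S'⟩ hP
    simp only [Finset.mem_filter, Finset.mem_product, Finset.mem_powerset] at hP
    obtain ⟨⟨h1, h2⟩, ⟨x, hx⟩, ⟨y, hy⟩⟩ := hP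
    refine Finset.mem_filter.2 ⟨Finset.mem_univ _, ?_⟩
    ext F
    simp only [Finset.mem_image, Finset.mem_union, Finset.mem_insert, Finset.mem_singleton]
    constructor
    · rintro ⟨z, hz | hz, rfl⟩
      · exact Or.inr (mem_edgeClass.1 (h2 hz))
      · exact Or.inl (mem_edgeClass.1 (h1 hz))
    · rintro (rfl | rfl)
      · exact ⟨x, Or.inr hx, mem_edgeClass.1 (h1 hx)⟩
      · exact ⟨y, Or.inl hy, mem_edgeClass.1 (h2 hy)⟩
  · intro S hS
    have hS := (Finset.mem_filter.1 hS).2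
    ext x
    simp only [Finset.mem_union, Finset.mem_filter]
    constructor
    · rintro (h | h) <;> exact h.1
    · intro hx
      have : D.aEdge x ∈ S.image D.aEdge := Finset.mem_image_of_mem _ hx
      rw [hS, Finset.mem_insert, Finset.mem_singleton] at this
      tauto
  · rintro ⟨S, S'⟩ hP
    simp only [Finset.mem_filter, Finset.mem_product, Finset.mem_powerset] at hP
    obtain ⟨⟨h1, h2⟩, -⟩ := hP
    have e1 : ∀ x ∈ S, D.aEdge x = E := fun x hx => mem_edgeClass.1 (h1 hx)
    have e2 : ∀ x ∈ S', D.aEdge x = E' := fun x hx => mem_edgeClass.1 (h2 hx)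
    simp only [Prod.mk.injEq]
    constructor
    · ext x
      simp only [Finset.mem_filter, Finset.mem_union]
      constructor
      · rintro ⟨hx | hx, hE⟩
        · exact absurd (hE.symm.trans (e2 x hx)) h
        · exact hx
      · exact fun hx => ⟨Or.inr hx, e1 x hx⟩
    · ext x
      simp only [Finset.mem_filter, Finset.mem_union]
      constructor
      · rintro ⟨hx | hx, hE⟩
        · exact hx
        · exact absurd ((e1 x hx).symm.trans hE) h
      · exact fun hx => ⟨Or.inl hx, e2 x hx⟩
  · intro S hS
    have hS := (Finset.mem_filter.1 hS).2
    have hu : S.filter (D.aEdge · = E') ∪ S.filter (D.aEdge · = E) = S := by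
      ext x
      simp only [Finset.mem_union, Finset.mem_filter]
      constructor
      · rintro (h | h) <;> exact h.1
      · intro hx
        have : D.aEdge x ∈ S.image D.aEdge := Finset.mem_image_of_mem _ hx
        rw [hS, Finset.mem_insert, Finset.mem_singleton] at this
        tauto
    have hd : Disjoint (S.filter (D.aEdge · = E')) (S.filter (D.aEdge · = E)) := by
      rw [Finset.disjoint_left]
      intro x hx hx'
      exact h ((Finset.mem_filter.1 hx').2.symm.trans (Finset.mem_filter.1 hx).2)
    simp only [hu]
    congr 1
    conv_lhs => rw [← hu]
    rw [Finset.card_union_of_disjoint hd, pow_add, mul_comm]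

theorem aEdge_mem_edgeSet (hD : D.IsAAdequate) {E : Sym2 D.AVertex} :
    E ∈ D.reducedAGraph.edgeSet ↔ ∃ x, D.aEdge x = E := by
  rw [reducedAGraph, SimpleGraph.edgeSet_fromEdgeSet]
  constructor
  · exact fun h => h.1
  · rintro ⟨x, rfl⟩
    exact ⟨⟨x, rfl⟩, hD x⟩

open Classical in
/-- The signed number of states of excess two whose `B`-splicings are in two given classes of
parallel crossings. -/
theorem sum_excess_pair (hD : D.IsAAdequate) {E E' : Sym2 D.AVertex} (hne : E ≠ E')
    (hE : ∃ x, D.aEdge x = E) (hE' : ∃ x, D.aEdge x = E') :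
    ∑ S with S.image D.aEdge = {E, E'}, (-1 : ℤ) ^ S.card * (if D.excess S = 2 then 1 else 0) =
    if ∃ V, D.Mixed V E E' then 0 else 1 := by
  have hEc : (D.edgeClass E).Nonempty := hE.imp fun x hx => mem_edgeClass.2 hx
  have hEc' : (D.edgeClass E').Nonempty := hE'.imp fun x hx => mem_edgeClass.2 hx
  by_cases hadj : ∃ V, V ∈ E ∧ V ∈ E'
  · obtain ⟨V, hVE, hVE'⟩ := hadj
    obtain ⟨W, rfl⟩ := hVE
    obtain ⟨W', rfl⟩ := hVE'
    have hWW' : W ≠ W' := by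
      rintro rfl
      exact hne rfl
    rw [sum_image_eq_pair hne]
    have := sum_excess_adjacent hD hWW' hEc hEc'
    simp only [ite_and] at this ⊢
    rw [this]
    have hiff : (∃ V', D.Mixed V' s(V, W) s(V, W')) ↔ ¬ D.Separated V s(V, W) s(V, W') := by
      constructor
      · rintro ⟨V', -, -, -, h1, h2, h3⟩
        have : V' = V := by
          rw [Sym2.mem_iff] at h1 h2
          have := ne_of_aEdge_eq hD hE.choose_spec
          rcases h1 with h1 | h1
          · exact h1
          · rcases h2 with h2 | h2
            · exact h2
            · exact absurd (h1.symm.trans h2) hWW'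
        exact this ▸ h3
      · intro h
        exact ⟨V, hne, (aEdge_mem_edgeSet hD).2 hE, (aEdge_mem_edgeSet hD).2 hE',
          Sym2.mem_mk_left _ _, Sym2.mem_mk_left _ _, h⟩
    rw [hiff]
    by_cases hs : D.Separated V s(V, W) s(V, W') <;> simp [hs]
  · have hnm : ¬ ∃ V, D.Mixed V E E' := by
      rintro ⟨V, -, -, -, h1, h2, -⟩
      exact hadj ⟨V, h1, h2⟩
    rw [if_neg hnm]
    -- For disjoint edges the crossings of `E'` touch neither `V` nor `W`, so the two classes
    -- contribute 1 each independently of the choice of crossings.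
    have hS : ∀ S : Finset X, S.image D.aEdge = {E, E'} → D.excess S = 2 := by
      intro S hS
      obtain ⟨x, hx, hxE⟩ := Finset.mem_image.1
        (hS ▸ Finset.mem_insert_self E {E'} : E ∈ S.image D.aEdge)
      obtain ⟨y, hy, hyE⟩ := Finset.mem_image.1
        (hS ▸ Finset.mem_insert_of_mem (Finset.mem_singleton_self E') : E' ∈ S.image D.aEdge)
      obtain ⟨V, W, rfl⟩ : ∃ V W, E = s(V, W) := ⟨_, _, hxE.symm⟩
      have hmem : ∀ w ∈ S, D.aEdge w = s(V, W) ∨ D.aEdge w = E' := by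
        intro w hw
        have := Finset.mem_image_of_mem D.aEdge hw
        rwa [hS, Finset.mem_insert, Finset.mem_singleton] at this
      set S₁ := S.filter fun w => D.aEdge w = E' with hS₁
      have hS₁E : ∀ w ∈ S₁, D.aEdge w = E' := fun w hw => (Finset.mem_filter.1 hw).2
      have hS₂E : ∀ w ∈ S.filter (fun w => ¬ D.aEdge w = E'), D.aEdge w = s(V, W) := fun w hw =>
        (hmem w (Finset.mem_filter.1 hw).1).resolve_right (Finset.mem_filter.1 hw).2
      have hVn : ∀ w ∈ S₁, V ∉ D.aEdge w := fun w hw h =>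
        hadj ⟨V, Sym2.mem_mk_left _ _, hS₁E w hw ▸ h⟩
      have hWn : ∀ w ∈ S₁, W ∉ D.aEdge w := fun w hw h =>
        hadj ⟨W, Sym2.mem_mk_right _ _, hS₁E w hw ▸ h⟩
      rw [← Finset.filter_union_filter_not_eq (fun x => D.aEdge x = E') S,
        excess_union_of_circleOf_eq hD (W := W) ⟨x, Finset.mem_filter.2 ⟨hx, by
          rw [hxE]; exact hne⟩⟩ hWn,
        excess_of_parallel hD ⟨y, Finset.mem_filter.2 ⟨hy, hyE⟩⟩ hS₁E]
      · intro w hw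
        rw [hS₂E w hw]
        exact Sym2.mem_mk_right _ _
      · have hside : ∀ a : X × ZMod 4, EvenEnd a → a.1 ∈ S.filter (fun w => ¬ D.aEdge w = E') →
            D.circleOf ∅ (ccw (ccw a)) = W → D.circleOf ∅ a = V := by
          intro a ha haS haW
          have h := ha.stateEdge_eq (D := D) ∅
          rw [haW] at h
          exact (Sym2.congr_left.1 ((hS₂E _ haS).symm.trans h)).symm
        intro a b ha hb haS hbS haW hbW
        have := circleOf_union_eq (t := ∅) hVn (hside a ha haS haW) (hside b hb hbS hbW)
        rwa [Finset.empty_union] at this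
    have h1 : ∑ S with S.image D.aEdge = {E, E'},
        (-1 : ℤ) ^ S.card * (if D.excess S = 2 then 1 else 0) =
        ∑ S ∈ (Finset.univ : Finset X).powerset with S.image D.aEdge = {E, E'},
          (-1 : ℤ) ^ S.card := by
      rw [Finset.powerset_univ]
      refine Finset.sum_congr rfl fun S hS' => ?_
      rw [if_pos (hS S (Finset.mem_filter.1 hS').2), mul_one]
    rw [h1, Finset.sum_powerset_image_eq, Finset.card_pair hne]
    · norm_num
    · intro F hF
      rw [Finset.mem_insert, Finset.mem_singleton] at hF
      rcases hF with rfl | rfl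
      · exact Finset.mem_image.2 (hE.imp fun x hx => ⟨Finset.mem_univ _, hx⟩)
      · exact Finset.mem_image.2 (hE'.imp fun x hx => ⟨Finset.mem_univ _, hx⟩)

end Pairs

end LinkDiagram

/-! ### Signed sums over the states of given excess. -/

namespace LinkDiagram

variable {X : Type*} [Fintype X] [DecidableEq X] {D : LinkDiagram X}

open Classical in
variable (D) in
/-- The edges of the reduced `A`-graph. -/
noncomputable def edges : Finset (Sym2 D.AVertex) := Finset.univ.image D.aEdge

theorem mem_edges {E : Sym2 D.AVertex} : E ∈ D.edges ↔ ∃ x, D.aEdge x = E := by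
  simp [edges]

theorem coe_edges (hD : D.IsAAdequate) : (D.edges : Set (Sym2 D.AVertex)) =
    D.reducedAGraph.edgeSet := by
  ext E
  rw [Finset.mem_coe, mem_edges, aEdge_mem_edgeSet hD]

theorem card_edges (hD : D.IsAAdequate) : D.edges.card = D.e := by
  rw [e, ← coe_edges hD, Set.ncard_coe_finset]

open Classical in
theorem sum_eq_sum_edges (f : Finset X → ℤ) :
    ∑ S : Finset X, f S = ∑ T ∈ D.edges.powerset, ∑ S with S.image D.aEdge = T, f S := by
  refine (Finset.sum_fiberwise_of_maps_to (fun S _ => ?_) f).symm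
  rw [Finset.mem_powerset]
  exact Finset.image_subset_image (Finset.subset_univ _)

section ExcessOne

open Classical in
theorem excess_eq_zero_iff (hD : D.IsAAdequate) (S : Finset X) : D.excess S = 0 ↔ S = ∅ := by
  constructor
  · intro h
    by_contra hne
    obtain ⟨x, hx⟩ := Finset.nonempty_iff_ne_empty.2 hne
    have h1 := excess_mono (D := D) (Finset.singleton_subset_iff.2 hx)
    rw [excess_singleton hD] at h1
    omega
  · rintro rfl
    exact D.excess_empty

open Classical in
theorem two_le_excess (hD : D.IsAAdequate) {S : Finset X} (h : 2 ≤ (S.image D.aEdge).card) :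
    2 ≤ D.excess S := by
  obtain ⟨a, ha, b, hb, hab⟩ := Finset.one_lt_card.1 h
  obtain ⟨x, hx, rfl⟩ := Finset.mem_image.1 ha
  obtain ⟨y, hy, rfl⟩ := Finset.mem_image.1 hb
  rw [← excess_pair hD hab]
  refine excess_mono ?_
  intro w hw
  simp only [Finset.mem_insert, Finset.mem_singleton] at hw
  rcases hw with rfl | rfl <;> assumption

open Classical in
theorem excess_eq_one_iff (hD : D.IsAAdequate) (S : Finset X) :
    D.excess S = 1 ↔ (S.image D.aEdge).card = 1 := by
  constructor
  · intro h
    have h1 : ¬ 2 ≤ (S.image D.aEdge).card := fun h2 => by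
      have := two_le_excess hD h2
      omega
    have h2 : (S.image D.aEdge).card ≠ 0 := by
      rw [Finset.card_ne_zero, Finset.image_nonempty, Finset.nonempty_iff_ne_empty]
      rintro rfl
      rw [excess_empty] at h
      omega
    omega
  · intro h
    obtain ⟨E, hE⟩ := Finset.card_eq_one.1 h
    have hne : S.Nonempty := by
      rw [← Finset.image_nonempty (f := D.aEdge), hE]
      exact Finset.singleton_nonempty _
    refine excess_of_parallel hD hne (E := E) fun x hx => ?_
    have := Finset.mem_image_of_mem D.aEdge hx
    rwa [hE, Finset.mem_singleton] at this

-- The states of excess 1 are the nonempty subsets of the single parallel classes.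
open Classical in
theorem sum_excess_one (hD : D.IsAAdequate) (f : Finset X → ℤ) :
    ∑ S : Finset X, (-1 : ℤ) ^ S.card * f S * (if D.excess S = 1 then 1 else 0) =
    ∑ E ∈ D.edges, ∑ S ∈ (D.edgeClass E).powerset.erase ∅, (-1 : ℤ) ^ S.card * f S := by
  have h1 : ∀ E, (D.edgeClass E).powerset.erase ∅ =
      Finset.univ.filter fun S : Finset X => S.image D.aEdge = {E} := by
    intro E
    ext S
    simp only [Finset.mem_erase, Finset.mem_powerset, Finset.mem_filter, Finset.mem_univ, true_and]
    constructor
    · rintro ⟨hne, hS⟩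
      obtain ⟨x, hx⟩ := Finset.nonempty_iff_ne_empty.2 hne
      refine Finset.eq_singleton_iff_nonempty_unique_mem.2 ⟨⟨_, Finset.mem_image_of_mem _ hx⟩, ?_⟩
      intro F hF
      obtain ⟨y, hy, rfl⟩ := Finset.mem_image.1 hF
      exact mem_edgeClass.1 (hS hy)
    · intro h
      constructor
      · rintro rfl
        exact absurd h.symm (by simp)
      · intro x hx
        rw [mem_edgeClass, ← Finset.mem_singleton, ← h]
        exact Finset.mem_image_of_mem _ hx
  rw [sum_eq_sum_edges, ← Finset.sum_subset
    (s₁ := D.edges.map ⟨_, Finset.singleton_injective⟩), Finset.sum_map]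
  · refine Finset.sum_congr rfl fun E _ => ?_
    rw [h1]
    refine Finset.sum_congr rfl fun S hS => ?_
    have hS : S.image D.aEdge = {E} := (Finset.mem_filter.1 hS).2
    rw [if_pos ((excess_eq_one_iff hD S).2 (by rw [hS, Finset.card_singleton])), mul_one]
  · intro T hT
    obtain ⟨E, hE, rfl⟩ := Finset.mem_map.1 hT
    exact Finset.mem_powerset.2 (Finset.singleton_subset_iff.2 hE)
  · intro T hT hT'
    refine Finset.sum_eq_zero fun S hS => ?_
    have hS : S.image D.aEdge = T := (Finset.mem_filter.1 hS).2
    rw [if_neg, mul_zero]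
    rw [excess_eq_one_iff hD, hS]
    intro h
    obtain ⟨E, rfl⟩ := Finset.card_eq_one.1 h
    refine hT' (Finset.mem_map.2 ⟨E, ?_, rfl⟩)
    exact Finset.singleton_subset_iff.1 (Finset.mem_powerset.1 hT)

theorem sum_sign_excess_one (hD : D.IsAAdequate) :
    ∑ S : Finset X, (-1 : ℤ) ^ S.card * (if D.excess S = 1 then 1 else 0) = -D.e := by
  classical
  have h := sum_excess_one hD fun _ => 1
  simp only [mul_one] at h
  rw [h, ← card_edges hD, Finset.card_eq_sum_ones, Nat.cast_sum, ← Finset.sum_neg_distrib]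
  refine Finset.sum_congr rfl fun E hE => ?_
  have hne : (D.edgeClass E).Nonempty := (mem_edges.1 hE).imp fun x hx => mem_edgeClass.2 hx
  have := Finset.sum_powerset_neg_one_pow_card_of_nonempty hne
  rw [← Finset.add_sum_erase _ _ (Finset.empty_mem_powerset _)] at this
  simp only [Finset.card_empty, pow_zero] at this
  push_cast
  linarith

theorem multiplicity_eq (E : Sym2 D.AVertex) : D.multiplicity E = (D.edgeClass E).card := by
  rw [multiplicity, ← Set.ncard_coe_finset]
  congr 1
  ext x
  simp [mem_edgeClass]

open Classical in
theorem μ_eq (hD : D.IsAAdequate) :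
    D.μ = (D.edges.filter fun E => 1 < (D.edgeClass E).card).card := by
  rw [μ, ← Set.ncard_coe_finset]
  congr 1
  ext E
  rw [Finset.mem_coe, Finset.mem_filter, Set.mem_ofPred_eq, ← coe_edges hD, multiplicity_eq,
    Finset.mem_coe]

/-- Each simple edge contributes `-1` and each multiple edge `0`. -/
theorem sum_card_excess_one (hD : D.IsAAdequate) :
    ∑ S : Finset X, (-1 : ℤ) ^ S.card * S.card * (if D.excess S = 1 then 1 else 0) =
      D.μ - D.e := by
  classical
  rw [sum_excess_one hD fun S => (S.card : ℤ), ← card_edges hD, μ_eq hD, Finset.card_filter,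
    Finset.card_eq_sum_ones]
  push_cast
  rw [← Finset.sum_sub_distrib]
  refine Finset.sum_congr rfl fun E hE => ?_
  have hne : (D.edgeClass E).Nonempty := (mem_edges.1 hE).imp fun x hx => mem_edgeClass.2 hx
  have := Finset.sum_powerset_neg_one_pow_card_mul_card (D.edgeClass E)
  rw [← Finset.add_sum_erase _ _ (Finset.empty_mem_powerset _)] at this
  simp only [Finset.card_empty, pow_zero, Nat.cast_zero, mul_zero, zero_add] at this
  rw [this]
  have hpos := hne.card_pos
  split_ifs <;> omega

end ExcessOne

section ExcessTwo

open Classical in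
theorem sum_sign_image_eq {T : Finset (Sym2 D.AVertex)} (hT : T ⊆ D.edges) :
    ∑ S : Finset X with S.image D.aEdge = T, (-1 : ℤ) ^ S.card = (-1) ^ T.card := by
  rw [← Finset.sum_powerset_image_eq Finset.univ D.aEdge hT, Finset.powerset_univ]

open Classical in
theorem sum_excess_two_of_card_eq_two (hD : D.IsAAdequate) {T : Finset (Sym2 D.AVertex)}
    (hT : T ⊆ D.edges) (hT2 : T.card = 2) :
    ∑ S with S.image D.aEdge = T, (-1 : ℤ) ^ S.card * (if D.excess S = 2 then 1 else 0) =
    if ∃ V E E', T = {E, E'} ∧ D.Mixed V E E' then 0 else 1 := by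
  obtain ⟨E, E', hne, rfl⟩ := Finset.card_eq_two.1 hT2
  have hE := mem_edges.1 (hT (Finset.mem_insert_self _ _))
  have hE' := mem_edges.1 (hT (Finset.mem_insert_of_mem (Finset.mem_singleton_self _)))
  have h1 := sum_excess_pair hD hne hE hE'
  have h2 := sum_excess_pair hD hne.symm hE' hE
  rw [Finset.pair_comm, h1] at h2
  -- Being separated is defined with an order of the two edges. Its symmetry is read off from the
  -- signed sum, which is the same for both orders.
  have hsymm : (∃ V, D.Mixed V E E') ↔ ∃ V, D.Mixed V E' E := by
    by_cases ha : ∃ V, D.Mixed V E E' <;> by_cases hb : ∃ V, D.Mixed V E' E <;>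
      simp [ha, hb] at h2 ⊢
  rw [h1]
  refine if_congr ⟨fun ⟨V, h⟩ => ⟨V, E, E', rfl, h⟩, ?_⟩ rfl rfl
  rintro ⟨V, F, F', hF, h⟩
  have hFF' : s(E, E') = s(F, F') := by
    refine Sym2.ext fun Y => ?_
    have := Finset.ext_iff.1 hF Y
    simpa [Sym2.mem_iff] using this
  rcases Sym2.eq_iff.1 hFF' with ⟨rfl, rfl⟩ | ⟨rfl, rfl⟩
  · exact ⟨V, h⟩
  · exact hsymm.2 ⟨V, h⟩

open Classical in
theorem sum_excess_two_of_card_eq_three (hD : D.IsAAdequate) {T : Finset (Sym2 D.AVertex)}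
    (hT : T ⊆ D.edges) (hT3 : T.card = 3) :
    ∑ S with S.image D.aEdge = T, (-1 : ℤ) ^ S.card * (if D.excess S = 2 then 1 else 0) =
    if ∃ U V W, T = {s(U, V), s(U, W), s(V, W)} then -1 else 0 := by
  split_ifs with h
  · obtain ⟨U, V, W, rfl⟩ := h
    have hsign := sum_sign_image_eq hT
    rw [hT3, show (-1 : ℤ) ^ 3 = -1 by norm_num] at hsign
    refine Eq.trans (Finset.sum_congr rfl fun S hS => ?_) hsign
    have hS : S.image D.aEdge = {s(U, V), s(U, W), s(V, W)} := (Finset.mem_filter.1 hS).2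
    have hmem : ∀ F, F ∈ S.image D.aEdge ↔ F = s(U, V) ∨ F = s(U, W) ∨ F = s(V, W) := by
      intro F
      rw [hS, Finset.mem_insert, Finset.mem_insert, Finset.mem_singleton]
    rw [if_pos, mul_one]
    refine excess_of_isTriangle hD (fun x hx => (hmem _).1 (Finset.mem_image_of_mem _ hx)) ?_ ?_ ?_
    · exact Finset.mem_image.1 ((hmem _).2 (Or.inl rfl))
    · exact Finset.mem_image.1 ((hmem _).2 (Or.inr (Or.inl rfl)))
    · exact Finset.mem_image.1 ((hmem _).2 (Or.inr (Or.inr rfl)))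
  · refine Finset.sum_eq_zero fun S hS => ?_
    have hS : S.image D.aEdge = T := (Finset.mem_filter.1 hS).2
    obtain ⟨a, b, c, hab, hac, hbc, rfl⟩ := Finset.card_eq_three.1 hT3
    have hmem : ∀ F, F = a ∨ F = b ∨ F = c → F ∈ S.image D.aEdge := by
      intro F hF
      rw [hS, Finset.mem_insert, Finset.mem_insert, Finset.mem_singleton]
      exact hF
    obtain ⟨x, hx, rfl⟩ := Finset.mem_image.1 (hmem a (Or.inl rfl))
    obtain ⟨y, hy, rfl⟩ := Finset.mem_image.1 (hmem b (Or.inr (Or.inl rfl)))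
    obtain ⟨z, hz, rfl⟩ := Finset.mem_image.1 (hmem c (Or.inr (Or.inr rfl)))
    have := three_le_excess_of_not_isTriangle hD hx hy hz hab hac hbc (by
      rintro ⟨U, V, W, h1, h2, h3⟩
      exact h ⟨U, V, W, by rw [h1, h2, h3]⟩)
    rw [if_neg (by omega), mul_zero]

open Classical in
theorem θ_eq (hD : D.IsAAdequate) :
    D.θ = ((D.edges.powersetCard 2).filter fun T =>
      ∃ V E E', T = {E, E'} ∧ D.Mixed V E E').card := by
  rw [θ, ← Set.ncard_coe_finset]
  have hinj : Function.Injective (Sym2.toFinset : Sym2 (Sym2 D.AVertex) → _) := by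
    intro P Q h
    refine Sym2.ext fun Y => ?_
    rw [← Sym2.mem_toFinset, h, Sym2.mem_toFinset]
  rw [← Set.ncard_image_of_injective _ hinj]
  congr 1
  have hpair : ∀ E E' : Sym2 D.AVertex, Sym2.toFinset s(E, E') = {E, E'} := by
    intro E E'
    ext F
    simp [Sym2.mem_toFinset]
  ext T
  rw [Set.mem_image, Finset.mem_coe, Finset.mem_filter, Finset.mem_powersetCard]
  constructor
  · rintro ⟨_, ⟨V, E, E', rfl, h⟩, rfl⟩
    rw [hpair]
    refine ⟨⟨?_, Finset.card_pair h.1⟩, V, E, E', rfl, h⟩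
    intro F hF
    rw [Finset.mem_insert, Finset.mem_singleton] at hF
    rw [← Finset.mem_coe, coe_edges hD]
    rcases hF with rfl | rfl
    · exact h.2.1
    · exact h.2.2.1
  · rintro ⟨-, V, E, E', rfl, h⟩
    exact ⟨s(E, E'), ⟨V, E, E', rfl, h⟩, hpair E E'⟩

open Classical in
theorem τ_eq (hD : D.IsAAdequate) :
    D.τ = ((D.edges.powersetCard 3).filter fun T =>
      ∃ U V W, T = {s(U, V), s(U, W), s(V, W)}).card := by
  rw [τ, ← Set.ncard_coe_finset]
  -- `ψ` turns the vertex set of a triangle into the set of its sides.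
  set ψ : Finset D.AVertex → Finset (Sym2 D.AVertex) := fun t => t.sym2.filter (¬ ·.IsDiag) with hψ
  have hmem : ∀ t u w, s(u, w) ∈ ψ t ↔ (u ∈ t ∧ w ∈ t) ∧ u ≠ w := by
    intro t u w
    rw [hψ, Finset.mem_filter, Finset.mk_mem_sym2_iff, Sym2.mk_isDiag_iff]
  have hinj : Set.InjOn ψ {t | D.reducedAGraph.IsNClique 3 t} := by
    have key : ∀ t t' : Finset D.AVertex, t.card = 3 → ψ t = ψ t' → t ⊆ t' := by
      intro t t' ht h u hu
      obtain ⟨w, hw, hne⟩ := Finset.exists_mem_ne (by omega : 1 < t.card) u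
      have := (hmem t u w).2 ⟨⟨hu, hw⟩, hne.symm⟩
      rw [h, hmem] at this
      exact this.1.1
    intro t ht t' ht' h
    exact (key t t' ht.card_eq h).antisymm (key t' t ht'.card_eq h.symm)
  have htri : ∀ a b c, a ≠ b → a ≠ c → b ≠ c → ψ {a, b, c} = {s(a, b), s(a, c), s(b, c)} := by
    intro a b c hab hac hbc
    ext F
    induction F with
    | h u w =>
      rw [hmem]
      simp only [Finset.mem_insert, Finset.mem_singleton, Sym2.eq_iff]
      constructor
      · rintro ⟨⟨rfl | rfl | rfl, rfl | rfl | rfl⟩, h⟩ <;> simp_all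
      · rintro ((⟨rfl, rfl⟩ | ⟨rfl, rfl⟩) | (⟨rfl, rfl⟩ | ⟨rfl, rfl⟩) | ⟨rfl, rfl⟩ | ⟨rfl, rfl⟩) <;>
          simp_all [Ne.symm]
  rw [← Set.InjOn.ncard_image hinj]
  congr 1
  have hadj : ∀ a b, D.reducedAGraph.Adj a b ↔ s(a, b) ∈ D.edges := by
    intro a b
    rw [← SimpleGraph.mem_edgeSet, ← coe_edges hD, Finset.mem_coe]
  ext T
  rw [Set.mem_image, Finset.mem_coe, Finset.mem_filter, Finset.mem_powersetCard]
  constructor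
  · rintro ⟨t, ht, rfl⟩
    obtain ⟨a, b, c, hab, hac, hbc, rfl⟩ := SimpleGraph.is3Clique_iff.1 ht
    rw [htri a b c hab.ne hac.ne hbc.ne]
    refine ⟨⟨?_, ?_⟩, a, b, c, rfl⟩
    · intro F hF
      simp only [Finset.mem_insert, Finset.mem_singleton] at hF
      rcases hF with rfl | rfl | rfl
      · exact (hadj _ _).1 hab
      · exact (hadj _ _).1 hac
      · exact (hadj _ _).1 hbc
    · have := hab.ne
      have := hac.ne
      have := hbc.ne
      rw [Finset.card_eq_three]
      refine ⟨_, _, _, ?_, ?_, ?_, rfl⟩ <;> simp only [ne_eq, Sym2.eq_iff] <;> grind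
  · rintro ⟨⟨hT, -⟩, a, b, c, rfl⟩
    have hab := (hadj a b).2 (hT (by simp))
    have hac := (hadj a c).2 (hT (by simp))
    have hbc := (hadj b c).2 (hT (by simp))
    exact ⟨{a, b, c}, SimpleGraph.is3Clique_iff.2 ⟨a, b, c, hab, hac, hbc, rfl⟩,
      htri a b c hab.ne hac.ne hbc.ne⟩

/-- Only sets of two or three reduced edges contribute: smaller ones have excess at most 1, larger
ones at least 3. Unmixed pairs give 1, mixed pairs 0 and triangles `-1`. -/
theorem sum_sign_excess_two (hD : D.IsAAdequate) :
    ∑ S : Finset X, (-1 : ℤ) ^ S.card * (if D.excess S = 2 then 1 else 0) =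
      (D.e.choose 2 : ℤ) - D.θ - D.τ := by
  classical
  rw [sum_eq_sum_edges]
  have hsplit : ∀ T ∈ D.edges.powerset,
      ∑ S with S.image D.aEdge = T, (-1 : ℤ) ^ S.card * (if D.excess S = 2 then 1 else 0) =
      (if T.card = 2 then (if ∃ V E E', T = {E, E'} ∧ D.Mixed V E E' then 0 else 1) else 0) +
      (if T.card = 3 then (if ∃ U V W, T = {s(U, V), s(U, W), s(V, W)} then -1 else 0) else 0) := by
    intro T hT
    rw [Finset.mem_powerset] at hT
    by_cases h2 : T.card = 2
    · have h3 : T.card ≠ 3 := by omega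
      rw [if_pos h2, if_neg h3, add_zero]
      exact sum_excess_two_of_card_eq_two hD hT h2
    by_cases h3 : T.card = 3
    · rw [if_neg h2, if_pos h3, zero_add]
      exact sum_excess_two_of_card_eq_three hD hT h3
    rw [if_neg h2, if_neg h3, add_zero]
    refine Finset.sum_eq_zero fun S hS => ?_
    have hS : S.image D.aEdge = T := (Finset.mem_filter.1 hS).2
    rw [if_neg, mul_zero]
    intro h
    have h4 : ¬ 4 ≤ T.card := fun h4 => by
      have := three_le_excess_of_four_le_card hD (S := S) (by rwa [hS])
      omega
    have h0 : T.card ≠ 0 := by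
      rw [← hS, Finset.card_ne_zero, Finset.image_nonempty, Finset.nonempty_iff_ne_empty]
      rintro rfl
      rw [excess_empty] at h
      omega
    have h1 : T.card = 1 := by omega
    rw [← hS, ← excess_eq_one_iff hD] at h1
    omega
  rw [Finset.sum_congr rfl hsplit, Finset.sum_add_distrib, ← Finset.sum_filter,
    ← Finset.sum_filter, ← Finset.powersetCard_eq_filter, ← Finset.powersetCard_eq_filter,
    θ_eq hD, τ_eq hD, ← card_edges hD, ← Finset.card_powersetCard]
  have a1 : ∑ T ∈ D.edges.powersetCard 2,
      (if ∃ V E E', T = {E, E'} ∧ D.Mixed V E E' then (0 : ℤ) else 1) =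
      (D.edges.powersetCard 2).card - ((D.edges.powersetCard 2).filter fun T =>
        ∃ V E E', T = {E, E'} ∧ D.Mixed V E E').card := by
    rw [Finset.card_filter, Finset.card_eq_sum_ones]
    push_cast
    rw [← Finset.sum_sub_distrib]
    refine Finset.sum_congr rfl fun T _ => ?_
    split_ifs <;> norm_num
  have a2 : ∑ T ∈ D.edges.powersetCard 3,
      (if ∃ U V W, T = {s(U, V), s(U, W), s(V, W)} then (-1 : ℤ) else 0) =
      - ((D.edges.powersetCard 3).filter fun T =>
        ∃ U V W, T = {s(U, V), s(U, W), s(V, W)}).card := by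
    rw [Finset.card_filter]
    push_cast
    rw [← Finset.sum_neg_distrib]
    refine Finset.sum_congr rfl fun T _ => ?_
    split_ifs <;> norm_num
  rw [a1, a2]
  ring

end ExcessTwo

/-! ### Expansion of the bracket. -/

section Bracket

theorem card_circle_pos (s : Finset X) : 0 < Nat.card (D.Circle s) := by
  rw [Nat.card_pos_iff]
  refine ⟨?_, inferInstance⟩
  rcases D.nonempty with ⟨⟨x⟩⟩ | h
  · exact ⟨D.circleOf s (x, 0)⟩
  · exact ⟨Sum.inr ⟨0, h⟩⟩

/-- The contribution of a state to the bracket, up to terms of low degree. -/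
theorem bracket_term (hD : D.IsAAdequate) (s : Finset X) :
    (T ((sᶜ.card : ℤ) - (s.card : ℤ)) * (-T 2 - T (-2)) ^ (Nat.card (D.Circle s) - 1) : ℤ[T;T⁻¹]) -
      (C (-(-1) ^ D.v * ((-1) ^ s.card * (if D.excess s = 0 then 1 else 0)) : ℤ) *
        (T (Fintype.card X + 2 * D.v - 2) + C ((D.v : ℤ) - 1) * T (Fintype.card X + 2 * D.v - 6) +
          C ((D.v - 1).choose 2 : ℤ) * T (Fintype.card X + 2 * D.v - 10)) +
      (C (-(-1) ^ D.v * ((-1) ^ s.card * (if D.excess s = 1 then 1 else 0)) : ℤ) *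
        (T (Fintype.card X + 2 * D.v - 6) +
          C ((D.v : ℤ) - 3) * T (Fintype.card X + 2 * D.v - 10)) +
        C (-(-1) ^ D.v * ((-1) ^ s.card * s.card * (if D.excess s = 1 then 1 else 0)) : ℤ) *
          T (Fintype.card X + 2 * D.v - 10)) +
      C (-(-1) ^ D.v * ((-1) ^ s.card * (if D.excess s = 2 then 1 else 0)) : ℤ) *
        T (Fintype.card X + 2 * D.v - 10)) ∈ below (Fintype.card X + 2 * D.v - 10) := by
  obtain ⟨n, hn⟩ : ∃ n, Nat.card (D.Circle s) = n + 1 :=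
    ⟨_, (Nat.succ_pred_eq_of_pos (card_circle_pos s)).symm⟩
  have hv := D.v_add_card s
  rw [hn] at hv ⊢
  rw [Nat.add_sub_cancel]
  have hc : (sᶜ.card : ℤ) = Fintype.card X - s.card := by
    rw [Finset.card_compl, Nat.cast_sub (Finset.card_le_univ _)]
  rw [hc]
  set k := D.excess s with hk
  have hsign : (-1 : ℤ) ^ n = -((-1) ^ D.v * (-1) ^ s.card) := by
    rw [← pow_add, hv]
    rw [pow_add, pow_add, pow_mul]
    norm_num
  have h1 := T_mul_mem_below ((Fintype.card X : ℤ) - s.card - s.card) (neg_T_sub_T_pow n)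
  rw [mul_sub] at h1
  have h1' := below_mono (N := Fintype.card X + 2 * D.v - 10) (by omega) h1
  have htrans : ∀ {N : ℤ} {p q r : ℤ[T;T⁻¹]}, p - q ∈ below N → q - r ∈ below N →
      p - r ∈ below N := fun h h' => by
    rw [← sub_add_sub_cancel]
    exact add_mem h h'
  refine htrans h1' ?_
  -- With `n = v + |s| - 2k - 1` the cardinality of `s` cancels from all exponents.
  have e1 : (T ((Fintype.card X : ℤ) - s.card - s.card) * (C ((-1) ^ n) * (T (2 * n) +
      C (n : ℤ) * T (2 * n - 4) + C (n.choose 2 : ℤ) * T (2 * n - 8))) : ℤ[T;T⁻¹]) =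
      C ((-1) ^ n) * (T (Fintype.card X + 2 * D.v - 2 - 4 * k) +
        C (n : ℤ) * T (Fintype.card X + 2 * D.v - 6 - 4 * k) +
        C (n.choose 2 : ℤ) * T (Fintype.card X + 2 * D.v - 10 - 4 * k)) := by
    have b1 : (T (Fintype.card X + 2 * D.v - 2 - 4 * k) : ℤ[T;T⁻¹]) =
        T ((Fintype.card X : ℤ) - s.card - s.card) * T (2 * n) := by
      rw [← T_add]; congr 1; omega
    have b2 : (T (Fintype.card X + 2 * D.v - 6 - 4 * k) : ℤ[T;T⁻¹]) =
        T ((Fintype.card X : ℤ) - s.card - s.card) * T (2 * n - 4) := by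
      rw [← T_add]; congr 1; omega
    have b3 : (T (Fintype.card X + 2 * D.v - 10 - 4 * k) : ℤ[T;T⁻¹]) =
        T ((Fintype.card X : ℤ) - s.card - s.card) * T (2 * n - 8) := by
      rw [← T_add]; congr 1; omega
    rw [b1, b2, b3]
    ring
  rw [e1, hsign]
  have hk4 : k = 0 ∨ k = 1 ∨ k = 2 ∨ 3 ≤ k := by omega
  rcases hk4 with h | h | h | h
  · have hs := (excess_eq_zero_iff hD s).1 (hk.symm.trans h)
    have hcard : s.card = 0 := by rw [hs, Finset.card_empty]
    have hnv : (n : ℤ) = D.v - 1 := by omega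
    have hnv' : n = D.v - 1 := by omega
    rw [h, hnv, ← hnv', hcard]
    convert (below ((Fintype.card X : ℤ) + 2 * D.v - 10)).zero_mem using 1
    simp
  · rw [h]
    -- The second coefficient of a state of excess 1 depends on `|s|`; this is why the sum weighted
    -- by `|s|` is needed.
    have hnv : (n : ℤ) = (D.v - 3) + s.card := by omega
    have e2 : (T (Fintype.card X + 2 * D.v - 2 - 4 * (1 : ℕ)) : ℤ[T;T⁻¹]) =
      T (Fintype.card X + 2 * D.v - 6) := by congr 1; push_cast; ring
    have e3 : (T (Fintype.card X + 2 * D.v - 6 - 4 * (1 : ℕ)) : ℤ[T;T⁻¹]) =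
      T (Fintype.card X + 2 * D.v - 10) := by congr 1; push_cast; ring
    rw [e2, e3, hnv]
    have := C_mul_mem_below (-((-1) ^ D.v * (-1) ^ s.card)) (C_mul_T_mem_below (n.choose 2 : ℤ)
      (N := Fintype.card X + 2 * D.v - 10) (k := Fintype.card X + 2 * D.v - 10 - 4 * (1 : ℕ))
      (by push_cast; omega))
    convert this using 1
    simp only [one_ne_zero, if_false, if_true, OfNat.one_ne_ofNat, mul_zero, map_zero, zero_mul,
      map_neg, map_mul, map_add, mul_one, zero_add, add_zero]
    ring
  · rw [h]
    have e2 : (T (Fintype.card X + 2 * D.v - 2 - 4 * (2 : ℕ)) : ℤ[T;T⁻¹]) =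
      T (Fintype.card X + 2 * D.v - 10) := by congr 1; push_cast; ring
    rw [e2]
    have := C_mul_mem_below (-((-1) ^ D.v * (-1) ^ s.card)) (add_mem (C_mul_T_mem_below (n : ℤ)
      (N := Fintype.card X + 2 * D.v - 10) (k := Fintype.card X + 2 * D.v - 6 - 4 * (2 : ℕ))
      (by push_cast; omega)) (C_mul_T_mem_below (n.choose 2 : ℤ)
      (N := Fintype.card X + 2 * D.v - 10) (k := Fintype.card X + 2 * D.v - 10 - 4 * (2 : ℕ))
      (by push_cast; omega)))
    convert this using 1
    simp only [OfNat.ofNat_ne_zero, OfNat.ofNat_ne_one, if_false, if_true, mul_zero, map_zero,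
      zero_mul, map_neg, map_mul, mul_one, zero_add, add_zero]
    ring
  · have h0 : k ≠ 0 := by omega
    have h1 : k ≠ 1 := by omega
    have h2 : k ≠ 2 := by omega
    rw [if_neg h0, if_neg h1, if_neg h2]
    have := C_mul_mem_below (-((-1) ^ D.v * (-1) ^ s.card)) (add_mem (add_mem (T_mem_below
      (N := Fintype.card X + 2 * D.v - 10) (k := Fintype.card X + 2 * D.v - 2 - 4 * k)
      (by omega)) (C_mul_T_mem_below (n : ℤ)
      (N := Fintype.card X + 2 * D.v - 10) (k := Fintype.card X + 2 * D.v - 6 - 4 * k)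
      (by omega))) (C_mul_T_mem_below (n.choose 2 : ℤ)
      (N := Fintype.card X + 2 * D.v - 10) (k := Fintype.card X + 2 * D.v - 10 - 4 * k)
      (by omega)))
    convert this using 1
    simp

theorem sum_sign_excess_zero (hD : D.IsAAdequate) :
    ∑ S : Finset X, (-1 : ℤ) ^ S.card * (if D.excess S = 0 then 1 else 0) = 1 := by
  simp [excess_eq_zero_iff hD]

end Bracket

end LinkDiagram

theorem theorem4p1 {X : Type*} [Fintype X] [DecidableEq X] (D : LinkDiagram X)
    (hD : D.IsAAdequate) :
    ∃ R : ℤ[T;T⁻¹],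
      R.degree < (((Fintype.card X : ℤ) + 2 * (D.v : ℤ) - 10 : ℤ) : WithBot ℤ) ∧
      D.bracket =
        C (((D.v : ℤ) - 1).negOnePow : ℤ) * T ((Fintype.card X : ℤ) + 2 * (D.v : ℤ) - 2) +
        C ((((D.v : ℤ) - 2).negOnePow : ℤ) * ((D.e : ℤ) - (D.v : ℤ) + 1)) *
          T ((Fintype.card X : ℤ) + 2 * (D.v : ℤ) - 6) +
        C ((((D.v : ℤ) - 3).negOnePow : ℤ) *
            (((D.v - 1).choose 2 : ℤ) - (D.e : ℤ) * ((D.v : ℤ) - 2) + (D.μ : ℤ) +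
              (D.e.choose 2 : ℤ) - (D.θ : ℤ) - (D.τ : ℤ))) *
          T ((Fintype.card X : ℤ) + 2 * (D.v : ℤ) - 10) +
        R := by
  have hsum := sum_mem (t := Finset.univ) fun s _ => LinkDiagram.bracket_term hD s
  -- `R` is the sum of the errors of all states. The coefficient of the third term collects `binom
  -- (v-1) 2` from excess 0, `-e(v-3) + μ - e` from excess 1 and `binom e 2 - θ - τ` from excess 2.
  refine ⟨_, LaurentPolynomial.degree_lt_of_mem_below hsum, ?_⟩
  have hv : ((D.v : ℤ).negOnePow : ℤ) = (-1) ^ D.v := by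
    rw [Int.negOnePow_def]
    simp
  have s1 : (((D.v : ℤ) - 1).negOnePow : ℤ) = -(-1) ^ D.v := by
    rw [Int.negOnePow_sub, ← hv]
    simp
  have s2 : (((D.v : ℤ) - 2).negOnePow : ℤ) = (-1) ^ D.v := by
    rw [Int.negOnePow_sub, ← hv, Int.negOnePow_even 2 (by decide)]
    simp
  have s3 : (((D.v : ℤ) - 3).negOnePow : ℤ) = -(-1) ^ D.v := by
    rw [Int.negOnePow_sub, ← hv, Int.negOnePow_odd 3 (by decide)]
    simp
  rw [s1, s2, s3, Finset.sum_sub_distrib, ← LinkDiagram.bracket]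
  simp only [Finset.sum_add_distrib, ← Finset.sum_mul, ← map_sum, ← Finset.mul_sum]
  rw [LinkDiagram.sum_sign_excess_zero hD, LinkDiagram.sum_sign_excess_one hD, LinkDiagram.sum_card_excess_one hD,
    LinkDiagram.sum_sign_excess_two hD]
  simp only [map_neg, map_mul, map_sub, map_add, map_one, map_ofNat]
  ring
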